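/- Let $d\ge 2$ and regard $\mathbb{Z}^d$ as a graph with edges between vertices at $\ell^1$-distance $1$. For a finite graph $G=(V,E)$ and $x\in[0,1]$, the loop $\mathrm{O}(1)$ model $\ell_{x,G}$ is the probability measure on $\{0,1\}^E$ that gives the configuration with set of open edges $\eta\subseteq E$ the probability $x^{|\eta|}/Z$ if every vertex has even degree in $(V,\eta)$, and $0$ otherwise; here $Z=\sum_{\eta\text{ even}}x^{|\eta|}$. The loop $\mathrm{O}(1)$ model on $\mathbb{Z}^d$, denoted $\ell_{x,\mathbb{Z}^d}$, is the weak limit, as $n\to\infty$, of the measures $\ell_{x,\Lambda_n}$ on the boxes $\Lambda_n=\{-n,\dots,n\}^d$ (with their nearest-neighbour edges, and with all edges of $\mathbb{Z}^d$ outside the box declared closed); the limit exists for every $x\in[0,1]$. Write $\{0\leftrightarrow\infty\}$ for the event that there is an infinite self-avoiding path of open edges starting at $0$. Then there exists $x_0<1$ such that for all $x\in(x_0,1]$, $$\ell_{x,\mathbb{Z}^d}[0\leftrightarrow\infty]>0 .$$ Moreover the percolation phase transition of the loop $\mathrm{O}(1)$ model is non-trivial: there is also $x_1$ with $0<x_1\le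 x_0$ such that $\ell_{x,\mathbb{Z}^d}[0\leftrightarrow\infty]=0$ for all $x\in[0,x_1)$. -/

import Mathlib

open MeasureTheory Filter Topology
open scoped BoundedContinuousFunction

/-- The hypercubic lattice `ℤ^d`: nearest-neighbour graph, `u ∼ v` iff `∑ |u i - v i| = 1`. -/
def hypercubicLattice (d : ℕ) : SimpleGraph (Fin d → ℤ) where
  Adj u v := ∑ i, |u i - v i| = 1
  symm := ⟨fun u v h => by simpa only [abs_sub_comm] using h⟩
  loopless := ⟨fun u h => by simp at h⟩

/-- Percolation configurations `{0,1}^E` on the edges of `G` (`true` = open, `false` = closed),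
with the product topology and the product σ-algebra. -/
abbrev PercConfig {V : Type*} (G : SimpleGraph V) : Type _ := G.edgeSet → Bool

/-- The subgraph of open edges of a configuration. -/
def openSubgraph {V : Type*} (G : SimpleGraph V) (ω : PercConfig G) : SimpleGraph V where
  Adj u v := ∃ h : G.Adj u v, ω ⟨s(u, v), h⟩ = true
  symm := ⟨fun u v h => by
    obtain ⟨h, hω⟩ := h
    refine ⟨h.symm, ?_⟩
    rw [← hω]
    congr 2
    exact Sym2.eq_swap⟩
  loopless := ⟨fun u h => G.loopless.irrefl u h.1⟩

/-- The event `{o ↔ ∞}`: there is an infinite (self-avoiding) path of open edges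
starting at `o`. -/
def connectedToInfinity {V : Type*} (G : SimpleGraph V) (o : V) : Set (PercConfig G) :=
  {ω | ∃ γ : ℕ → V, Function.Injective γ ∧ γ 0 = o ∧
    ∀ k, (openSubgraph G ω).Adj (γ k) (γ (k + 1))}

/-- A finite set of edges is even if every vertex is incident to an even number of its edges. -/
def IsEvenEdgeSet {V : Type*} (G : SimpleGraph V) (η : Finset G.edgeSet) : Prop :=
  ∀ v : V, Even {e : G.edgeSet | e ∈ η ∧ v ∈ e.1}.ncard

open Classical in
/-- The even subgraphs of the finite subgraph of `G` with edge set `F`. -/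
noncomputable def evenSubgraphs {V : Type*} (G : SimpleGraph V) (F : Finset G.edgeSet) :
    Finset (Finset G.edgeSet) :=
  F.powerset.filter (IsEvenEdgeSet G)

/-- The partition function `Z = ∑_{η even} x^{o(η)}`. -/
noncomputable def loopO1Z {V : Type*} (G : SimpleGraph V) (F : Finset G.edgeSet) (x : ℝ) : ℝ :=
  ∑ η ∈ evenSubgraphs G F, x ^ η.card

open Classical in
/-- The configuration whose open edges are exactly those of `η`. -/
noncomputable def toConfig {V : Type*} (G : SimpleGraph V) (η : Finset G.edgeSet) :
    PercConfig G :=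
  fun e => decide (e ∈ η)

/-- The loop O(1) model (free boundary conditions) with parameter `x ∈ [0,1]` on the finite
subgraph of `G` with edge set `F`: each even `η ⊆ F` has probability `x^{o(η)} / Z`.
It is viewed as a measure on configurations of `G` in which all edges outside `F` are closed. -/
noncomputable def loopO1Finite {V : Type*} (G : SimpleGraph V) (F : Finset G.edgeSet) (x : ℝ) :
    Measure (PercConfig G) :=
  ∑ η ∈ evenSubgraphs G F,
    ENNReal.ofReal (x ^ η.card / loopO1Z G F x) • Measure.dirac (toConfig G η)

/-- The edges of `ℤ^d` with both endpoints in the box `Λ_n = {v | ∀ i, |v i| ≤ n}`. -/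
def boxEdgeSet (d n : ℕ) : Set (hypercubicLattice d).edgeSet :=
  {e | ∀ v ∈ e.1, ∀ i, |v i| ≤ (n : ℤ)}

theorem boxEdgeSet_finite (d n : ℕ) : (boxEdgeSet d n).Finite := by
  have hB : (Set.Icc (fun _ : Fin d => -(n : ℤ)) (fun _ => (n : ℤ))).Finite := Set.finite_Icc _ _
  have hP : ((fun p : (Fin d → ℤ) × (Fin d → ℤ) => s(p.1, p.2)) ''
      ((Set.Icc (fun _ : Fin d => -(n : ℤ)) (fun _ => (n : ℤ))) ×ˢ
        (Set.Icc (fun _ : Fin d => -(n : ℤ)) (fun _ => (n : ℤ))))).Finite :=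
    (hB.prod hB).image _
  refine Set.Finite.of_finite_image (f := Subtype.val) (hP.subset ?_)
    Subtype.val_injective.injOn
  rintro _ ⟨⟨e, he⟩, h, rfl⟩
  induction e using Sym2.ind with
  | _ u v =>
    have hu := h u (Sym2.mem_mk_left u v)
    have hv := h v (Sym2.mem_mk_right u v)
    exact ⟨(u, v), ⟨⟨fun i => (abs_le.1 (hu i)).1, fun i => (abs_le.1 (hu i)).2⟩,
      ⟨fun i => (abs_le.1 (hv i)).1, fun i => (abs_le.1 (hv i)).2⟩⟩, rfl⟩

/-- The loop O(1) model on the box `Λ_n` of `ℤ^d`, with free boundary conditions. -/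
noncomputable def loopO1Box (d n : ℕ) (x : ℝ) : Measure (PercConfig (hypercubicLattice d)) :=
  loopO1Finite (hypercubicLattice d) (boxEdgeSet_finite d n).toFinset x

/-- `μ` is the loop O(1) model `ℓ_{x,ℤ^d}`: the probability measure that is the weak limit
of the loop O(1) models on the boxes `Λ_n` as `n → ∞`. -/
def IsLoopO1Lattice (d : ℕ) (x : ℝ) (μ : Measure (PercConfig (hypercubicLattice d))) : Prop :=
  IsProbabilityMeasure μ ∧
    ∀ f : PercConfig (hypercubicLattice d) →ᵇ ℝ,
      Tendsto (fun n : ℕ => ∫ ω, f ω ∂(loopO1Box d n x)) atTop (𝓝 (∫ ω, f ω ∂μ))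

/-!
Existence and uniqueness of the infinite-volume measure, and percolation for small `x`, follow from
two properties of even subgraphs. The weight of the even subgraphs that agree with a given set on a
finite set of edges is, up to a factor, a correlation of the Ising model on the remaining graph in
its high-temperature expansion. These correlations increase with the graph by Griffiths' second
inequality (`bdZ_mul_le`, `bdZ_ratio_mono`), hence expectations of local functions converge
(`exists_tendsto_evE`), along any exhaustion, and the limit is unique and translation invariant
(`existsUnique_isLoopO1Lattice`, `measureReal_pathEvent`). They are at most one, hence `k` given
edges are open with probability at most `x ^ k` (`evE_subset_le`), and a union bound over
self-avoiding paths excludes percolation for `2 * d * x < 1` (`connectedToInfinity_eq_zero`).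

For `x` close to one, percolation comes from stochastic domination. Replacing `η` by its symmetric
difference with a cycle of length `k` preserves evenness and costs at most a factor `x ^ k`
(`evW_toggle`). Toggling plaquettes thus shows that suitable functions of `η` dominate Bernoulli
percolation at a parameter close to one half (`bernE_le_evE`). One half itself is not enough, and
in each dimension there is a small gain.

In dimension two, even subgraphs are the contours of spins on the faces (`spin_faceA_add`), and
the faces of either spin dominate independent site percolation at parameters up to
`x ^ 4 / (1 + x ^ 4)`. When diagonal steps are allowed, site percolation percolates already below
one half (`exists_pos_le_armProb`), since edges of the square lattice can be represented by sites,
with the additional feature that opposite open edges of a face are joined. This enhancement allows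
for a smaller parameter; the comparison is made in disjoint cells that tile the lattice
(`bernE_cell_le`, `exists_pos_le_bernE_enh`). So in a large box there are, with probability close
to one each, long connections of faces of either spin. If both are present, then the open clusters
that meet the box are not surrounded by a closed contour, for along such a contour the spin would
be constant, while both connections cross it (`exists_conn_of_arms`).

In dimension three or more, the edges of a coordinate plane dominate bond percolation at
`x ^ 4 / (1 + x ^ 4)`, by toggling plaquettes perpendicular to the plane. An edge in the first
direction can also be bypassed by three edges on one side of the plane. Given the states of all
other edges, the probability of such a detour is bounded below (`obsW_detour`), so the parameter of
this direction exceeds one half by a constant, while the other one tends to one half as `x` tends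
to one. Hence their sum exceeds one.

Both cases use that bond percolation on the square lattice percolates when the parameters of the two
directions sum to more than one (`exists_pos_le_bernE_conn`). If, on the self-dual line, the mean
number of exits from some finite set were less than one, then connection probabilities would decay
exponentially by Simon's inequality (`simon_inequality`, `bernE_conn_le_pow`), in the dual lattice as
well, which is absurd (`one_le_exitMean`). This lower bound on the number of exits is a lower bound
for the logarithmic derivative of the probability of not being connected to a large distance
(`mul_one_sub_le_deriv`), which gives percolation above the line.
-/

/-! ### Finite Bernoulli expectations -/

/-- The indicator of a proposition, as a real number. -/
noncomputable def ind (P : Prop) : ℝ := by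
  classical exact if P then 1 else 0

theorem ind_of {P : Prop} (h : P) : ind P = 1 := by simp [ind, h]

theorem ind_of_not {P : Prop} (h : ¬ P) : ind P = 0 := by simp [ind, h]

theorem ind_nonneg (P : Prop) : 0 ≤ ind P := by
  by_cases h : P <;> simp [ind, h]

theorem ind_le_one (P : Prop) : ind P ≤ 1 := by
  by_cases h : P <;> simp [ind, h]

theorem ind_mono {P Q : Prop} (h : P → Q) : ind P ≤ ind Q := by
  by_cases hP : P
  · rw [ind_of hP, ind_of (h hP)]
  · rw [ind_of_not hP]; exact ind_nonneg Q

theorem ind_congr {P Q : Prop} (h : P ↔ Q) : ind P = ind Q := by rw [propext h]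

theorem ind_and (P Q : Prop) : ind (P ∧ Q) = ind P * ind Q := by
  by_cases hP : P <;> by_cases hQ : Q <;> simp [ind, hP, hQ]

theorem ind_not (P : Prop) : ind (¬ P) = 1 - ind P := by
  by_cases hP : P <;> simp [ind, hP]

theorem ind_or_le (P Q : Prop) : ind (P ∨ Q) ≤ ind P + ind Q := by
  by_cases hP : P <;> by_cases hQ : Q <;> simp [ind, hP, hQ]

theorem ind_exists_le {ι : Type*} (s : Finset ι) (P : ι → Prop) :
    ind (∃ i ∈ s, P i) ≤ ∑ i ∈ s, ind (P i) := by
  by_cases h : ∃ i ∈ s, P i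
  · obtain ⟨i, hi, hP⟩ := h
    rw [ind_of ⟨i, hi, hP⟩, ← ind_of hP]
    exact Finset.single_le_sum (f := fun i => ind (P i)) (fun j _ => ind_nonneg _) hi
  · rw [ind_of_not h]
    exact Finset.sum_nonneg fun j _ => ind_nonneg _

section Bernoulli

variable {α : Type*} [DecidableEq α]

/-- The expectation of `f` over the random subset of the finite set `E` that contains each
`e ∈ E` independently with probability `p e`. -/
noncomputable def bernE (p : α → ℝ) (E : Finset α) (f : Finset α → ℝ) : ℝ :=
  ∑ S ∈ E.powerset, (∏ e ∈ S, p e) * (∏ e ∈ E \ S, (1 - p e)) * f S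

theorem bernE_empty (p : α → ℝ) (f : Finset α → ℝ) : bernE p ∅ f = f ∅ := by
  simp [bernE]

theorem bernE_insert (p : α → ℝ) {E : Finset α} {e : α} (he : e ∉ E) (f : Finset α → ℝ) :
    bernE p (insert e E) f =
      p e * bernE p E (fun S => f (insert e S)) + (1 - p e) * bernE p E f := by
  unfold bernE
  rw [Finset.sum_powerset_insert he, add_comm, Finset.mul_sum, Finset.mul_sum]
  congr 1
  · refine Finset.sum_congr rfl fun S hS => ?_
    have heS : e ∉ S := fun h => he (Finset.mem_powerset.1 hS h)
    rw [Finset.prod_insert heS]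
    have : insert e E \ insert e S = E \ S := by
      ext a; simp only [Finset.mem_sdiff, Finset.mem_insert]; grind
    rw [this]; ring
  · refine Finset.sum_congr rfl fun S hS => ?_
    have heS : e ∉ S := fun h => he (Finset.mem_powerset.1 hS h)
    have : insert e E \ S = insert e (E \ S) := by
      ext a; simp only [Finset.mem_sdiff, Finset.mem_insert]; grind
    rw [this, Finset.prod_insert (by simp [he])]; ring

theorem bernE_congr (p : α → ℝ) {E : Finset α} {f g : Finset α → ℝ}
    (h : ∀ S ⊆ E, f S = g S) : bernE p E f = bernE p E g :=
  Finset.sum_congr rfl fun S hS => by rw [h S (Finset.mem_powerset.1 hS)]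

theorem bernE_add (p : α → ℝ) (E : Finset α) (f g : Finset α → ℝ) :
    bernE p E (fun S => f S + g S) = bernE p E f + bernE p E g := by
  simp only [bernE, mul_add, Finset.sum_add_distrib]

theorem bernE_const_mul (p : α → ℝ) (E : Finset α) (c : ℝ) (f : Finset α → ℝ) :
    bernE p E (fun S => c * f S) = c * bernE p E f := by
  simp only [bernE, Finset.mul_sum]
  exact Finset.sum_congr rfl fun S _ => by ring

theorem bernE_mul_const (p : α → ℝ) (E : Finset α) (c : ℝ) (f : Finset α → ℝ) :
    bernE p E (fun S => f S * c) = bernE p E f * c := by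
  simp only [bernE, Finset.sum_mul]
  exact Finset.sum_congr rfl fun S _ => by ring

theorem bernE_sub (p : α → ℝ) (E : Finset α) (f g : Finset α → ℝ) :
    bernE p E (fun S => f S - g S) = bernE p E f - bernE p E g := by
  simp only [bernE, mul_sub, Finset.sum_sub_distrib]

theorem bernE_sum {ι : Type*} (p : α → ℝ) (E : Finset α) (s : Finset ι)
    (f : ι → Finset α → ℝ) :
    bernE p E (fun S => ∑ i ∈ s, f i S) = ∑ i ∈ s, bernE p E (f i) := by
  simp only [bernE, Finset.mul_sum]
  exact Finset.sum_comm

theorem bernE_const (p : α → ℝ) (E : Finset α) (c : ℝ) : bernE p E (fun _ => c) = c := by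
  induction E using Finset.induction_on with
  | empty => simp [bernE_empty]
  | insert e E he ih => rw [bernE_insert p he, ih]; ring

theorem bernE_weight_nonneg {p : α → ℝ} (h0 : ∀ e, 0 ≤ p e) (h1 : ∀ e, p e ≤ 1)
    (E S : Finset α) : 0 ≤ (∏ e ∈ S, p e) * (∏ e ∈ E \ S, (1 - p e)) :=
  mul_nonneg (Finset.prod_nonneg fun e _ => h0 e)
    (Finset.prod_nonneg fun e _ => sub_nonneg.2 (h1 e))

theorem bernE_mono {p : α → ℝ} (h0 : ∀ e, 0 ≤ p e) (h1 : ∀ e, p e ≤ 1) {E : Finset α}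
    {f g : Finset α → ℝ} (h : ∀ S ⊆ E, f S ≤ g S) : bernE p E f ≤ bernE p E g :=
  Finset.sum_le_sum fun S hS =>
    mul_le_mul_of_nonneg_left (h S (Finset.mem_powerset.1 hS)) (bernE_weight_nonneg h0 h1 E S)

theorem bernE_nonneg {p : α → ℝ} (h0 : ∀ e, 0 ≤ p e) (h1 : ∀ e, p e ≤ 1) {E : Finset α}
    {f : Finset α → ℝ} (h : ∀ S ⊆ E, 0 ≤ f S) : 0 ≤ bernE p E f := by
  have := bernE_mono h0 h1 h
  rwa [bernE_const] at this

theorem bernE_le_const {p : α → ℝ} (h0 : ∀ e, 0 ≤ p e) (h1 : ∀ e, p e ≤ 1) {E : Finset α}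
    {f : Finset α → ℝ} {c : ℝ} (h : ∀ S ⊆ E, f S ≤ c) : bernE p E f ≤ c := by
  have := bernE_mono h0 h1 h
  rwa [bernE_const] at this

theorem bernE_union (p : α → ℝ) {E₁ E₂ : Finset α} (hd : Disjoint E₁ E₂)
    (f : Finset α → ℝ) :
    bernE p (E₁ ∪ E₂) f = bernE p E₁ (fun S₁ => bernE p E₂ (fun S₂ => f (S₁ ∪ S₂))) := by
  induction E₁ using Finset.induction_on generalizing f with
  | empty => simp [bernE_empty]
  | insert e E₁ he ih =>
    rw [Finset.disjoint_insert_left] at hd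
    rw [Finset.insert_union, bernE_insert p (by simp [he, hd.1]), bernE_insert p he, ih hd.2,
      ih hd.2]
    simp only [Finset.insert_union]

/-- Functions of the configurations on two disjoint sets of coordinates are independent. -/
theorem bernE_mul_of_disjoint (p : α → ℝ) {E E₁ E₂ : Finset α} (h₁ : E₁ ⊆ E) (h₂ : E₂ ⊆ E)
    (hd : Disjoint E₁ E₂) (f g : Finset α → ℝ) :
    bernE p E (fun S => f (S ∩ E₁) * g (S ∩ E₂)) = bernE p E₁ f * bernE p E₂ g := by
  have hE : E = (E₁ ∪ E₂) ∪ (E \ (E₁ ∪ E₂)) := by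
    rw [Finset.union_sdiff_of_subset (Finset.union_subset h₁ h₂)]
  rw [hE, bernE_union p (Finset.disjoint_sdiff), bernE_union p hd, ← bernE_mul_const]
  refine bernE_congr p fun S₁ hS₁ => ?_
  rw [← bernE_const_mul]
  refine bernE_congr p fun S₂ hS₂ => ?_
  rw [← bernE_const p (E \ (E₁ ∪ E₂)) (f S₁ * g S₂)]
  refine bernE_congr p fun S₃ hS₃ => ?_
  have e1 : (S₁ ∪ S₂ ∪ S₃) ∩ E₁ = S₁ := by
    ext a
    have := @hS₁ a; have := @hS₂ a; have := @hS₃ a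
    have hda : a ∈ E₁ → a ∉ E₂ := fun h => Finset.disjoint_left.1 hd h
    simp only [Finset.mem_inter, Finset.mem_union, Finset.mem_sdiff] at *
    tauto
  have e2 : (S₁ ∪ S₂ ∪ S₃) ∩ E₂ = S₂ := by
    ext a
    have := @hS₁ a; have := @hS₂ a; have := @hS₃ a
    have hda : a ∈ E₁ → a ∉ E₂ := fun h => Finset.disjoint_left.1 hd h
    simp only [Finset.mem_inter, Finset.mem_union, Finset.mem_sdiff] at *
    tauto
  rw [e1, e2]

theorem bernE_inter (p : α → ℝ) {E E₁ : Finset α} (h₁ : E₁ ⊆ E) (f : Finset α → ℝ) :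
    bernE p E (fun S => f (S ∩ E₁)) = bernE p E₁ f := by
  have := bernE_mul_of_disjoint p h₁ (Finset.empty_subset E) (Finset.disjoint_empty_right _) f
    (fun _ => 1)
  simpa [bernE_const] using this

theorem bernE_map {β : Type*} [DecidableEq β] (p : β → ℝ) (σ : α ↪ β) (E : Finset α)
    (f : Finset β → ℝ) :
    bernE p (E.map σ) f = bernE (fun a => p (σ a)) E (fun S => f (S.map σ)) := by
  induction E using Finset.induction_on generalizing f with
  | empty => simp [bernE_empty]
  | insert e E he ih =>
    rw [Finset.map_insert, bernE_insert p (by simpa using he), bernE_insert _ he, ih, ih]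
    simp only [Finset.map_insert]

/-- The complement of a Bernoulli random set is a Bernoulli random set. -/
theorem bernE_compl (p : α → ℝ) (E : Finset α) (f : Finset α → ℝ) :
    bernE p E (fun S => f (E \ S)) = bernE (fun e => 1 - p e) E f := by
  induction E using Finset.induction_on generalizing f with
  | empty => simp [bernE_empty]
  | insert e E he ih =>
    rw [bernE_insert p he, bernE_insert _ he, ← ih, ← ih]
    have e1 : bernE p E (fun S => f (insert e E \ insert e S)) =
        bernE p E (fun S => f (E \ S)) := by
      refine bernE_congr p fun S hS => ?_
      congr 1
      ext a; simp only [Finset.mem_sdiff, Finset.mem_insert]; grind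
    have e2 : bernE p E (fun S => f (insert e E \ S)) =
        bernE p E (fun S => f (insert e (E \ S))) := by
      refine bernE_congr p fun S hS => ?_
      congr 1
      have := @hS e
      ext a; simp only [Finset.mem_sdiff, Finset.mem_insert]; grind
    rw [e1, e2]; ring

/-- A Bernoulli expectation of an increasing function is increasing in the parameters. -/
theorem bernE_mono_param {p q : α → ℝ} (h0 : ∀ e, 0 ≤ p e) (hpq : ∀ e, p e ≤ q e)
    (h1 : ∀ e, q e ≤ 1) (E : Finset α) (f : Finset α → ℝ)
    (hf : ∀ S T, S ⊆ T → f S ≤ f T) : bernE p E f ≤ bernE q E f := by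
  induction E using Finset.induction_on generalizing f with
  | empty => simp [bernE_empty]
  | insert e E he ih =>
    rw [bernE_insert p he, bernE_insert q he]
    have a1 := ih (fun S => f (insert e S)) fun S T h => hf _ _ (Finset.insert_subset_insert e h)
    have a2 := ih f hf
    have a3 : bernE q E f ≤ bernE q E (fun S => f (insert e S)) :=
      bernE_mono (fun e => (h0 e).trans (hpq e)) h1 fun S _ => hf _ _ (Finset.subset_insert e S)
    have b1 := mul_le_mul_of_nonneg_left a1 (h0 e)
    have b2 := mul_le_mul_of_nonneg_left a2 (sub_nonneg.2 ((hpq e).trans (h1 e)))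
    nlinarith [mul_le_mul_of_nonneg_left a3 (sub_nonneg.2 (hpq e))]

/-- Enlarging the set of coordinates increases the expectation of an increasing function. -/
theorem bernE_mono_set {p : α → ℝ} (h0 : ∀ e, 0 ≤ p e) (h1 : ∀ e, p e ≤ 1) {E E' : Finset α}
    (h : E ⊆ E') (f : Finset α → ℝ) (hf : ∀ S T, S ⊆ T → f S ≤ f T) :
    bernE p E f ≤ bernE p E' f := by
  rw [← bernE_inter p h f]
  exact bernE_mono h0 h1 fun S _ => hf _ _ Finset.inter_subset_left

/-- A weight on the subsets of `E` each of whose one-point conditional probabilities is at least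
that of the Bernoulli measure gives increasing functions at least their Bernoulli mean. -/
theorem bernE_le_of_conditional {p : α → ℝ} (h0 : ∀ e, 0 ≤ p e) (h1 : ∀ e, p e ≤ 1)
    (E : Finset α) (ν f : Finset α → ℝ)
    (hν : ∀ e ∈ E, ∀ S ⊆ E, e ∉ S → p e * ν S ≤ (1 - p e) * ν (insert e S))
    (hf : ∀ S T, S ⊆ T → f S ≤ f T) :
    (∑ S ∈ E.powerset, ν S) * bernE p E f ≤ ∑ S ∈ E.powerset, ν S * f S := by
  induction E using Finset.induction_on generalizing ν f with
  | empty => simp [bernE_empty]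
  | insert e E he ih =>
    have key := ih (fun S => ν S + ν (insert e S))
      (fun S => p e * f (insert e S) + (1 - p e) * f S) ?_ ?_
    · rw [Finset.sum_powerset_insert he, Finset.sum_powerset_insert he, bernE_insert p he]
      rw [bernE_add, bernE_const_mul, bernE_const_mul, Finset.sum_add_distrib] at key
      refine key.trans ?_
      rw [← Finset.sum_add_distrib]
      refine Finset.sum_le_sum fun S hS => ?_
      have hS' := Finset.mem_powerset.1 hS
      have a := hν e (Finset.mem_insert_self e E) S (hS'.trans (Finset.subset_insert e E))
        (fun h => he (hS' h))
      have b := hf S (insert e S) (Finset.subset_insert e S)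
      nlinarith [mul_le_mul_of_nonneg_left a (sub_nonneg.2 b)]
    · intro a ha S hS haS
      have hae : a ≠ e := fun h => he (h ▸ ha)
      have i1 := hν a (Finset.mem_insert_of_mem ha) S (hS.trans (Finset.subset_insert e E)) haS
      have i2 := hν a (Finset.mem_insert_of_mem ha) (insert e S) (Finset.insert_subset_insert e hS)
        (by simp [hae, haS])
      rw [Finset.insert_comm] at i2
      linarith
    · intro S T h
      have c1 := hf _ _ (Finset.insert_subset_insert e h)
      have c2 := hf _ _ h
      exact add_le_add (mul_le_mul_of_nonneg_left c1 (h0 e))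
        (mul_le_mul_of_nonneg_left c2 (sub_nonneg.2 (h1 e)))

/-- Russo's formula along the line `t ↦ p + t`. -/
theorem hasDerivAt_bernE (p : α → ℝ) (E : Finset α) (f : Finset α → ℝ) (t : ℝ) :
    HasDerivAt (fun t : ℝ => bernE (fun e => p e + t) E f)
      (∑ e ∈ E, bernE (fun e => p e + t) (E.erase e) (fun S => f (insert e S) - f S)) t := by
  induction E using Finset.induction_on generalizing f with
  | empty => simpa [bernE_empty] using hasDerivAt_const t (f ∅)
  | insert e E he ih =>
    have hd := ((((hasDerivAt_id t).const_add (p e)).mul (ih (fun S => f (insert e S)))).add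
      ((((hasDerivAt_id t).const_add (p e)).const_sub 1).mul (ih f)))
    have hfun : (fun t : ℝ => bernE (fun e => p e + t) (insert e E) f) =
        ((fun t => p e + id t) * fun t => bernE (fun e => p e + t) E (fun S => f (insert e S))) +
        ((fun t => 1 - (p e + id t)) * fun t => bernE (fun e => p e + t) E f) := by
      funext t
      rw [bernE_insert _ he]; rfl
    rw [hfun]
    refine hd.congr_deriv ?_
    rw [Finset.sum_insert he, Finset.erase_insert he, bernE_sub]
    have : ∀ a ∈ E, bernE (fun e => p e + t) ((insert e E).erase a)
        (fun S => f (insert a S) - f S) =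
        (p e + t) * bernE (fun e => p e + t) (E.erase a)
          (fun S => f (insert e (insert a S)) - f (insert e S)) +
        (1 - (p e + t)) * bernE (fun e => p e + t) (E.erase a)
          (fun S => f (insert a S) - f S) := by
      intro a ha
      have hae : e ≠ a := fun h => he (h ▸ ha)
      rw [Finset.erase_insert_of_ne hae, bernE_insert _ (by simp [he])]
      simp only [Finset.insert_comm a e]
    rw [Finset.sum_congr rfl this, Finset.sum_add_distrib, ← Finset.mul_sum, ← Finset.mul_sum]
    simp only [id]
    ring

end Bernoulli

/-! ### Connectivity through open edges -/

/-- A path either avoids `P`, or has a last visit to `P`. -/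
theorem avoids_or_last_exit {V : Type*} {r : V → V → Prop} (P : V → Prop) {a b : V}
    (h : Relation.ReflTransGen r a b) (hb : ¬ P b) :
    Relation.ReflTransGen (fun u v => r u v ∧ ¬ P u ∧ ¬ P v) a b ∨
    ∃ x y, P x ∧ r x y ∧ ¬ P y ∧ Relation.ReflTransGen (fun u v => r u v ∧ ¬ P u ∧ ¬ P v) y b := by
  induction h using Relation.ReflTransGen.head_induction_on with
  | refl => exact Or.inl .refl
  | head hac hcb ih =>
    rename_i a c
    rcases ih with h | h
    · have hc : ¬ P c := by
        rcases h.cases_head with rfl | ⟨d, hd, -⟩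
        · exact hb
        · exact hd.2.1
      by_cases ha : P a
      · exact Or.inr ⟨a, c, ha, hac, hc, h⟩
      · exact Or.inl (.head ⟨hac, ha, hc⟩ h)
    · exact Or.inr h

/-- A path that starts in `P` and ends outside `P` has a last exit from `P`. -/
theorem exists_last_exit {V : Type*} {r : V → V → Prop} (P : V → Prop) {a b : V}
    (h : Relation.ReflTransGen r a b) (ha : P a) (hb : ¬ P b) :
    ∃ x y, P x ∧ r x y ∧ ¬ P y ∧ Relation.ReflTransGen (fun u v => r u v ∧ ¬ P u ∧ ¬ P v) y b := by
  rcases avoids_or_last_exit P h hb with h | h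
  · rcases h.cases_head with rfl | ⟨d, hd, -⟩
    · exact absurd ha hb
    · exact absurd ha hd.2.1
  · exact h

section Conn

variable {V α : Type*} (ends : α → V × V)

/-- The two vertices are the endpoints of some edge of `S`. -/
def Link (S : Set α) (u v : V) : Prop := ∃ e ∈ S, ends e = (u, v) ∨ ends e = (v, u)

/-- The two vertices are connected by a path of edges of `S`. -/
def Conn (S : Set α) : V → V → Prop := Relation.ReflTransGen (Link ends S)

variable {ends}

theorem Link.symm {S : Set α} {u v : V} (h : Link ends S u v) : Link ends S v u := by
  obtain ⟨e, he, h⟩ := h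
  exact ⟨e, he, h.symm⟩

theorem Link.mono {S T : Set α} (hST : S ⊆ T) {u v : V} (h : Link ends S u v) :
    Link ends T u v := by
  obtain ⟨e, he, h⟩ := h
  exact ⟨e, hST he, h⟩

theorem Conn.refl {S : Set α} (u : V) : Conn ends S u u := Relation.ReflTransGen.refl

theorem Conn.symm {S : Set α} {u v : V} (h : Conn ends S u v) : Conn ends S v u := by
  induction h with
  | refl => exact Relation.ReflTransGen.refl
  | tail _ h2 ih => exact Relation.ReflTransGen.head h2.symm ih

theorem Conn.trans {S : Set α} {u v w : V} (h : Conn ends S u v) (h' : Conn ends S v w) :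
    Conn ends S u w := Relation.ReflTransGen.trans h h'

theorem Conn.mono {S T : Set α} (hST : S ⊆ T) {u v : V} (h : Conn ends S u v) :
    Conn ends T u v := Relation.ReflTransGen.mono (fun _ _ h => Link.mono hST h) _ _ h

theorem Link.conn {S : Set α} {u v : V} (h : Link ends S u v) : Conn ends S u v :=
  Relation.ReflTransGen.single h

variable (ends)

/-- The edges with both endpoints in `W`. -/
def inn (W : Finset V) : Set α := {e | (ends e).1 ∈ W ∧ (ends e).2 ∈ W}

/-- The edge `e` leaves `W` from an endpoint that is connected to `o` by open edges inside `W`. -/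
def ReachBdry (o : V) (W : Finset V) (S : Set α) (e : α) : Prop :=
  ∃ x y, (ends e = (x, y) ∨ ends e = (y, x)) ∧ x ∈ W ∧ y ∉ W ∧ Conn ends (S ∩ inn ends W) o x

variable {ends}

theorem ReachBdry.mono {o : V} {W : Finset V} {S T : Set α} (hST : S ⊆ T) {e : α}
    (h : ReachBdry ends o W S e) : ReachBdry ends o W T e := by
  obtain ⟨x, y, h1, h2, h3, h4⟩ := h
  exact ⟨x, y, h1, h2, h3, h4.mono (Set.inter_subset_inter_left _ hST)⟩

variable [DecidableEq α]

open Classical in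
/-- The set of vertices not connected to `B` is determined by the edges that are not inside it. -/
theorem filter_not_conn_eq_iff {verts : Finset V} {E S : Finset α} (hSE : S ⊆ E)
    (hE : ∀ e ∈ E, (ends e).1 ∈ verts ∧ (ends e).2 ∈ verts) (B : Set V) (W : Finset V) :
    verts.filter (fun v => ¬ ∃ b ∈ B, Conn ends (S : Set α) v b) = W ↔
    verts.filter (fun v => ¬ ∃ b ∈ B,
      Conn ends ((S ∩ E.filter (fun e => e ∉ inn ends W) : Finset α) : Set α) v b) = W := by
  have hsub : ((S ∩ E.filter (fun e => e ∉ inn ends W) : Finset α) : Set α) ⊆ S := by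
    exact_mod_cast Finset.inter_subset_left
  have hlink : ∀ {u v}, Link ends (S : Set α) u v → ¬ (u ∈ W ∧ v ∈ W) →
      Link ends ((S ∩ E.filter (fun e => e ∉ inn ends W) : Finset α) : Set α) u v := by
    rintro u v ⟨e, he, h⟩ hn
    refine ⟨e, ?_, h⟩
    have he' : e ∈ S := he
    simp only [Finset.coe_inter, Finset.coe_filter, Set.mem_inter_iff, Set.mem_ofPred_eq]
    refine ⟨he, hSE he', fun hi => hn ?_⟩
    rcases h with h | h <;> simp only [inn, Set.mem_ofPred_eq, h] at hi
    · exact hi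
    · exact hi.symm
  have hverts : ∀ {u v}, Link ends (S : Set α) u v → v ∈ verts := by
    rintro u v ⟨e, he, h⟩
    have := hE e (hSE he)
    rcases h with h | h <;> rw [h] at this
    · exact this.2
    · exact this.1
  constructor
  · rintro rfl
    refine Finset.filter_congr fun v hv => not_congr ⟨?_, ?_⟩
    · rintro ⟨b, hb, h⟩
      exact ⟨b, hb, h.mono hsub⟩
    · rintro ⟨b, hb, h⟩
      refine ⟨b, hb, ?_⟩
      induction h using Relation.ReflTransGen.head_induction_on with
      | refl => exact Conn.refl _
      | head h1 h2 ih =>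
        refine Relation.ReflTransGen.head (hlink h1 fun hn => ?_) (ih (hverts h1))
        exact (Finset.mem_filter.1 hn.2).2 ⟨b, hb, h2⟩
  · intro hW
    refine (Finset.filter_congr fun v hv => not_congr ⟨?_, ?_⟩).trans hW
    · rintro ⟨b, hb, h⟩
      induction h using Relation.ReflTransGen.head_induction_on with
      | refl => exact ⟨b, hb, Conn.refl _⟩
      | head h1 h2 ih =>
        rename_i v w
        obtain ⟨b', hb', h'⟩ := ih (hverts h1)
        refine ⟨b', hb', .head (hlink h1 fun hn => ?_) h'⟩
        have := hn.2
        rw [← hW] at this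
        exact (Finset.mem_filter.1 this).2 ⟨b', hb', h'⟩
    · rintro ⟨b, hb, h⟩
      exact ⟨b, hb, h.mono hsub⟩

/-! ### The differential inequality for connection probabilities -/

/-- The derivative of a connection probability is at least its complement times the least expected
number of exits: conditionally on the set `W` of vertices not connected to `B`, the edges inside
`W` are fresh, and each edge leaving `W` from the cluster of `o` in `W` is pivotal. -/
theorem mul_one_sub_le_deriv (E : Finset α) {p : α → ℝ} (h0 : ∀ e, 0 ≤ p e) (h1 : ∀ e, p e ≤ 1)
    (o : V) (B : Set V) {c : ℝ}
    (hc : ∀ W : Finset V, o ∈ W → (∀ v ∈ W, v ∉ B) →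
      c ≤ ∑ e ∈ E, bernE p E (fun S => ind (ReachBdry ends o W (S : Set α) e))) :
    c * (1 - bernE p E (fun S => ind (∃ b ∈ B, Conn ends (S : Set α) o b))) ≤
      ∑ e ∈ E, bernE p (E.erase e) (fun S =>
        ind (∃ b ∈ B, Conn ends ((insert e S : Finset α) : Set α) o b) -
          ind (∃ b ∈ B, Conn ends (S : Set α) o b)) := by
  classical
  set A : Finset α → ℝ := fun S => ind (∃ b ∈ B, Conn ends (S : Set α) o b) with hA
  have hAmono : ∀ S T : Finset α, S ⊆ T → A S ≤ A T := fun S T h =>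
    ind_mono fun ⟨b, hb, hh⟩ => ⟨b, hb, hh.mono (by exact_mod_cast h)⟩
  set verts : Finset V :=
    insert o (E.image (fun e => (ends e).1) ∪ E.image (fun e => (ends e).2)) with hverts
  have hE : ∀ e ∈ E, (ends e).1 ∈ verts ∧ (ends e).2 ∈ verts := fun e he =>
    ⟨by simp only [hverts, Finset.mem_insert, Finset.mem_union, Finset.mem_image]
        exact Or.inr (Or.inl ⟨e, he, rfl⟩),
     by simp only [hverts, Finset.mem_insert, Finset.mem_union, Finset.mem_image]
        exact Or.inr (Or.inr ⟨e, he, rfl⟩)⟩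
  set D : Finset α → Finset V :=
    fun S => verts.filter (fun v => ¬ ∃ b ∈ B, Conn ends (S : Set α) v b) with hD
  have hoD : ∀ S, o ∈ D S ↔ ¬ ∃ b ∈ B, Conn ends (S : Set α) o b := fun S => by
    simp [hD, hverts]
  -- compare with the sum over pivotal closed edges
  have step1 : ∀ e ∈ E, bernE p E (fun S => A (insert e S) - A S) ≤
      bernE p (E.erase e) (fun S => A (insert e S) - A S) := by
    intro e he
    conv_lhs => rw [← Finset.insert_erase he]
    rw [bernE_insert p (Finset.notMem_erase e E)]
    have : bernE p (E.erase e) (fun S => A (insert e (insert e S)) - A (insert e S)) = 0 := by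
      simp [bernE_const]
    rw [this, mul_zero, zero_add]
    have hnn : 0 ≤ bernE p (E.erase e) (fun S => A (insert e S) - A S) :=
      bernE_nonneg h0 h1 fun S _ => sub_nonneg.2 (hAmono _ _ (Finset.subset_insert e S))
    nlinarith [h0 e]
  refine le_trans ?_ (Finset.sum_le_sum step1)
  rw [← bernE_sum]
  -- decompose according to the set of vertices not connected to `B`
  set Ws := verts.powerset.filter (fun W => o ∈ W ∧ ∀ v ∈ W, v ∉ B) with hWs
  have hDmem : ∀ S, o ∈ D S → D S ∈ Ws := by
    intro S hS
    simp only [hWs, Finset.mem_filter, Finset.mem_powerset]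
    refine ⟨Finset.filter_subset _ _, hS, fun v hv hvB => ?_⟩
    exact (Finset.mem_filter.1 hv).2 ⟨v, hvB, Conn.refl v⟩
  have step2 : ∀ S ⊆ E, ∑ W ∈ Ws, ∑ e ∈ E, ind (D S = W) * ind (ReachBdry ends o W (S : Set α) e) ≤
      ∑ e ∈ E, (A (insert e S) - A S) := by
    intro S hSE
    by_cases hoS : o ∈ D S
    · rw [Finset.sum_eq_single_of_mem (D S) (hDmem S hoS)]
      · refine Finset.sum_le_sum fun e he => ?_
        rw [ind_of rfl, one_mul]
        have hA0 : A S = 0 := ind_of_not ((hoD S).1 hoS)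
        rw [hA0, sub_zero]
        refine ind_mono ?_
        rintro ⟨x, y, hxy, hx, hy, hox⟩
        have hyv : y ∈ verts := by
          have := hE e he
          rcases hxy with h | h <;> rw [h] at this
          · exact this.2
          · exact this.1
        have : ∃ b ∈ B, Conn ends (S : Set α) y b := by
          by_contra hno
          exact hy (Finset.mem_filter.2 ⟨hyv, hno⟩)
        obtain ⟨b, hb, hyb⟩ := this
        have hsub : (S : Set α) ⊆ ((insert e S : Finset α) : Set α) := by
          exact_mod_cast Finset.subset_insert e S
        refine ⟨b, hb, ((hox.mono Set.inter_subset_left).mono hsub).trans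
          (Conn.trans (Link.conn ⟨e, ?_, hxy⟩) (hyb.mono hsub))⟩
        exact_mod_cast Finset.mem_insert_self e S
      · intro W _ hne
        exact Finset.sum_eq_zero fun e _ => by rw [ind_of_not (Ne.symm hne), zero_mul]
    · have : ∑ W ∈ Ws, ∑ e ∈ E, ind (D S = W) * ind (ReachBdry ends o W (S : Set α) e) = 0 := by
        refine Finset.sum_eq_zero fun W hW => Finset.sum_eq_zero fun e _ => ?_
        rw [ind_of_not, zero_mul]
        rintro rfl
        exact hoS (Finset.mem_filter.1 hW).2.1
      rw [this]
      exact Finset.sum_nonneg fun e _ => sub_nonneg.2 (hAmono _ _ (Finset.subset_insert e S))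
  refine le_trans ?_ (bernE_mono h0 h1 step2)
  rw [bernE_sum]
  -- the event `D S = W` depends on the edges that are not inside `W`, and the exits from `W` depend
  -- on those inside `W`; hence both are independent
  have step3 : ∀ W ∈ Ws, c * bernE p E (fun S => ind (D S = W)) ≤
      bernE p E (fun S => ∑ e ∈ E, ind (D S = W) * ind (ReachBdry ends o W (S : Set α) e)) := by
    intro W hW
    have hW' := (Finset.mem_filter.1 hW).2
    rw [bernE_sum]
    have : ∀ e ∈ E, bernE p E (fun S => ind (D S = W) * ind (ReachBdry ends o W (S : Set α) e)) =
        bernE p E (fun S => ind (ReachBdry ends o W (S : Set α) e)) *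
          bernE p E (fun S => ind (D S = W)) := by
      intro e _
      set Eo := E.filter (fun e => e ∉ inn ends W)
      set Ei := E.filter (fun e => e ∈ inn ends W)
      have hdisj : Disjoint Ei Eo := Finset.disjoint_filter_filter_not _ _ _
      have r1 : ∀ S ⊆ E, ind (ReachBdry ends o W (S : Set α) e) =
          ind (ReachBdry ends o W ((S ∩ Ei : Finset α) : Set α) e) := by
        intro S hS
        have : (S : Set α) ∩ inn ends W = ((S ∩ Ei : Finset α) : Set α) ∩ inn ends W := by
          ext a
          simp only [Set.mem_inter_iff, Finset.mem_coe, Finset.mem_inter, Ei, Finset.mem_filter]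
          exact ⟨fun h => ⟨⟨h.1, hS h.1, h.2⟩, h.2⟩, fun h => ⟨h.1.1, h.2⟩⟩
        unfold ReachBdry
        rw [this]
      have r2 : ∀ S ⊆ E, ind (D S = W) = ind (D (S ∩ Eo) = W) := fun S hS =>
        ind_congr (filter_not_conn_eq_iff hS hE B W)
      rw [bernE_congr p (fun S hS => by rw [r1 S hS, r2 S hS, mul_comm]),
        bernE_mul_of_disjoint p (Finset.filter_subset _ _) (Finset.filter_subset _ _) hdisj
          (fun S => ind (ReachBdry ends o W (S : Set α) e)) (fun S => ind (D S = W)),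
        ← bernE_inter p (Finset.filter_subset _ _ : Ei ⊆ E),
        ← bernE_inter p (Finset.filter_subset _ _ : Eo ⊆ E),
        ← bernE_congr p r1, ← bernE_congr p r2]
    rw [Finset.sum_congr rfl this, ← Finset.sum_mul]
    exact mul_le_mul_of_nonneg_right (hc W hW'.1 hW'.2)
      (bernE_nonneg h0 h1 fun S _ => ind_nonneg _)
  refine le_trans ?_ (Finset.sum_le_sum step3)
  rw [← Finset.mul_sum, ← bernE_sum]
  -- the events `D S = W` partition the event that `o` is not connected to `B`
  have step4 : 1 - bernE p E A = bernE p E (fun S => ∑ W ∈ Ws, ind (D S = W)) := by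
    rw [← bernE_const p E 1, ← bernE_sub]
    refine bernE_congr p fun S _ => ?_
    by_cases hoS : o ∈ D S
    · rw [Finset.sum_eq_single_of_mem (D S) (hDmem S hoS), ind_of rfl]
      · rw [hA]
        simp only
        rw [ind_of_not ((hoD S).1 hoS), sub_zero]
      · intro W _ hne
        exact ind_of_not (Ne.symm hne)
    · rw [Finset.sum_eq_zero]
      · rw [hA]
        simp only
        rw [ind_of (by by_contra h; exact hoS ((hoD S).2 h)), sub_self]
      · intro W hW
        refine ind_of_not ?_
        rintro rfl
        exact hoS (Finset.mem_filter.1 hW).2.1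
  rw [step4]

/-- If every finite set containing `o` and avoiding `B` has at least `c` expected exits at
parameter `p`, then at parameter `p + t` the connection probability of `o` and `B` is at least
`1 - exp (-c t)`. -/
theorem one_sub_exp_le_bernE_conn (E : Finset α) {p : α → ℝ} (h0 : ∀ e, 0 ≤ p e) {T : ℝ}
    (hT : 0 ≤ T) (h1 : ∀ e, p e + T ≤ 1) (o : V) (B : Set V) {c : ℝ}
    (hc : ∀ W : Finset V, o ∈ W → (∀ v ∈ W, v ∉ B) →
      c ≤ ∑ e ∈ E, bernE p E (fun S => ind (ReachBdry ends o W (S : Set α) e))) :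
    1 - Real.exp (-(c * T)) ≤
      bernE (fun e => p e + T) E (fun S => ind (∃ b ∈ B, Conn ends (S : Set α) o b)) := by
  set A : Finset α → ℝ := fun S => ind (∃ b ∈ B, Conn ends (S : Set α) o b) with hA
  set F : ℝ → ℝ := fun t => bernE (fun e => p e + t) E A with hF
  -- the differential inequality says that `G` is antitone
  set G : ℝ → ℝ := fun t => (1 - F t) * Real.exp (c * t) with hG
  have hderiv : ∀ t, HasDerivAt G
      (-(∑ e ∈ E, bernE (fun e => p e + t) (E.erase e) (fun S => A (insert e S) - A S)) *
        Real.exp (c * t) + (1 - F t) * (Real.exp (c * t) * c)) t := by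
    intro t
    have a := (hasDerivAt_bernE p E A t).const_sub 1
    have b : HasDerivAt (fun t => Real.exp (c * t)) (Real.exp (c * t) * c) t := by
      have := ((hasDerivAt_id t).const_mul c).exp
      simpa using this
    exact a.mul b
  have hanti : AntitoneOn G (Set.Icc 0 T) := by
    refine antitoneOn_of_deriv_nonpos (convex_Icc 0 T)
      (fun t _ => (hderiv t).continuousAt.continuousWithinAt)
      (fun t _ => (hderiv t).differentiableAt.differentiableWithinAt) fun t ht => ?_
    rw [interior_Icc] at ht
    rw [(hderiv t).deriv]
    have h0' : ∀ e, 0 ≤ p e + t := fun e => add_nonneg (h0 e) ht.1.le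
    have h1' : ∀ e, p e + t ≤ 1 := fun e => by linarith [h1 e, ht.2]
    have := mul_one_sub_le_deriv (ends := ends) E h0' h1' o B (c := c) fun W hW hWB =>
      (hc W hW hWB).trans (Finset.sum_le_sum fun e _ =>
        bernE_mono_param h0 (fun e => by linarith [ht.1]) h1' E _ fun S T h =>
          ind_mono (ReachBdry.mono (by exact_mod_cast h)))
    have e := Real.exp_pos (c * t)
    have : c * (1 - F t) ≤ ∑ e ∈ E, bernE (fun e => p e + t) (E.erase e)
      (fun S => A (insert e S) - A S) := this
    nlinarith [mul_le_mul_of_nonneg_left this e.le]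
  have hle := hanti ⟨le_rfl, hT⟩ ⟨hT, le_rfl⟩ hT
  have h00 : 0 ≤ F 0 := bernE_nonneg (fun e => by simpa using h0 e)
    (fun e => by linarith [h1 e]) fun S _ => ind_nonneg _
  have hG0 : G 0 ≤ 1 := by simp only [hG, mul_zero, Real.exp_zero, mul_one]; linarith
  have hGT : (1 - F T) * Real.exp (c * T) ≤ 1 := hle.trans hG0
  rw [Real.exp_neg, ← one_div]
  have := (le_div_iff₀ (Real.exp_pos (c * T))).2 hGT
  change _ ≤ F T
  linarith

end Conn

/-! ### The Simon inequality -/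

section Simon

variable {V α : Type*} {ends : α → V × V}

open Classical in
/-- The endpoint outside `W` of an edge that leaves `W`. -/
noncomputable def outerEnd (ends : α → V × V) (W : Finset V) (e : α) : V :=
  if (ends e).1 ∈ W then (ends e).2 else (ends e).1

theorem outerEnd_eq {W : Finset V} {e : α} {x y : V} (h : ends e = (x, y) ∨ ends e = (y, x))
    (hx : x ∈ W) (hy : y ∉ W) : outerEnd ends W e = y := by
  unfold outerEnd
  rcases h with h | h <;> simp [h, hx, hy]

open Classical in
/-- The vertices of `W` connected to `o` by edges of `S` inside `W`. -/
noncomputable def clusterIn (ends : α → V × V) (o : V) (W : Finset V) (S : Set α) : Finset V :=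
  W.filter (fun v => Conn ends (S ∩ inn ends W) o v)

variable [DecidableEq α]

open Classical in
/-- Whether `C` is the cluster of `o` in `W` is determined by the edges inside `W` that
touch `C`. -/
theorem clusterIn_eq_iff {o : V} {W : Finset V} (ho : o ∈ W) {E S : Finset α} (hSE : S ⊆ E)
    (C : Finset V) :
    clusterIn ends o W (S : Set α) = C ↔
    clusterIn ends o W ((S ∩ E.filter
      (fun e => e ∈ inn ends W ∧ ((ends e).1 ∈ C ∨ (ends e).2 ∈ C)) : Finset α) : Set α) = C := by
  set E₁ := E.filter (fun e => e ∈ inn ends W ∧ ((ends e).1 ∈ C ∨ (ends e).2 ∈ C))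
  have hsub : ((S ∩ E₁ : Finset α) : Set α) ⊆ S := by
    exact_mod_cast Finset.inter_subset_left
  have hlink : ∀ {u v}, Link ends ((S : Set α) ∩ inn ends W) u v → u ∈ C →
      Link ends (((S ∩ E₁ : Finset α) : Set α) ∩ inn ends W) u v := by
    rintro u v ⟨e, he, h⟩ hu
    refine ⟨e, ⟨?_, he.2⟩, h⟩
    have he' : e ∈ S := he.1
    simp only [Finset.coe_inter, Set.mem_inter_iff, Finset.mem_coe, E₁, Finset.mem_filter]
    refine ⟨he', hSE he', he.2, ?_⟩
    rcases h with h | h <;> simp [h, hu]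
  have hinW : ∀ {u v}, Link ends ((S : Set α) ∩ inn ends W) u v → v ∈ W := by
    rintro u v ⟨e, he, h⟩
    have := he.2
    rcases h with h | h <;> simp only [inn, Set.mem_ofPred_eq, h] at this
    · exact this.2
    · exact this.1
  have hW : ∀ {v}, Conn ends ((S : Set α) ∩ inn ends W) o v → v ∈ W := by
    intro v h
    induction h with
    | refl => exact ho
    | tail _ h2 _ => exact hinW h2
  constructor
  · rintro rfl
    refine Finset.filter_congr fun v hv =>
      ⟨fun h => h.mono (Set.inter_subset_inter_left _ hsub), ?_⟩
    intro h
    induction h with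
    | refl => exact Conn.refl _
    | tail h1 h2 ih =>
      refine Relation.ReflTransGen.tail (ih (hW h1)) (hlink h2 ?_)
      exact Finset.mem_filter.2 ⟨hW h1, h1⟩
  · intro hC
    refine (Finset.filter_congr fun v hv => ⟨?_, fun h =>
      h.mono (Set.inter_subset_inter_left _ hsub)⟩).trans hC
    intro h
    induction h with
    | refl => exact Conn.refl _
    | tail h1 h2 ih =>
      refine Relation.ReflTransGen.tail (ih (hW h1)) (hlink h2 ?_)
      rw [← hC]
      exact Finset.mem_filter.2 ⟨hW h1, ih (hW h1)⟩

/-- **Simon's inequality**: to reach `B`, the point `o` must leave `W` through an open edge whose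
outer endpoint is connected to `B` off the cluster of `o` in `W`. -/
theorem simon_inequality (E : Finset α) {p : α → ℝ} (h0 : ∀ e, 0 ≤ p e) (h1 : ∀ e, p e ≤ 1)
    {o : V} {W : Finset V} (ho : o ∈ W) {B : Set V} (hWB : ∀ v ∈ W, v ∉ B) :
    bernE p E (fun S => ind (∃ b ∈ B, Conn ends (S : Set α) o b)) ≤
      ∑ e ∈ E, p e * bernE p E (fun S => ind (ReachBdry ends o W (S : Set α) e)) *
        bernE p E (fun S => ind (∃ b ∈ B, Conn ends (S : Set α) (outerEnd ends W e) b)) := by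
  classical
  -- The sum is over the cluster `C` of `o` inside `W` and the edge `e` of the last exit from `C`.
  -- `E₁ C` are the edges that determine whether `C` is the cluster, `E₃ C` those off the cluster;
  -- together with `e` they are disjoint, which makes the three events independent.
  set Cl : Finset α → Finset V := fun S => clusterIn ends o W (S : Set α) with hCl
  set K : Finset V → α → Prop := fun C e =>
    ∃ x y, (ends e = (x, y) ∨ ends e = (y, x)) ∧ x ∈ C ∧ x ∈ W ∧ y ∉ W with hK
  set E₁ : Finset V → Finset α := fun C =>
    E.filter (fun e => e ∈ inn ends W ∧ ((ends e).1 ∈ C ∨ (ends e).2 ∈ C)) with hE₁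
  set E₃ : Finset V → Finset α := fun C => E.filter (fun e => (ends e).1 ∉ C ∧ (ends e).2 ∉ C)
    with hE₃
  set R : Finset α → α → Prop := fun S e =>
    ∃ b ∈ B, Conn ends (S : Set α) (outerEnd ends W e) b with hR
  have hRmono : ∀ S T : Finset α, S ⊆ T → ∀ e, R S e → R T e := fun S T h e ⟨b, hb, hh⟩ =>
    ⟨b, hb, hh.mono (by exact_mod_cast h)⟩
  -- the last exit from the cluster leaves `W`, for otherwise it would extend the cluster
  have pointwise : ∀ S ⊆ E, ind (∃ b ∈ B, Conn ends (S : Set α) o b) ≤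
      ∑ C ∈ W.powerset, ∑ e ∈ E, ind (Cl S = C) *
        (ind (K C e) * (ind (e ∈ S) * ind (R (S ∩ E₃ C) e))) := by
    intro S hSE
    rw [Finset.sum_eq_single_of_mem (Cl S) (Finset.mem_powerset.2 (Finset.filter_subset _ _))]
    · by_cases h : ∃ b ∈ B, Conn ends (S : Set α) o b
      · obtain ⟨b, hb, hob⟩ := h
        have hoC : o ∈ Cl S := Finset.mem_filter.2 ⟨ho, Conn.refl o⟩
        have hbC : b ∉ Cl S := fun h => hWB b (Finset.mem_filter.1 h).1 hb
        obtain ⟨x, y, hx, ⟨e, heS, hxy⟩, hy, hyb⟩ := exists_last_exit (· ∈ Cl S) hob hoC hbC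
        have heS' : e ∈ S := heS
        have hxW := (Finset.mem_filter.1 hx).1
        have hyW : y ∉ W := by
          intro hyW
          refine hy (Finset.mem_filter.2 ⟨hyW, (Finset.mem_filter.1 hx).2.tail ⟨e, ⟨heS, ?_⟩, hxy⟩⟩)
          rcases hxy with h | h <;> simp [inn, h, hxW, hyW]
        have hyb' : Conn ends ((S ∩ E₃ (Cl S) : Finset α) : Set α) y b := by
          refine Relation.ReflTransGen.mono ?_ _ _ hyb
          rintro u v ⟨⟨f, hf, huv⟩, hu, hv⟩
          refine ⟨f, ?_, huv⟩
          have hf' : f ∈ S := hf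
          simp only [Finset.coe_inter, Set.mem_inter_iff, Finset.mem_coe, hE₃, Finset.mem_filter]
          refine ⟨hf', hSE hf', ?_⟩
          rcases huv with h | h <;> simp [h, hu, hv]
        refine (ind_le_one _).trans ?_
        have hone : ind (Cl S = Cl S) *
            (ind (K (Cl S) e) * (ind (e ∈ S) * ind (R (S ∩ E₃ (Cl S)) e))) = 1 := by
          rw [ind_of rfl, ind_of (show K (Cl S) e from ⟨x, y, hxy, hx, hxW, hyW⟩), ind_of heS',
            ind_of (show R (S ∩ E₃ (Cl S)) e from
              ⟨b, hb, by rw [outerEnd_eq hxy hxW hyW]; exact hyb'⟩)]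
          norm_num
        rw [← hone]
        exact Finset.single_le_sum (f := fun e => ind (Cl S = Cl S) *
            (ind (K (Cl S) e) * (ind (e ∈ S) * ind (R (S ∩ E₃ (Cl S)) e))))
          (fun e _ => mul_nonneg (ind_nonneg _) (mul_nonneg (ind_nonneg _)
            (mul_nonneg (ind_nonneg _) (ind_nonneg _)))) (hSE heS')
      · rw [ind_of_not h]
        exact Finset.sum_nonneg fun e _ => mul_nonneg (ind_nonneg _) (mul_nonneg (ind_nonneg _)
            (mul_nonneg (ind_nonneg _) (ind_nonneg _)))
    · intro C _ hne
      exact Finset.sum_eq_zero fun e _ => by rw [ind_of_not (Ne.symm hne), zero_mul]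
  refine (bernE_mono h0 h1 pointwise).trans ?_
  rw [bernE_sum]
  have term : ∀ C, ∀ e ∈ E, bernE p E (fun S => ind (Cl S = C) *
        (ind (K C e) * (ind (e ∈ S) * ind (R (S ∩ E₃ C) e)))) ≤
      bernE p E (fun S => ind (Cl S = C ∧ K C e)) * (p e * bernE p E (fun S => ind (R S e))) := by
    intro C e he
    by_cases hKe : K C e
    swap
    · rw [bernE_congr p (g := fun _ => 0) (fun S _ => by rw [ind_of_not hKe]; ring), bernE_const]
      exact mul_nonneg (bernE_nonneg h0 h1 fun S _ => ind_nonneg _)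
        (mul_nonneg (h0 e) (bernE_nonneg h0 h1 fun S _ => ind_nonneg _))
    obtain ⟨x, y, hxy, hxC, hxW, hyW⟩ := id hKe
    have he3 : e ∉ E₃ C := by
      simp only [hE₃, Finset.mem_filter, not_and]
      rintro - h
      rcases hxy with h' | h' <;> simp [h', hxC] at h ⊢
    have he1 : e ∉ E₁ C := by
      simp only [hE₁, Finset.mem_filter, not_and]
      rintro - h
      exfalso
      rcases hxy with h' | h' <;> simp [inn, h', hyW] at h
    have hd13 : Disjoint (E₁ C) (insert e (E₃ C)) := by
      rw [Finset.disjoint_insert_right]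
      refine ⟨he1, Finset.disjoint_left.2 fun a ha hb => ?_⟩
      have ha' := (Finset.mem_filter.1 ha).2.2
      have hb' := (Finset.mem_filter.1 hb).2
      tauto
    have r1 : ∀ S ⊆ E, ind (Cl S = C) = ind (Cl (S ∩ E₁ C) = C) := fun S hS =>
      ind_congr (clusterIn_eq_iff ho hS C)
    have hins : insert e (E₃ C) ⊆ E := Finset.insert_subset he (Finset.filter_subset _ _)
    have r2 : ∀ S, ind (e ∈ S) * ind (R (S ∩ E₃ C) e) =
        (fun T : Finset α => ind (e ∈ T) * ind (R (T ∩ E₃ C) e)) (S ∩ insert e (E₃ C)) := by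
      intro S
      have a1 : S ∩ insert e (E₃ C) ∩ E₃ C = S ∩ E₃ C := by
        ext a; simp only [Finset.mem_inter, Finset.mem_insert]; tauto
      have a2 : e ∈ S ∩ insert e (E₃ C) ↔ e ∈ S := by simp
      simp only [a1, a2]
    have r3 : ∀ S ⊆ E, ind (Cl S = C) * (ind (K C e) * (ind (e ∈ S) * ind (R (S ∩ E₃ C) e))) =
        (fun T : Finset α => ind (Cl T = C)) (S ∩ E₁ C) *
        (fun T : Finset α => ind (e ∈ T) * ind (R (T ∩ E₃ C) e)) (S ∩ insert e (E₃ C)) := by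
      intro S hS
      rw [ind_of hKe, one_mul, r2 S, r1 S hS]
    rw [bernE_congr p r3, bernE_mul_of_disjoint p (Finset.filter_subset _ _) hins hd13
      (fun T => ind (Cl T = C)) (fun T => ind (e ∈ T) * ind (R (T ∩ E₃ C) e)),
      ← bernE_inter p (Finset.filter_subset _ _ : E₁ C ⊆ E), ← bernE_congr p r1,
      bernE_insert p he3]
    have z1 : bernE p (E₃ C) (fun S => ind (e ∈ S) * ind (R (S ∩ E₃ C) e)) = 0 := by
      rw [bernE_congr p (g := fun _ => 0), bernE_const]
      intro S hS
      rw [ind_of_not (fun h => he3 (hS h)), zero_mul]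
    have z2 : bernE p (E₃ C) (fun S => ind (e ∈ insert e S) * ind (R (insert e S ∩ E₃ C) e)) =
        bernE p (E₃ C) (fun S => ind (R S e)) := by
      refine bernE_congr p fun S hS => ?_
      rw [ind_of (Finset.mem_insert_self e S), one_mul]
      have : insert e S ∩ E₃ C = S := by
        ext a
        have := @hS a
        simp only [Finset.mem_inter, Finset.mem_insert]
        constructor
        · rintro ⟨rfl | h, h'⟩
          · exact absurd h' he3
          · exact h
        · intro h; exact ⟨Or.inr h, this h⟩
      rw [this]
    rw [z1, z2, mul_zero, add_zero]
    -- the restriction to edges off the cluster can now be dropped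
    have z3 : bernE p (E₃ C) (fun S => ind (R S e)) ≤ bernE p E (fun S => ind (R S e)) :=
      bernE_mono_set h0 h1 (Finset.filter_subset _ _) _ fun S T h => ind_mono (hRmono S T h e)
    have z4 : bernE p E (fun S => ind (Cl S = C)) = bernE p E (fun S => ind (Cl S = C ∧ K C e)) :=
      bernE_congr p fun S _ => ind_congr ⟨fun h => ⟨h, hKe⟩, fun h => h.1⟩
    rw [z4]
    exact mul_le_mul_of_nonneg_left (mul_le_mul_of_nonneg_left z3 (h0 e))
      (bernE_nonneg h0 h1 fun S _ => ind_nonneg _)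
  have hsum : ∀ C ∈ W.powerset, bernE p E (fun S => ∑ e ∈ E, ind (Cl S = C) *
        (ind (K C e) * (ind (e ∈ S) * ind (R (S ∩ E₃ C) e)))) ≤
      ∑ e ∈ E, bernE p E (fun S => ind (Cl S = C ∧ K C e)) *
        (p e * bernE p E (fun S => ind (R S e))) := by
    intro C _
    rw [bernE_sum]
    exact Finset.sum_le_sum fun e he => term C e he
  -- sum over the clusters that contain an endpoint of `e`
  refine (Finset.sum_le_sum hsum).trans ?_
  rw [Finset.sum_comm]
  refine Finset.sum_le_sum fun e _ => ?_
  rw [← Finset.sum_mul, ← bernE_sum]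
  refine (mul_le_mul_of_nonneg_right (c := bernE p E fun S =>
      ind (ReachBdry ends o W (S : Set α) e)) (bernE_mono h0 h1 fun S _ => ?_)
    (mul_nonneg (h0 e) (bernE_nonneg h0 h1 fun S _ => ind_nonneg _))).trans
    (le_of_eq (by rw [← mul_assoc, mul_comm _ (p e)]))
  rw [Finset.sum_eq_single_of_mem (Cl S) (Finset.mem_powerset.2 (Finset.filter_subset _ _))]
  · refine ind_mono ?_
    rintro ⟨-, x, y, hxy, hx, hxW, hy⟩
    exact ⟨x, y, hxy, hxW, hy, (Finset.mem_filter.1 hx).2⟩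
  · intro C _ hne
    exact ind_of_not fun h => hne h.1.symm

end Simon

/-! ### Contours in the square lattice -/

/-- Edges of the square lattice: `(a, b, true)` joins `(a, b)` to `(a + 1, b)`, and
`(a, b, false)` joins `(a, b)` to `(a, b + 1)`. -/
abbrev Z2Edge : Type := ℤ × ℤ × Bool

/-- The endpoints of an edge of the square lattice. -/
def ends2 (e : Z2Edge) : (ℤ × ℤ) × (ℤ × ℤ) :=
  ((e.1, e.2.1), if e.2.2 then (e.1 + 1, e.2.1) else (e.1, e.2.1 + 1))

/-- The face above a horizontal edge, or to the right of a vertical edge. A face is named by its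
lower left corner. -/
def faceA (e : Z2Edge) : ℤ × ℤ := (e.1, e.2.1)

/-- The face below a horizontal edge, or to the left of a vertical edge. -/
def faceB (e : Z2Edge) : ℤ × ℤ := if e.2.2 then (e.1, e.2.1 - 1) else (e.1 - 1, e.2.1)

@[simp] theorem ends2_true (a b : ℤ) : ends2 (a, b, true) = ((a, b), (a + 1, b)) := by simp [ends2]
@[simp] theorem ends2_false (a b : ℤ) : ends2 (a, b, false) = ((a, b), (a, b + 1)) := by
  simp [ends2]
@[simp] theorem faceA_mk (a b : ℤ) (h : Bool) : faceA (a, b, h) = (a, b) := rfl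
@[simp] theorem faceB_true (a b : ℤ) : faceB (a, b, true) = (a, b - 1) := by simp [faceB]
@[simp] theorem faceB_false (a b : ℤ) : faceB (a, b, false) = (a - 1, b) := by simp [faceB]

/-- A function on the integers is the difference of another one. -/
theorem exists_int_primitive (g : ℤ → ZMod 2) : ∃ X : ℤ → ZMod 2, X 0 = 0 ∧
    ∀ a, X (a + 1) = X a + g a := by
  refine ⟨fun a => ∑ k ∈ Finset.Ico 0 a, g k + ∑ k ∈ Finset.Ico a 0, g k, by simp, fun a => ?_⟩
  rcases le_or_gt 0 a with h | h
  · have e1 : Finset.Ico 0 (a + 1) = insert a (Finset.Ico 0 a) := by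
      ext x; simp only [Finset.mem_Ico, Finset.mem_insert]; omega
    have e2 : Finset.Ico (a + 1) 0 = ∅ := Finset.Ico_eq_empty (by omega)
    have e3 : Finset.Ico a 0 = ∅ := Finset.Ico_eq_empty (by omega)
    simp only [e1, e2, e3, Finset.sum_empty, add_zero]
    rw [Finset.sum_insert (by simp), add_comm]
  · have e1 : Finset.Ico a 0 = insert a (Finset.Ico (a + 1) 0) := by
      ext x; simp only [Finset.mem_Ico, Finset.mem_insert]; omega
    have e2 : Finset.Ico 0 (a + 1) = ∅ := Finset.Ico_eq_empty (by omega)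
    have e3 : Finset.Ico 0 a = ∅ := Finset.Ico_eq_empty (by omega)
    simp only [e1, e2, e3, Finset.sum_empty, zero_add]
    rw [Finset.sum_insert (by simp), add_comm (g a), add_assoc, CharTwo.add_self_eq_zero, add_zero]

/-- A mod 2 cochain on the edges of the square lattice whose sum around each face vanishes is a
coboundary. -/
theorem exists_potential (f : Z2Edge → ZMod 2)
    (hf : ∀ a b, f (a, b, true) + f (a + 1, b, false) = f (a, b, false) + f (a, b + 1, true)) :
    ∃ h : ℤ × ℤ → ZMod 2, ∀ e, h (ends2 e).2 = h (ends2 e).1 + f e := by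
  obtain ⟨X, -, hX⟩ := exists_int_primitive fun a => f (a, 0, true)
  choose Y hY0 hY using fun a => exists_int_primitive fun b => f (a, b, false)
  -- integrate along the horizontal axis, and then vertically
  refine ⟨fun v => X v.1 + Y v.1 v.2, ?_⟩
  rintro ⟨a, b, _ | _⟩
  · simp only [ends2_false, hY]; ring
  · simp only [ends2_true]
    have key : ∀ b, X (a + 1) + Y (a + 1) b + f (a, b, true) + X a + Y a b = 0 := by
      have two : ∀ z : ZMod 2, z + z = 0 := CharTwo.add_self_eq_zero
      have step : ∀ b, X (a + 1) + Y (a + 1) (b + 1) + f (a, b + 1, true) + X a + Y a (b + 1) =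
          X (a + 1) + Y (a + 1) b + f (a, b, true) + X a + Y a b := by
        intro b
        rw [hY, hY]
        have := hf a b
        linear_combination this + two (f (a, b, false)) + two (f (a, b + 1, true)) -
          two (f (a, b, true))
      intro b
      induction b using Int.induction_on with
      | zero =>
        rw [hY0, hY0, hX]
        linear_combination two (X a) + two (f (a, 0, true))
      | succ i ih => rw [step]; exact ih
      | pred i ih =>
        have := step (-(i : ℤ) - 1)
        rw [sub_add_cancel] at this
        rw [← this]; exact ih
    have two : ∀ z : ZMod 2, z + z = 0 := CharTwo.add_self_eq_zero
    linear_combination key b - two (X a) - two (Y a b) - two (f (a, b, true))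

/-- The endpoints of `e` are on different sides of `C`. -/
def IsCut (C : Set (ℤ × ℤ)) (e : Z2Edge) : Prop := ¬ ((ends2 e).1 ∈ C ↔ (ends2 e).2 ∈ C)

/-- Any two vertices of `C` are joined by a lattice path inside `C`. -/
def LatticeConnected (C : Set (ℤ × ℤ)) : Prop :=
  ∀ u ∈ C, ∀ v ∈ C,
    Relation.ReflTransGen (fun a b => Link ends2 Set.univ a b ∧ a ∈ C ∧ b ∈ C) u v

/-- If `C` and its complement are both connected, then the faces along the cut are connected to
each other through edges of the cut: a set of faces closed under crossing the cut that contains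
a face along one cut edge contains the faces along all of them. The cut edges next to the set
of faces form a cocycle, hence a coboundary, of a function that is constant on both sides. -/
theorem faceA_mem_of_isCut {C : Set (ℤ × ℤ)} (hC : LatticeConnected C)
    (hC' : LatticeConnected Cᶜ) {P : Set (ℤ × ℤ)}
    (hP : ∀ e, IsCut C e → (faceA e ∈ P ↔ faceB e ∈ P)) {e e' : Z2Edge} (he : IsCut C e)
    (he' : IsCut C e') (h : faceA e ∈ P) : faceA e' ∈ P := by
  classical
  set f : Z2Edge → ZMod 2 := fun e => if IsCut C e ∧ faceA e ∈ P then 1 else 0 with hf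
  have hcl : ∀ a b, f (a, b, true) + f (a + 1, b, false) =
      f (a, b, false) + f (a, b + 1, true) := by
    intro a b
    have h1 := hP (a + 1, b, false)
    have h2 := hP (a, b + 1, true)
    simp only [faceA_mk, faceB_true, faceB_false, add_sub_cancel_right] at h1 h2
    simp only [hf, faceA_mk]
    have e1 : (IsCut C (a + 1, b, false) ∧ (a + 1, b) ∈ P) ↔
      (IsCut C (a + 1, b, false) ∧ (a, b) ∈ P) := and_congr_right h1
    have e2 : (IsCut C (a, b + 1, true) ∧ (a, b + 1) ∈ P) ↔
      (IsCut C (a, b + 1, true) ∧ (a, b) ∈ P) := and_congr_right h2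
    simp only [e1, e2]
    simp only [IsCut, ends2_true, ends2_false]
    by_cases hp : (a, b) ∈ P <;> by_cases c1 : (a, b) ∈ C <;> by_cases c2 : (a + 1, b) ∈ C <;>
      by_cases c3 : (a, b + 1) ∈ C <;> by_cases c4 : (a + 1, b + 1) ∈ C <;>
      simp [hp, c1, c2, c3, c4] <;> decide
  obtain ⟨ϕ, hϕ⟩ := exists_potential f hcl
  have hconst : ∀ D : Set (ℤ × ℤ), LatticeConnected D →
      (∀ e, (ends2 e).1 ∈ D → (ends2 e).2 ∈ D → ¬ IsCut C e) →
      ∀ u ∈ D, ∀ v ∈ D, ϕ u = ϕ v := by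
    intro D hD hnc u hu v hv
    have := hD u hu v hv
    clear hv
    induction this with
    | refl => rfl
    | tail _ h2 ih =>
      obtain ⟨⟨e, -, hxy⟩, ha, hb⟩ := h2
      rw [ih]
      rcases hxy with h | h
      · have hf0 : f e = 0 := if_neg fun hh =>
          hnc e (by rw [h]; exact ha) (by rw [h]; exact hb) hh.1
        have := hϕ e
        rw [h, hf0, add_zero] at this
        exact this.symm
      · have hf0 : f e = 0 := if_neg fun hh =>
          hnc e (by rw [h]; exact hb) (by rw [h]; exact ha) hh.1
        have := hϕ e
        rw [h, hf0, add_zero] at this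
        exact this
  have hin := hconst C hC fun e h1 h2 hc => hc (iff_of_true h1 h2)
  have hout := hconst Cᶜ hC' fun e h1 h2 hc => hc (iff_of_false h1 h2)
  -- both edges lead from `C` to its complement, in one direction or the other
  have hff : f e = f e' := by
    have i1 := hϕ e
    have i2 := hϕ e'
    have two : ∀ z : ZMod 2, z + z = 0 := CharTwo.add_self_eq_zero
    unfold IsCut at he he'
    by_cases c1 : (ends2 e).1 ∈ C <;> by_cases c2 : (ends2 e').1 ∈ C
    · have d1 : (ends2 e).2 ∈ Cᶜ := fun h => he (iff_of_true c1 h)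
      have d2 : (ends2 e').2 ∈ Cᶜ := fun h => he' (iff_of_true c2 h)
      linear_combination i2 - i1 - hin _ c1 _ c2 + hout _ d1 _ d2
    · have d1 : (ends2 e).2 ∈ Cᶜ := fun h => he (iff_of_true c1 h)
      have d2 : (ends2 e').2 ∈ C := by by_contra h; exact he' (iff_of_false c2 h)
      have a1 := hin _ c1 _ d2
      have a2 := hout _ d1 _ c2
      linear_combination -i1 - i2 - a1 + a2 - two (f e')
    · have d1 : (ends2 e).2 ∈ C := by by_contra h; exact he (iff_of_false c1 h)
      have d2 : (ends2 e').2 ∈ Cᶜ := fun h => he' (iff_of_true c2 h)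
      have a1 := hin _ d1 _ c2
      have a2 := hout _ c1 _ d2
      linear_combination -i1 - i2 + a1 - a2 - two (f e')
    · have d1 : (ends2 e).2 ∈ C := by by_contra h; exact he (iff_of_false c1 h)
      have d2 : (ends2 e').2 ∈ C := by by_contra h; exact he' (iff_of_false c2 h)
      linear_combination i2 - i1 + hin _ d1 _ d2 - hout _ c1 _ c2
  have h1 : f e = 1 := if_pos ⟨he, h⟩
  by_contra hno
  have h2 : f e' = 0 := if_neg fun hh => hno hh.2
  rw [h1, h2] at hff
  exact absurd hff (by decide)

/-- The relation of being lattice neighbours that both lie in `D`. -/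
def StepIn (D : Set (ℤ × ℤ)) (a b : ℤ × ℤ) : Prop := Link ends2 Set.univ a b ∧ a ∈ D ∧ b ∈ D

theorem StepIn.symm {D : Set (ℤ × ℤ)} {a b : ℤ × ℤ} (h : StepIn D a b) : StepIn D b a :=
  ⟨h.1.symm, h.2.2, h.2.1⟩

theorem rtg_stepIn_symm {D : Set (ℤ × ℤ)} {a b : ℤ × ℤ}
    (h : Relation.ReflTransGen (StepIn D) a b) : Relation.ReflTransGen (StepIn D) b a := by
  induction h with
  | refl => exact .refl
  | tail _ h2 ih => exact ih.head h2.symm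

theorem rtg_stepIn_mono {D D' : Set (ℤ × ℤ)} (hD : D ⊆ D') {a b : ℤ × ℤ}
    (h : Relation.ReflTransGen (StepIn D) a b) : Relation.ReflTransGen (StepIn D') a b :=
  Relation.ReflTransGen.mono (fun _ _ h => ⟨h.1, hD h.2.1, hD h.2.2⟩) _ _ h

theorem rtg_horizontal {D : Set (ℤ × ℤ)} {x x' y : ℤ}
    (h : ∀ t, min x x' ≤ t → t ≤ max x x' → (t, y) ∈ D) :
    Relation.ReflTransGen (StepIn D) (x, y) (x', y) := by
  have key : ∀ (n : ℕ) (x : ℤ), (∀ t, x ≤ t → t ≤ x + n → (t, y) ∈ D) →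
      Relation.ReflTransGen (StepIn D) (x, y) (x + n, y) := by
    intro n
    induction n with
    | zero => intro x _; simpa using Relation.ReflTransGen.refl
    | succ n ih =>
      intro x hx
      refine (ih x fun t h1 h2 => hx t h1 (by push_cast; omega)).tail ⟨⟨(x + n, y, true), trivial,
        Or.inl ?_⟩, hx _ (by omega) (by push_cast; omega), hx _ (by omega) (by omega)⟩
      simp only [ends2_true, Nat.cast_succ, add_assoc]
  rcases le_total x x' with hle | hle
  · have := key (x' - x).toNat x fun t h1 h2 => h t (by omega) (by omega)
    rwa [show x + ((x' - x).toNat : ℤ) = x' by omega] at this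
  · have := key (x - x').toNat x' fun t h1 h2 => h t (by omega) (by omega)
    rw [show x' + ((x - x').toNat : ℤ) = x by omega] at this
    exact rtg_stepIn_symm this

theorem rtg_vertical {D : Set (ℤ × ℤ)} {x y y' : ℤ}
    (h : ∀ t, min y y' ≤ t → t ≤ max y y' → (x, t) ∈ D) :
    Relation.ReflTransGen (StepIn D) (x, y) (x, y') := by
  have key : ∀ (n : ℕ) (y : ℤ), (∀ t, y ≤ t → t ≤ y + n → (x, t) ∈ D) →
      Relation.ReflTransGen (StepIn D) (x, y) (x, y + n) := by
    intro n
    induction n with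
    | zero => intro y _; simpa using Relation.ReflTransGen.refl
    | succ n ih =>
      intro y hy
      refine (ih y fun t h1 h2 => hy t h1 (by push_cast; omega)).tail ⟨⟨(x, y + n, false), trivial,
        Or.inl ?_⟩, hy _ (by omega) (by push_cast; omega), hy _ (by omega) (by omega)⟩
      simp only [ends2_false, Nat.cast_succ, add_assoc]
  rcases le_total y y' with hle | hle
  · have := key (y' - y).toNat y fun t h1 h2 => h t (by omega) (by omega)
    rwa [show y + ((y' - y).toNat : ℤ) = y' by omega] at this
  · have := key (y - y').toNat y' fun t h1 h2 => h t (by omega) (by omega)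
    rw [show y' + ((y - y').toNat : ℤ) = y by omega] at this
    exact rtg_stepIn_symm this

/-- The points at sup-distance at least `r` from `c`. -/
def far (c : ℤ × ℤ) (r : ℤ) : Set (ℤ × ℤ) := {v | r ≤ |v.1 - c.1| ∨ r ≤ |v.2 - c.2|}

/-- The box of radius `r` around the origin. -/
def box2 (r : ℤ) : Set (ℤ × ℤ) := {v | |v.1| ≤ r ∧ |v.2| ≤ r}

theorem mem_far {c v : ℤ × ℤ} {r : ℤ} : v ∈ far c r ↔ r ≤ |v.1 - c.1| ∨ r ≤ |v.2 - c.2| := Iff.rfl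

theorem mem_box2 {v : ℤ × ℤ} {r : ℤ} : v ∈ box2 r ↔ |v.1| ≤ r ∧ |v.2| ≤ r := Iff.rfl

theorem latticeConnected_box2 {r : ℤ} (hr : 0 ≤ r) : LatticeConnected (box2 r) := by
  have key : ∀ v ∈ box2 r, Relation.ReflTransGen (StepIn (box2 r)) v (0, 0) := by
    rintro ⟨x, y⟩ hv
    rw [mem_box2, abs_le, abs_le] at hv
    refine (rtg_horizontal (x' := 0) fun t h1 h2 => ?_).trans
      (rtg_vertical (y' := 0) fun t h1 h2 => ?_) <;>
    · simp only [mem_box2, abs_le] at *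
      omega
  intro u hu v hv
  exact (key u hu).trans (rtg_stepIn_symm (key v hv))

theorem rtg_far {D : Set (ℤ × ℤ)} {r : ℤ} (hD : far 0 r ⊆ D) {u : ℤ × ℤ}
    (hu : u ∈ far 0 r) : Relation.ReflTransGen (StepIn D) u (r, r) := by
  refine rtg_stepIn_mono hD ?_
  obtain ⟨x, y⟩ := u
  simp only [mem_far, Prod.fst_zero, Prod.snd_zero, sub_zero] at hu
  rcases hu with h | h
  · refine (rtg_vertical (y' := r) fun t h1 h2 => ?_).trans
      (rtg_horizontal (x' := r) fun t h1 h2 => ?_)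
    · exact Or.inl (by simpa using h)
    · exact Or.inr (by simpa using le_abs_self r)
  · refine (rtg_horizontal (x' := r) fun t h1 h2 => ?_).trans
      (rtg_vertical (y' := r) fun t h1 h2 => ?_)
    · exact Or.inr (by simpa using h)
    · exact Or.inl (by simpa using le_abs_self r)

/-- A bounded connected set can be filled, by adding the bounded components of its complement,
without creating new cut edges. -/
theorem exists_filling {C₀ : Set (ℤ × ℤ)} (hC₀ : LatticeConnected C₀) (hne : C₀.Nonempty) {r : ℤ}
    (hfar : Disjoint C₀ (far 0 r)) :
    ∃ C, C₀ ⊆ C ∧ Disjoint C (far 0 r) ∧ LatticeConnected C ∧ LatticeConnected Cᶜ ∧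
      ∀ e, IsCut C e → IsCut C₀ e := by
  -- the unbounded component of the complement; the filling is its complement
  set U : Set (ℤ × ℤ) := {v | v ∉ C₀ ∧ Relation.ReflTransGen (StepIn C₀ᶜ) v (r, r)} with hU
  have hfarC : far 0 r ⊆ C₀ᶜ := fun v hv h => Set.disjoint_left.1 hfar h hv
  have hfarU : far 0 r ⊆ U := fun v hv => ⟨hfarC hv, rtg_far hfarC hv⟩
  have hstep : ∀ {u v}, Link ends2 Set.univ u v → u ∉ C₀ → v ∈ U → u ∈ U :=
    fun h hu hv => ⟨hu, hv.2.head ⟨h, hu, hv.1⟩⟩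
  have hUto : ∀ v ∈ U, Relation.ReflTransGen (StepIn U) v (r, r) := by
    rintro v ⟨hv, h⟩
    clear hv
    induction h using Relation.ReflTransGen.head_induction_on with
    | refl => exact .refl
    | head h1 h2 ih => exact ih.head ⟨h1.1, ⟨h1.2.1, h2.head h1⟩, ⟨h1.2.2, h2⟩⟩
  obtain ⟨c, hc⟩ := hne
  have hCto : ∀ v ∈ Uᶜ, Relation.ReflTransGen (StepIn Uᶜ) v c := by
    intro v hv
    have hCU : C₀ ⊆ Uᶜ := fun v hv h => h.1 hv
    have hpath : Relation.ReflTransGen (StepIn Set.univ) v c :=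
      (rtg_horizontal (x' := c.1) fun _ _ _ => Set.mem_univ _).trans
        (rtg_vertical (y' := c.2) fun _ _ _ => Set.mem_univ _)
    induction hpath using Relation.ReflTransGen.head_induction_on with
    | refl => exact .refl
    | head h1 h2 ih =>
      rename_i v w
      by_cases hvC : v ∈ C₀
      · exact rtg_stepIn_mono hCU (hC₀ v hvC c hc)
      · have hw : w ∈ Uᶜ := fun hw => hv (hstep h1.1 hvC hw)
        exact (ih hw).head ⟨h1.1, hv, hw⟩
  refine ⟨Uᶜ, fun v hv h => h.1 hv, Set.disjoint_left.2 fun v hv hf => hv (hfarU hf),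
    fun u hu v hv => (hCto u hu).trans (rtg_stepIn_symm (hCto v hv)), ?_, ?_⟩
  · rw [compl_compl]
    exact fun u hu v hv => (hUto u hu).trans (rtg_stepIn_symm (hUto v hv))
  · intro e he
    have hl : Link ends2 Set.univ (ends2 e).1 (ends2 e).2 := ⟨e, trivial, Or.inl rfl⟩
    unfold IsCut at he ⊢
    by_cases h1 : (ends2 e).1 ∈ U <;> by_cases h2 : (ends2 e).2 ∈ U
    · simp [h1, h2] at he
    · refine fun hh => h2 (hstep hl.symm ?_ h1)
      rw [← hh]; exact h1.1
    · refine fun hh => h1 (hstep hl ?_ h2)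
      rw [hh]; exact h2.1
    · simp [h1, h2] at he

/-- The union of the clusters of a connected set is connected. -/
theorem latticeConnected_cluster {A : Set (ℤ × ℤ)} (hA : LatticeConnected A) (S : Set Z2Edge) :
    LatticeConnected {v | ∃ u ∈ A, Conn ends2 S u v} := by
  set C : Set (ℤ × ℤ) := {v | ∃ u ∈ A, Conn ends2 S u v} with hC
  have key : ∀ u ∈ A, ∀ v, Conn ends2 S u v → Relation.ReflTransGen (StepIn C) u v := by
    intro u hu v h
    induction h with
    | refl => exact .refl
    | tail h1 h2 ih =>
      exact ih.tail ⟨h2.mono (Set.subset_univ _), ⟨u, hu, h1⟩, ⟨u, hu, h1.tail h2⟩⟩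
  rintro v ⟨u, hu, h⟩ v' ⟨u', hu', h'⟩
  have hAC : A ⊆ C := fun a ha => ⟨a, ha, Conn.refl a⟩
  exact (rtg_stepIn_symm (key u hu v h)).trans
    ((rtg_stepIn_mono hAC (hA u hu u' hu')).trans (key u' hu' v' h'))

theorem not_mem_of_isCut_cluster {A : Set (ℤ × ℤ)} {S : Set Z2Edge} {e : Z2Edge}
    (h : IsCut {v | ∃ u ∈ A, Conn ends2 S u v} e) : e ∉ S := by
  intro he
  refine h ⟨?_, ?_⟩
  · rintro ⟨u, hu, hc⟩
    exact ⟨u, hu, hc.tail ⟨e, he, Or.inl rfl⟩⟩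
  · rintro ⟨u, hu, hc⟩
    exact ⟨u, hu, hc.tail ⟨e, he, Or.inr rfl⟩⟩

/-! ### Bond percolation on the square lattice -/

/-- The edges of the square lattice whose base point lies in the box of radius `n`. -/
noncomputable def boxEdges (n : ℕ) : Finset Z2Edge :=
  Finset.Icc (-(n : ℤ)) n ×ˢ Finset.Icc (-(n : ℤ)) n ×ˢ Finset.univ

theorem mem_boxEdges {n : ℕ} {e : Z2Edge} :
    e ∈ boxEdges n ↔ (-(n : ℤ) ≤ e.1 ∧ e.1 ≤ n) ∧ (-(n : ℤ) ≤ e.2.1 ∧ e.2.1 ≤ n) := by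
  simp [boxEdges, Finset.mem_product]

theorem mem_boxEdges_of_link {n : ℕ} {e : Z2Edge} {x y : ℤ × ℤ}
    (h : ends2 e = (x, y) ∨ ends2 e = (y, x)) (hx : x ∉ far 0 n) : e ∈ boxEdges n := by
  obtain ⟨a, b, d⟩ := e
  simp only [mem_far, Prod.fst_zero, Prod.snd_zero, sub_zero, not_or, not_le, abs_lt] at hx
  rw [mem_boxEdges]
  cases d <;> simp only [ends2_true, ends2_false, Prod.mk.injEq] at h ⊢ <;>
    rcases h with ⟨h, h'⟩ | ⟨h', h⟩ <;> subst h <;> simp only at hx <;> omega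

/-- Translation of the edges of the square lattice. -/
def shiftEdge (x : ℤ × ℤ) : Z2Edge ↪ Z2Edge :=
  ⟨fun e => (e.1 + x.1, e.2.1 + x.2, e.2.2), fun e f h => by
    simp only [Prod.mk.injEq, add_left_inj] at h
    exact Prod.ext h.1 (Prod.ext h.2.1 h.2.2)⟩

theorem shiftEdge_apply (x : ℤ × ℤ) (e : Z2Edge) :
    shiftEdge x e = (e.1 + x.1, e.2.1 + x.2, e.2.2) := rfl

theorem ends2_shiftEdge (x : ℤ × ℤ) (e : Z2Edge) :
    ends2 (shiftEdge x e) = ((ends2 e).1 + x, (ends2 e).2 + x) := by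
  obtain ⟨a, b, _ | _⟩ := e <;>
    simp only [shiftEdge_apply, ends2_true, ends2_false] <;>
    ext <;> simp <;> ring

theorem shiftEdge_neg (x : ℤ × ℤ) (e : Z2Edge) : shiftEdge x (shiftEdge (-x) e) = e := by
  simp [shiftEdge_apply]

theorem shiftEdge_neg' (x : ℤ × ℤ) (e : Z2Edge) : shiftEdge (-x) (shiftEdge x e) = e := by
  simp [shiftEdge_apply]

theorem map_shiftEdge (x : ℤ × ℤ) (E : Finset Z2Edge) :
    (E.map (shiftEdge (-x))).map (shiftEdge x) = E := by
  ext e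
  simp only [Finset.mem_map, exists_exists_and_eq_and, shiftEdge_neg, exists_eq_right]

section Transport

variable {V V' α β : Type*} {ends : α → V × V} {ends' : β → V' × V'}

/-- A map of graphs maps connected vertices to connected vertices. -/
theorem Conn.map {σ : α → β} {φ : V → V'}
    (hσ : ∀ e, ends' (σ e) = (φ (ends e).1, φ (ends e).2)) {S : Set α} {T : Set β}
    (hST : ∀ e ∈ S, σ e ∈ T) {u v : V} (h : Conn ends S u v) : Conn ends' T (φ u) (φ v) := by
  induction h with
  | refl => exact Conn.refl _
  | tail _ h2 ih =>
    obtain ⟨e, he, h⟩ := h2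
    refine ih.tail ⟨σ e, hST e he, ?_⟩
    rcases h with h | h <;> simp [hσ, h]

end Transport

/-- The parameter of an edge as a function of its direction. -/
def dirP (q : Bool → ℝ) (e : Z2Edge) : ℝ := q e.2.2

/-- The expected number of open edges leaving `W` from the cluster of the origin in `W`. -/
noncomputable def exitMean (q : Bool → ℝ) (W : Finset (ℤ × ℤ)) (E : Finset Z2Edge) : ℝ :=
  ∑ e ∈ E, dirP q e * bernE (dirP q) E (fun S => ind (ReachBdry ends2 0 W (S : Set Z2Edge) e))

section Decay

variable {q : Bool → ℝ} (q0 : ∀ b, 0 ≤ q b) (q1 : ∀ b, q b ≤ 1)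

include q0 q1 in
/-- If the mean number of exits from some finite set is at most `lam`, then connection
probabilities decay geometrically with ratio `lam`, in every finite set of edges. -/
theorem bernE_conn_le_pow {W : Finset (ℤ × ℤ)} (hW0 : (0 : ℤ × ℤ) ∈ W) {L : ℕ}
    (hWL : ∀ v ∈ W, v ∉ far 0 L) {lam : ℝ} (hlam : exitMean q W (boxEdges L) ≤ lam) (k : ℕ)
    (E : Finset Z2Edge) (x : ℤ × ℤ) :
    bernE (dirP q) E (fun S => ind (∃ b ∈ far x (k * L : ℕ), Conn ends2 (S : Set Z2Edge) x b)) ≤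
      lam ^ k := by
  have p0 : ∀ e, 0 ≤ dirP q e := fun e => q0 _
  have p1 : ∀ e, dirP q e ≤ 1 := fun e => q1 _
  have hlam0 : 0 ≤ lam := le_trans (Finset.sum_nonneg fun e _ => mul_nonneg (p0 e)
    (bernE_nonneg p0 p1 fun S _ => ind_nonneg _)) hlam
  induction k generalizing x with
  | zero => simpa using bernE_le_const p0 p1 (E := E) (c := 1) fun S _ => ind_le_one _
  | succ k ih =>
    set Wx : Finset (ℤ × ℤ) := W.map (addRightEmbedding x) with hWx
    have hmemWx : ∀ v, v ∈ Wx ↔ v - x ∈ W := by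
      intro v
      simp only [hWx, Finset.mem_map, addRightEmbedding_apply]
      exact ⟨by rintro ⟨a, ha, rfl⟩; simpa using ha, fun h => ⟨_, h, sub_add_cancel v x⟩⟩
    have hxW : x ∈ Wx := by rw [hmemWx, sub_self]; exact hW0
    have hnear : ∀ v ∈ Wx, |v.1 - x.1| < L ∧ |v.2 - x.2| < L := by
      intro v hv
      have := hWL _ ((hmemWx v).1 hv)
      simpa [mem_far] using this
    have hkL : ((k + 1) * L : ℕ) = ((k * L : ℕ) : ℤ) + L := by push_cast; ring
    have hdisj : ∀ v ∈ Wx, v ∉ far x ((k + 1) * L : ℕ) := by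
      intro v hv hf
      have := hnear v hv
      rw [mem_far, hkL] at hf
      have : (0 : ℤ) ≤ (k * L : ℕ) := by positivity
      omega
    refine (simon_inequality E p0 p1 hxW hdisj).trans ?_
    -- an outer endpoint is at distance at most `L` from `x`, hence still at distance `k * L` from
    -- the target
    have hout : ∀ e ∈ E, dirP q e *
        bernE (dirP q) E (fun S => ind (ReachBdry ends2 x Wx (S : Set Z2Edge) e)) *
        bernE (dirP q) E (fun S => ind (∃ b ∈ far x ((k + 1) * L : ℕ),
          Conn ends2 (S : Set Z2Edge) (outerEnd ends2 Wx e) b)) ≤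
        dirP q e * bernE (dirP q) E (fun S => ind (ReachBdry ends2 x Wx (S : Set Z2Edge) e)) *
          lam ^ k := by
      intro e _
      by_cases hex : ∃ u v, (ends2 e = (u, v) ∨ ends2 e = (v, u)) ∧ u ∈ Wx ∧ v ∉ Wx
      · obtain ⟨u, v, huv, hu, hv⟩ := hex
        refine mul_le_mul_of_nonneg_left ?_ (mul_nonneg (p0 e)
          (bernE_nonneg p0 p1 fun S _ => ind_nonneg _))
        rw [outerEnd_eq huv hu hv]
        refine le_trans (bernE_mono p0 p1 fun S _ => ind_mono ?_) (ih v)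
        rintro ⟨b, hb, hc⟩
        refine ⟨b, ?_, hc⟩
        have hn := hnear u hu
        have hvu : |v.1 - u.1| ≤ 1 ∧ |v.2 - u.2| ≤ 1 := by
          obtain ⟨a, c, _ | _⟩ := e <;>
            simp only [ends2_true, ends2_false, Prod.mk.injEq] at huv <;>
            rcases huv with ⟨h, h'⟩ | ⟨h, h'⟩ <;> subst h <;> subst h' <;> simp
        simp only [mem_far, hkL, abs_lt, abs_le, le_abs] at *
        omega
      · rw [bernE_congr _
          (f := fun S : Finset Z2Edge => ind (ReachBdry ends2 x Wx (S : Set Z2Edge) e))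
          (g := fun _ => 0), bernE_const]
        · simp
        · intro S _
          exact ind_of_not fun ⟨u, v, h1, h2, h3, _⟩ => hex ⟨u, v, h1, h2, h3⟩
    refine (Finset.sum_le_sum hout).trans ?_
    rw [← Finset.sum_mul, pow_succ']
    refine mul_le_mul_of_nonneg_right (le_trans ?_ hlam) (pow_nonneg hlam0 k)
    -- translate to the origin; only the edges of `boxEdges L` matter for exits from `W`
    obtain ⟨E', rfl⟩ : ∃ E' : Finset Z2Edge, E = E'.map (shiftEdge x) :=
      ⟨_, (map_shiftEdge x E).symm⟩
    rw [Finset.sum_map]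
    have hle : ∀ e ∈ E', dirP q (shiftEdge x e) * bernE (dirP q) (E'.map (shiftEdge x))
        (fun S => ind (ReachBdry ends2 x Wx (S : Set Z2Edge) (shiftEdge x e))) ≤
        if e ∈ boxEdges L then dirP q e * bernE (dirP q) (boxEdges L)
          (fun S => ind (ReachBdry ends2 0 W (S : Set Z2Edge) e)) else 0 := by
      intro e _
      have hback : ∀ S : Finset Z2Edge,
          ReachBdry ends2 x Wx ((S.map (shiftEdge x) : Finset Z2Edge) : Set Z2Edge)
            (shiftEdge x e) → ReachBdry ends2 0 W (S : Set Z2Edge) e := by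
        rintro S ⟨u, v, huv, hu, hv, hc⟩
        refine ⟨u - x, v - x, ?_, (hmemWx u).1 hu, fun h => hv ((hmemWx v).2 h), ?_⟩
        · rw [ends2_shiftEdge] at huv
          rcases huv with h | h
          · left
            simp only [Prod.mk.injEq] at h
            ext1 <;> simp [← h.1, ← h.2]
          · right
            simp only [Prod.mk.injEq] at h
            ext1 <;> simp [← h.1, ← h.2]
        · have := Conn.map (ends := ends2) (ends' := ends2) (σ := shiftEdge (-x))
            (φ := fun v => v - x)
            (T := (S : Set Z2Edge) ∩ inn ends2 W)
            (fun e => by rw [ends2_shiftEdge]; simp [sub_eq_add_neg]) ?_ hc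
          · simpa using this
          · rintro f ⟨hf, hf'⟩
            simp only [Finset.coe_map, Set.mem_image, Finset.mem_coe] at hf
            obtain ⟨f, hfS, rfl⟩ := hf
            rw [shiftEdge_neg']
            refine ⟨hfS, ?_⟩
            simp only [inn, Set.mem_ofPred_eq, ends2_shiftEdge, hmemWx, add_sub_cancel_right] at hf'
            exact hf'
      rw [bernE_map]
      have hshift : (fun a => dirP q (shiftEdge x a)) = dirP q := rfl
      rw [hshift]
      split_ifs with heL
      · refine mul_le_mul_of_nonneg_left ?_ (p0 e)
        refine (bernE_mono p0 p1 fun S _ => ind_mono (hback S)).trans ?_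
        have hin : ∀ S ⊆ E', ind (ReachBdry ends2 0 W (S : Set Z2Edge) e) ≤
            ind (ReachBdry ends2 0 W ((S ∩ (E' ∩ boxEdges L) : Finset Z2Edge) : Set Z2Edge) e) := by
          intro S hS
          refine ind_mono ?_
          rintro ⟨u, v, h1, h2, h3, hc⟩
          refine ⟨u, v, h1, h2, h3, hc.mono ?_⟩
          rintro f ⟨hf, hf'⟩
          refine ⟨?_, hf'⟩
          have hfS : f ∈ S := hf
          simp only [Finset.coe_inter, Set.mem_inter_iff, Finset.mem_coe]
          exact ⟨hfS, hS hfS, mem_boxEdges_of_link (Or.inl rfl) (hWL _ hf'.1)⟩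
        refine (bernE_mono p0 p1 hin).trans ?_
        rw [bernE_inter _ Finset.inter_subset_left
          (fun S : Finset Z2Edge => ind (ReachBdry ends2 0 W (S : Set Z2Edge) e))]
        exact bernE_mono_set p0 p1 Finset.inter_subset_right _ fun S T h =>
          ind_mono (ReachBdry.mono (by exact_mod_cast h))
      · rw [bernE_congr (g := fun _ => 0), bernE_const, mul_zero]
        intro S _
        refine ind_of_not fun h => heL ?_
        obtain ⟨u, v, h1, h2, -, -⟩ := hback S h
        exact mem_boxEdges_of_link h1 (hWL _ h2)
    refine (Finset.sum_le_sum hle).trans ?_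
    rw [← Finset.sum_filter]
    refine Finset.sum_le_sum_of_subset_of_nonneg (fun e he => (Finset.mem_filter.1 he).2)
      fun e _ _ => mul_nonneg (p0 e) (bernE_nonneg p0 p1 fun S _ => ind_nonneg _)

end Decay

/-! ### Self-duality and supercritical bond percolation -/

/-- The two faces along an edge, as the endpoints of the dual edge. -/
def faceEnds (e : Z2Edge) : (ℤ × ℤ) × (ℤ × ℤ) := (faceB e, faceA e)

/-- The edge crossed by a dual edge; the dual lattice is identified with the lattice of faces. -/
def dualEdge : Z2Edge ↪ Z2Edge :=
  ⟨fun e => if e.2.2 then (e.1 + 1, e.2.1, false) else (e.1, e.2.1 + 1, true), by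
    rintro ⟨a, b, _ | _⟩ ⟨c, d, _ | _⟩ h <;> simp_all⟩

theorem dualEdge_apply (e : Z2Edge) :
    dualEdge e = if e.2.2 then (e.1 + 1, e.2.1, false) else (e.1, e.2.1 + 1, true) := rfl

theorem faceEnds_dualEdge (e : Z2Edge) : faceEnds (dualEdge e) = ends2 e := by
  obtain ⟨a, b, _ | _⟩ := e <;> simp [faceEnds, dualEdge_apply]

theorem exists_map_dualEdge (E : Finset Z2Edge) : ∃ E' : Finset Z2Edge, E = E'.map dualEdge := by
  refine ⟨E.image fun e => if e.2.2 then (e.1, e.2.1 - 1, false) else (e.1 - 1, e.2.1, true), ?_⟩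
  have hinv : ∀ e : Z2Edge, dualEdge (if e.2.2 then (e.1, e.2.1 - 1, false)
      else (e.1 - 1, e.2.1, true)) = e := by
    rintro ⟨a, b, _ | _⟩ <;> simp [dualEdge_apply]
  ext e
  simp only [Finset.mem_map, Finset.mem_image, exists_exists_and_eq_and, hinv, exists_eq_right]

/-- If a connected set `A` that contains the horizontal segment from `(-K, 0)` to `(K, 0)` is not
connected to distance `n`, then for some `k ≥ K` the face `(k, 0)` is connected by dual edges that
cross closed edges to a face at distance at least `k`. -/
theorem exists_dual_path {A : Set (ℤ × ℤ)} (hA : LatticeConnected A) {K n : ℕ}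
    (hKA : ((K : ℤ), (0 : ℤ)) ∈ A ∧ (-(K : ℤ), (0 : ℤ)) ∈ A) {S : Set Z2Edge}
    (h : ¬ ∃ a ∈ A, ∃ b ∈ far 0 n, Conn ends2 S a b) :
    ∃ k : ℕ, K ≤ k ∧ k < n ∧ ∃ f ∈ far ((k : ℤ), (0 : ℤ)) k,
      Conn faceEnds ((boxEdges n : Set Z2Edge) \ S) ((k : ℤ), (0 : ℤ)) f := by
  have hC₀ := latticeConnected_cluster hA S
  set C₀ : Set (ℤ × ℤ) := {v | ∃ u ∈ A, Conn ends2 S u v} with hC₀def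
  have hdisj : Disjoint C₀ (far 0 n) := Set.disjoint_left.2 fun v ⟨u, hu, hc⟩ hv =>
    h ⟨u, hu, v, hv, hc⟩
  have hAC : A ⊆ C₀ := fun a ha => ⟨a, ha, Conn.refl a⟩
  obtain ⟨C, hCC, hCfar, hconn, hconn', hcut⟩ := exists_filling hC₀ ⟨_, hAC hKA.1⟩ hdisj
  have hcutE : ∀ e, IsCut C e → e ∈ (boxEdges n : Set Z2Edge) \ S := by
    intro e he
    refine ⟨?_, not_mem_of_isCut_cluster (hcut e he)⟩
    by_cases h1 : (ends2 e).1 ∈ C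
    · exact mem_boxEdges_of_link (Or.inl rfl) (Set.disjoint_left.1 hCfar h1)
    · have h2 : (ends2 e).2 ∈ C := by by_contra h2; exact he (iff_of_false h1 h2)
      exact mem_boxEdges_of_link (Or.inr rfl) (Set.disjoint_left.1 hCfar h2)
  -- the last point of the half-axis before the first exit from `C`
  have hexit : ∀ s : ℤ, (s = 1 ∨ s = -1) → ((s * K : ℤ), (0 : ℤ)) ∈ C →
      ∃ k : ℕ, K ≤ k ∧ k < n ∧ ((s * k : ℤ), (0 : ℤ)) ∈ C ∧ ((s * (k + 1) : ℤ), (0 : ℤ)) ∉ C := by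
    intro s hs hK
    by_contra hno
    push Not at hno
    have hall : ∀ k : ℕ, K ≤ k → k ≤ n → ((s * k : ℤ), (0 : ℤ)) ∈ C := by
      intro k hk
      induction k, hk using Nat.le_induction with
      | base => exact fun _ => hK
      | succ k hk ih =>
        intro hkn
        have := hno k hk (by omega) (ih (by omega))
        exact_mod_cast this
    have habs : ∀ m : ℤ, |s * m| = |m| := by
      intro m; rcases hs with rfl | rfl <;> simp
    have hKn : K ≤ n := by
      by_contra hlt
      refine Set.disjoint_left.1 hCfar hK (Or.inl ?_)
      simp only [Prod.fst_zero, sub_zero, habs, Nat.abs_cast]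
      omega
    refine Set.disjoint_left.1 hCfar (hall n hKn le_rfl) (Or.inl ?_)
    simp only [Prod.fst_zero, sub_zero, habs, Nat.abs_cast, le_refl]
  obtain ⟨k, hKk, hkn, hk1, hk2⟩ := hexit 1 (Or.inl rfl) (by simpa using hCC (hAC hKA.1))
  obtain ⟨k', hKk', -, hk1', hk2'⟩ := hexit (-1) (Or.inr rfl) (by simpa using hCC (hAC hKA.2))
  have cut1 : IsCut C ((k : ℤ), (0 : ℤ), true) := by
    simp only [IsCut, ends2_true]
    simp only [one_mul] at hk1 hk2
    exact fun hh => hk2 (hh.1 hk1)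
  have cut2 : IsCut C (-(k' : ℤ) - 1, (0 : ℤ), true) := by
    simp only [IsCut, ends2_true]
    intro hh
    refine hk2' ?_
    have : (-1 * ((k' : ℤ) + 1)) = -(k' : ℤ) - 1 := by ring
    rw [this]
    refine hh.2 ?_
    have : (-(k' : ℤ) - 1 + 1) = -1 * k' := by ring
    rw [this]; exact hk1'
  have hmem := faceA_mem_of_isCut hconn hconn'
    (P := {f | Conn faceEnds ((boxEdges n : Set Z2Edge) \ S) ((k : ℤ), (0 : ℤ)) f})
    (fun e he => ⟨fun hc => hc.tail ⟨e, hcutE e he, Or.inr rfl⟩,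
      fun hc => hc.tail ⟨e, hcutE e he, Or.inl rfl⟩⟩) cut1 cut2 (Conn.refl _)
  refine ⟨k, hKk, hkn, _, ?_, hmem⟩
  simp only [faceA_mk, mem_far, sub_zero]
  left
  rw [abs_of_neg (by omega)]
  omega

/-- At a self-dual parameter the mean number of exits from a finite set is at least one. Otherwise
primal and dual connection probabilities both decay exponentially; but a large box either is
connected to a much larger distance, or is surrounded by a dual path. -/
theorem one_le_exitMean {q : Bool → ℝ} (q0 : ∀ b, 0 ≤ q b) (hq : q true + q false = 1)
    {W : Finset (ℤ × ℤ)} (hW0 : (0 : ℤ × ℤ) ∈ W) {L : ℕ} (hWL : ∀ v ∈ W, v ∉ far 0 L) :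
    1 ≤ exitMean q W (boxEdges L) := by
  classical
  have q1 : ∀ b, q b ≤ 1 := by
    rintro (_ | _)
    · linarith [q0 true]
    · linarith [q0 false]
  have p0 : ∀ e, 0 ≤ dirP q e := fun e => q0 _
  have p1 : ∀ e, dirP q e ≤ 1 := fun e => q1 _
  by_contra hlt
  push Not at hlt
  set lam := exitMean q W (boxEdges L) with hlam
  have hlam0 : 0 ≤ lam := Finset.sum_nonneg fun e _ => mul_nonneg (p0 e)
    (bernE_nonneg p0 p1 fun S _ => ind_nonneg _)
  have hL : 0 < L := by
    rcases Nat.eq_zero_or_pos L with rfl | h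
    · exact absurd (Or.inl (by simp)) (hWL 0 hW0)
    · exact h
  have decay := bernE_conn_le_pow q0 q1 hW0 hWL (le_refl lam)
  -- the closed edges, seen in the dual lattice, have the same law as the open ones
  have hdual : ∀ (k : ℕ) (E : Finset Z2Edge) (x : ℤ × ℤ),
      bernE (dirP q) E (fun S => ind (∃ f ∈ far x (k * L : ℕ),
        Conn faceEnds ((E \ S : Finset Z2Edge) : Set Z2Edge) x f)) ≤ lam ^ k := by
    intro k E x
    rw [bernE_compl (dirP q) E (fun T => ind (∃ f ∈ far x (k * L : ℕ),
        Conn faceEnds (T : Set Z2Edge) x f))]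
    obtain ⟨E', rfl⟩ := exists_map_dualEdge E
    rw [bernE_map]
    have hp : (fun a => 1 - dirP q (dualEdge a)) = dirP q := by
      funext ⟨a, b, d⟩
      cases d <;> simp [dirP, dualEdge_apply] <;> linarith
    rw [hp]
    refine (bernE_mono p0 p1 fun S _ => ind_mono ?_).trans (decay k E' x)
    rintro ⟨f, hf, hc⟩
    refine ⟨f, hf, ?_⟩
    unfold Conn at hc ⊢
    refine Relation.ReflTransGen.mono ?_ _ _ hc
    rintro u v ⟨e, he, huv⟩
    simp only [Finset.coe_map, Set.mem_image, Finset.mem_coe] at he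
    obtain ⟨d, hd, rfl⟩ := he
    rw [faceEnds_dualEdge] at huv
    exact ⟨d, hd, huv⟩
  -- The box `A` has the radius `K = N * L`, where `N` is such that dual paths around it are
  -- unlikely; then `M` is such that connections from `A` to distance `M * L` are unlikely.
  have htend : Tendsto (fun N : ℕ => lam ^ N) atTop (𝓝 0) :=
    tendsto_pow_atTop_nhds_zero_of_lt_one hlam0 hlt
  have h1lam : 0 < 1 - lam := sub_pos.2 hlt
  obtain ⟨N, hN⟩ : ∃ N : ℕ, L * (lam ^ N / (1 - lam)) < 1 / 4 := by
    have : Tendsto (fun N : ℕ => (L : ℝ) * (lam ^ N / (1 - lam))) atTop (𝓝 0) := by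
      simpa using (htend.div_const (1 - lam)).const_mul (L : ℝ)
    exact (this.eventually (gt_mem_nhds (by norm_num))).exists
  set K := N * L with hK
  set A : Finset (ℤ × ℤ) := Finset.Icc (-(K : ℤ)) K ×ˢ Finset.Icc (-(K : ℤ)) K with hA
  have hAbox : (A : Set (ℤ × ℤ)) = box2 K := by
    ext v
    simp only [hA, Finset.coe_product, Finset.coe_Icc, Set.mem_prod, Set.mem_Icc, mem_box2, abs_le]
  obtain ⟨M, hM⟩ : ∃ M : ℕ, A.card * lam ^ M < 1 / 4 := by
    have : Tendsto (fun M : ℕ => (A.card : ℝ) * lam ^ M) atTop (𝓝 0) := by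
      simpa using htend.const_mul (A.card : ℝ)
    exact (this.eventually (gt_mem_nhds (by norm_num))).exists
  set n := (N + M) * L with hn
  set E := boxEdges n
  -- A dual path around `A` meets the half-axis at a point `k = j * L + i`, and leads from there to
  -- distance at least `j * L`.
  have hcover : ∀ S ⊆ E, (1 : ℝ) ≤
      ∑ a ∈ A, ind (∃ b ∈ far a (M * L : ℕ), Conn ends2 (S : Set Z2Edge) a b) +
      ∑ j ∈ Finset.Ico N (N + M), ∑ i ∈ Finset.range L,
        ind (∃ f ∈ far (((j * L + i : ℕ) : ℤ), (0 : ℤ)) (j * L : ℕ),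
          Conn faceEnds ((E \ S : Finset Z2Edge) : Set Z2Edge) (((j * L + i : ℕ) : ℤ), 0) f) := by
    intro S hS
    by_cases hcon : ∃ a ∈ (A : Set (ℤ × ℤ)), ∃ b ∈ far 0 n, Conn ends2 (S : Set Z2Edge) a b
    · obtain ⟨a, ha, b, hb, hc⟩ := hcon
      refine le_add_of_le_of_nonneg ?_ (Finset.sum_nonneg fun j _ => Finset.sum_nonneg fun i _ =>
        ind_nonneg _)
      refine le_trans ?_ (ind_exists_le A fun a =>
        ∃ b ∈ far a (M * L : ℕ), Conn ends2 (S : Set Z2Edge) a b)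
      rw [ind_of]
      refine ⟨a, ha, b, ?_, hc⟩
      have haK := ha
      rw [hAbox, mem_box2] at haK
      have : (n : ℤ) = (K : ℤ) + (M * L : ℕ) := by rw [hn, hK]; push_cast; ring
      rw [mem_far] at hb ⊢
      simp only [Prod.fst_zero, Prod.snd_zero, sub_zero, abs_le, le_abs] at *
      omega
    · refine le_add_of_nonneg_of_le (Finset.sum_nonneg fun a _ => ind_nonneg _) ?_
      obtain ⟨k, hKk, hkn, f, hf, hc⟩ := exists_dual_path
        (by rw [hAbox]; exact latticeConnected_box2 (by positivity)) (K := K)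
        (by rw [hAbox]; simp [mem_box2]) hcon
      set j := k / L
      set i := k % L
      have hk : j * L + i = k := by
        have := Nat.div_add_mod k L
        rw [mul_comm] at this
        exact this
      have hj : j ∈ Finset.Ico N (N + M) := Finset.mem_Ico.2
        ⟨(Nat.le_div_iff_mul_le hL).2 hKk, (Nat.div_lt_iff_lt_mul hL).2 hkn⟩
      have hi : i ∈ Finset.range L := Finset.mem_range.2 (Nat.mod_lt _ hL)
      refine le_trans ?_ (Finset.single_le_sum (f := fun j => ∑ i ∈ Finset.range L,
        ind (∃ f ∈ far (((j * L + i : ℕ) : ℤ), (0 : ℤ)) (j * L : ℕ),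
          Conn faceEnds ((E \ S : Finset Z2Edge) : Set Z2Edge) (((j * L + i : ℕ) : ℤ), 0) f))
        (fun j _ => Finset.sum_nonneg fun i _ => ind_nonneg _) hj)
      refine le_trans ?_ (Finset.single_le_sum (f := fun i =>
        ind (∃ f ∈ far (((j * L + i : ℕ) : ℤ), (0 : ℤ)) (j * L : ℕ),
          Conn faceEnds ((E \ S : Finset Z2Edge) : Set Z2Edge) (((j * L + i : ℕ) : ℤ), 0) f))
        (fun i _ => ind_nonneg _) hi)
      rw [ind_of]
      rw [hk]
      refine ⟨f, ?_, by rw [Finset.coe_sdiff]; exact hc⟩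
      have hjk : j * L ≤ k := by omega
      have hjk' : ((j * L : ℕ) : ℤ) ≤ (k : ℤ) := by exact_mod_cast hjk
      exact hf.imp (fun h => hjk'.trans h) (fun h => hjk'.trans h)
  have hfinal := bernE_mono p0 p1 hcover
  rw [bernE_const, bernE_add, bernE_sum, bernE_sum] at hfinal
  have b1 : ∑ a ∈ A, bernE (dirP q) E (fun S => ind (∃ b ∈ far a (M * L : ℕ),
      Conn ends2 (S : Set Z2Edge) a b)) ≤ A.card * lam ^ M := by
    rw [← nsmul_eq_mul]
    exact Finset.sum_le_card_nsmul _ _ _ fun a _ => decay M E a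
  have b2 : ∑ j ∈ Finset.Ico N (N + M), bernE (dirP q) E (fun S => ∑ i ∈ Finset.range L,
        ind (∃ f ∈ far (((j * L + i : ℕ) : ℤ), (0 : ℤ)) (j * L : ℕ),
          Conn faceEnds ((E \ S : Finset Z2Edge) : Set Z2Edge) (((j * L + i : ℕ) : ℤ), 0) f)) ≤
      L * (lam ^ N / (1 - lam)) := by
    have hj : ∀ j ∈ Finset.Ico N (N + M), bernE (dirP q) E (fun S => ∑ i ∈ Finset.range L,
        ind (∃ f ∈ far (((j * L + i : ℕ) : ℤ), (0 : ℤ)) (j * L : ℕ),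
          Conn faceEnds ((E \ S : Finset Z2Edge) : Set Z2Edge) (((j * L + i : ℕ) : ℤ), 0) f)) ≤
        L * lam ^ j := by
      intro j _
      rw [bernE_sum]
      refine (Finset.sum_le_card_nsmul _ _ _ fun i _ => hdual j E _).trans ?_
      rw [Finset.card_range, nsmul_eq_mul]
    refine (Finset.sum_le_sum hj).trans ?_
    rw [← Finset.mul_sum]
    refine mul_le_mul_of_nonneg_left ?_ (Nat.cast_nonneg _)
    rw [le_div_iff₀ h1lam]
    have geom : ∀ M, (∑ j ∈ Finset.Ico N (N + M), lam ^ j) * (1 - lam) =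
        lam ^ N - lam ^ (N + M) := by
      intro M
      induction M with
      | zero => simp
      | succ M ih =>
        rw [← add_assoc, Finset.sum_Ico_succ_top (by omega), add_mul, ih]
        ring
    rw [geom]
    linarith [pow_nonneg hlam0 (N + M)]
  linarith

/-- Supercritical bond percolation on the square lattice: if the parameters of the two directions
sum to more than one, then the origin is connected to any distance with probability bounded
below. -/
theorem exists_pos_le_bernE_conn {p : Bool → ℝ} (p0 : ∀ b, 0 < p b) (p1 : ∀ b, p b < 1)
    (hp : 1 < p true + p false) :
    ∃ c : ℝ, 0 < c ∧ ∀ (n : ℕ) (E : Finset Z2Edge), boxEdges n ⊆ E →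
      c ≤ bernE (dirP p) E (fun S => ind (∃ b ∈ far 0 n, Conn ends2 (S : Set Z2Edge) 0 b)) := by
  -- the point of the self-dual line at equal distance `t` below `p`
  set t := (p true + p false - 1) / 2 with ht
  have ht0 : 0 < t := by rw [ht]; linarith
  set q : Bool → ℝ := fun b => p b - t with hq
  have q0 : ∀ b, 0 ≤ q b := by
    have h1 := p1 true
    have h2 := p1 false
    have h3 := p0 true
    have h4 := p0 false
    rintro (_ | _) <;> simp only [hq, ht] <;> linarith
  have hq1 : q true + q false = 1 := by simp only [hq, ht]; ring
  refine ⟨1 - Real.exp (-(1 * t)), ?_, fun n E hE => ?_⟩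
  · rw [sub_pos, Real.exp_lt_one_iff]; linarith
  have hfun : (fun e => dirP q e + t) = dirP p := by
    funext e; simp [dirP, hq]
  have := one_sub_exp_le_bernE_conn (ends := ends2) (boxEdges n) (p := dirP q) (fun e => q0 _)
    ht0.le (fun e => by simp only [dirP, hq, sub_add_cancel]; exact (p1 _).le) 0 (far 0 n) (c := 1)
    (fun W hW hWB => (one_le_exitMean q0 hq1 hW hWB).trans (Finset.sum_le_sum fun e _ => ?_))
  · rw [hfun] at this
    exact this.trans (bernE_mono_set (fun e => (p0 _).le) (fun e => (p1 _).le) hE _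
      fun S T h => ind_mono fun ⟨b, hb, hc⟩ => ⟨b, hb, hc.mono (by exact_mod_cast h)⟩)
  · refine mul_le_of_le_one_left (bernE_nonneg (fun e => q0 _) (fun e => ?_) fun S _ =>
      ind_nonneg _) ?_
    all_goals
      simp only [dirP, hq]
      linarith [p1 e.2.2]

/-! ### Comparison of bond percolation with its enhancement -/

/-- The enhancement of a set of edges of the square lattice: when two opposite edges of a face are
open, they are joined to each other (by one of the other two edges of the face). -/
def enh (S : Set Z2Edge) : Set Z2Edge :=
  {e | e ∈ S ∨ (e.2.2 = false ∧ (e.1, e.2.1, true) ∈ S ∧ (e.1, e.2.1 + 1, true) ∈ S) ∨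
    (e.2.2 = true ∧ (e.1, e.2.1, false) ∈ S ∧ (e.1 + 1, e.2.1, false) ∈ S)}

theorem subset_enh (S : Set Z2Edge) : S ⊆ enh S := fun _ h => Or.inl h

theorem enh_mono {S T : Set Z2Edge} (h : S ⊆ T) : enh S ⊆ enh T := by
  rintro e (he | ⟨h1, h2, h3⟩ | ⟨h1, h2, h3⟩)
  · exact Or.inl (h he)
  · exact Or.inr (Or.inl ⟨h1, h h2, h h3⟩)
  · exact Or.inr (Or.inr ⟨h1, h h2, h h3⟩)

/-- The cell: the three stars at its interior vertices, and two further edges. Its translates by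
the lattice spanned by `(3, 0)` and `(1, 2)` partition the edges of the square lattice. -/
def cell : Finset Z2Edge :=
  {(-1, 0, false), (-1, 0, true), (-1, 1, true), (0, -1, false), (0, -1, true), (0, 0, false),
    (0, 0, true), (0, 1, false), (0, 1, true), (1, -1, false), (1, 0, false), (1, 0, true)}

/-- The vertices all of whose edges belong to the cell. -/
def cellInterior : Finset (ℤ × ℤ) := {(0, 0), (1, 0), (0, 1)}

/-- If edges of `X` connect fewer pairs of vertices outside `I` than edges of `Y`, then this remains
true in the presence of further edges that do not touch `I`. -/
theorem conn_union_of_conn {V α : Type*} {ends : α → V × V} {R X Y : Set α} {I : Set V}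
    (hR : ∀ e ∈ R, (ends e).1 ∉ I ∧ (ends e).2 ∉ I)
    (hXY : ∀ u v, u ∉ I → v ∉ I → Conn ends X u v → Conn ends Y u v) {a b : V} (ha : a ∉ I)
    (hb : b ∉ I) (h : Conn ends (R ∪ X) a b) : Conn ends (R ∪ Y) a b := by
  have key : ∃ w, w ∉ I ∧ Conn ends (R ∪ Y) a w ∧ Conn ends X w b := by
    clear hb
    induction h with
    | refl => exact ⟨a, ha, Conn.refl _, Conn.refl _⟩
    | tail _ h2 ih =>
      obtain ⟨w, hw, h3, h4⟩ := ih
      obtain ⟨e, he | he, huv⟩ := h2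
      · have hh := hR e he
        rename_i u v _
        have hu : u ∉ I ∧ v ∉ I := by
          rcases huv with h | h <;> rw [h] at hh
          · exact hh
          · exact hh.symm
        refine ⟨v, hu.2, ?_, Conn.refl _⟩
        exact (h3.trans ((hXY w u hw hu.1 h4).mono Set.subset_union_right)).tail
          ⟨e, Or.inl he, huv⟩
      · exact ⟨w, hw, h3, h4.tail ⟨e, he, huv⟩⟩
  obtain ⟨w, hw, h3, h4⟩ := key
  exact h3.trans ((hXY w b hw hb h4).mono Set.subset_union_right)

/-- A labelling of the vertices that is constant along the edges of `X`, and whose labels are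
vertices connected in `Y`, shows that `X` connects fewer pairs than `Y`. -/
theorem conn_of_label {V α : Type*} {ends : α → V × V} {X Y : Set α} {I : Set V} (l : V → V)
    (hX : ∀ e ∈ X, l (ends e).1 = l (ends e).2) (hY : ∀ v, v ∉ I → Conn ends Y v (l v)) {u v : V}
    (hu : u ∉ I) (hv : v ∉ I) (h : Conn ends X u v) : Conn ends Y u v := by
  have hl : l u = l v := by
    clear hv
    induction h with
    | refl => rfl
    | tail _ h2 ih =>
      obtain ⟨e, he, huv⟩ := h2
      have := hX e he
      rcases huv with h | h <;> rw [h] at this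
      · exact ih.trans this
      · exact ih.trans this.symm
  exact (hY u hu).trans (hl ▸ (hY v hv).symm)

theorem conn_edge {α V : Type*} {ends : α → V × V} {Y : Set α} {e : α} (he : e ∈ Y) :
    Conn ends Y (ends e).1 (ends e).2 := Link.conn ⟨e, he, Or.inl rfl⟩

section Cell

/-- Four configurations in the cell. Each of them connects no more vertices on the boundary of the
cell than the enhancement of the preceding one, and the enhancement of the last one connects
everything. -/
def cellConfig : Fin 4 → Finset Z2Edge
  | 0 => {(-1, 0, true), (-1, 1, true)}
  | 1 => {(-1, 0, false), (0, -1, false), (1, -1, false)}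
  | 2 => {(-1, 0, false), (0, -1, true), (0, 0, false), (0, 1, false), (1, 0, false)}
  | 3 => {(-1, 0, false), (-1, 1, true), (0, -1, true), (0, 0, true), (0, 1, false), (0, 1, true),
      (1, 0, true)}

theorem cellConfig_subset (k : Fin 4) : cellConfig k ⊆ cell := by
  fin_cases k <;> decide

theorem cellConfig_zero_conn {u v : ℤ × ℤ} (hu : u ∉ (cellInterior : Set (ℤ × ℤ)))
    (hv : v ∉ (cellInterior : Set (ℤ × ℤ))) (h : Conn ends2 (cellConfig 0 : Set Z2Edge) u v) :
    Conn ends2 (∅ : Set Z2Edge) u v := by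
  refine conn_of_label (I := (cellInterior : Set (ℤ × ℤ)))
    (fun v => if v = (0, 0) then (-1, 0) else if v = (0, 1) then (-1, 1) else v) ?_ ?_ hu hv h
  · simp only [Finset.mem_coe]; decide
  · intro v hv
    simp only [cellInterior, Finset.coe_insert, Finset.coe_singleton, Set.mem_insert_iff,
      Set.mem_singleton_iff, not_or] at hv
    simp only [hv, if_false]
    exact Conn.refl v

theorem cellConfig_one_conn {u v : ℤ × ℤ} (hu : u ∉ (cellInterior : Set (ℤ × ℤ)))
    (hv : v ∉ (cellInterior : Set (ℤ × ℤ))) (h : Conn ends2 (cellConfig 1 : Set Z2Edge) u v) :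
    Conn ends2 (enh (cellConfig 0 : Set Z2Edge)) u v := by
  refine conn_of_label (I := (cellInterior : Set (ℤ × ℤ)))
    (fun v => if v = (1, 0) then (1, -1) else if v = (0, 0) then (0, -1) else
      if v = (-1, 1) then (-1, 0) else v) ?_ ?_ hu hv h
  · simp only [Finset.mem_coe]; decide
  · intro v hv
    simp only [cellInterior, Finset.coe_insert, Finset.coe_singleton, Set.mem_insert_iff,
      Set.mem_singleton_iff, not_or] at hv
    simp only [hv, if_false]
    split_ifs with h
    · subst h
      have := conn_edge (ends := ends2) (Y := enh (cellConfig 0 : Set Z2Edge))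
        (e := (-1, 0, false)) (by simp [enh, cellConfig])
      exact this.symm
    · exact Conn.refl v

theorem cellConfig_two_conn {u v : ℤ × ℤ} (hu : u ∉ (cellInterior : Set (ℤ × ℤ)))
    (hv : v ∉ (cellInterior : Set (ℤ × ℤ))) (h : Conn ends2 (cellConfig 2 : Set Z2Edge) u v) :
    Conn ends2 (enh (cellConfig 1 : Set Z2Edge)) u v := by
  refine conn_of_label (I := (cellInterior : Set (ℤ × ℤ)))
    (fun v => if v = (1, 0) then (1, 1) else if v = (0, 0) then (0, 2) else
      if v = (0, 1) then (0, 2) else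
      if v = (-1, 1) then (-1, 0) else if v = (1, -1) then (0, -1) else v) ?_ ?_ hu hv h
  · simp only [Finset.mem_coe]; decide
  · intro v hv
    simp only [cellInterior, Finset.coe_insert, Finset.coe_singleton, Set.mem_insert_iff,
      Set.mem_singleton_iff, not_or] at hv
    simp only [hv, if_false]
    split_ifs with h1 h2
    · subst h1
      have := conn_edge (ends := ends2) (Y := enh (cellConfig 1 : Set Z2Edge))
        (e := (-1, 0, false)) (by simp [enh, cellConfig])
      exact this.symm
    · subst h2
      have := conn_edge (ends := ends2) (Y := enh (cellConfig 1 : Set Z2Edge))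
        (e := (0, -1, true)) (by simp [enh, cellConfig])
      exact this.symm
    · exact Conn.refl v

theorem cellConfig_three_conn {u v : ℤ × ℤ} (hu : u ∉ (cellInterior : Set (ℤ × ℤ)))
    (hv : v ∉ (cellInterior : Set (ℤ × ℤ))) (h : Conn ends2 (cellConfig 3 : Set Z2Edge) u v) :
    Conn ends2 (enh (cellConfig 2 : Set Z2Edge)) u v := by
  have e1 := conn_edge (ends := ends2) (Y := enh (cellConfig 2 : Set Z2Edge))
    (e := (-1, 0, false)) (by simp [enh, cellConfig])
  have e2 := conn_edge (ends := ends2) (Y := enh (cellConfig 2 : Set Z2Edge))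
    (e := (0, -1, true)) (by simp [enh, cellConfig])
  have e3 := conn_edge (ends := ends2) (Y := enh (cellConfig 2 : Set Z2Edge))
    (e := (0, 0, false)) (by simp [enh, cellConfig])
  have e4 := conn_edge (ends := ends2) (Y := enh (cellConfig 2 : Set Z2Edge))
    (e := (0, 1, false)) (by simp [enh, cellConfig])
  have e5 := conn_edge (ends := ends2) (Y := enh (cellConfig 2 : Set Z2Edge))
    (e := (1, 0, false)) (by simp [enh, cellConfig])
  have e6 := conn_edge (ends := ends2) (Y := enh (cellConfig 2 : Set Z2Edge))
    (e := (-1, 0, true)) (by simp [enh, cellConfig])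
  have e7 := conn_edge (ends := ends2) (Y := enh (cellConfig 2 : Set Z2Edge))
    (e := (0, 0, true)) (by simp [enh, cellConfig])
  have e34 := e3.trans e4
  refine conn_of_label (I := (cellInterior : Set (ℤ × ℤ)))
    (fun v => if v = (1, 0) then (2, 0) else if v = (0, 0) then (2, 0) else
      if v = (0, 1) then (0, 2) else
      if v = (-1, 1) then (0, 2) else if v = (1, -1) then (0, -1) else
      if v = (-1, 0) then (0, 2) else if v = (1, 1) then (0, 2) else v) ?_ ?_ hu hv h
  · simp only [Finset.mem_coe]; decide
  · intro v hv
    simp only [cellInterior, Finset.coe_insert, Finset.coe_singleton, Set.mem_insert_iff,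
      Set.mem_singleton_iff, not_or] at hv
    simp only [hv, if_false]
    split_ifs with h1 h2 h3 h4
    · subst h1
      exact e1.symm.trans (e6.trans e34)
    · subst h2
      exact e2.symm
    · subst h3
      exact e6.trans e34
    · subst h4
      exact e5.symm.trans (e7.symm.trans e34)
    · exact Conn.refl v

theorem cell_conn {u v : ℤ × ℤ} (hu : u ∉ (cellInterior : Set (ℤ × ℤ)))
    (hv : v ∉ (cellInterior : Set (ℤ × ℤ))) (h : Conn ends2 (cell : Set Z2Edge) u v) :
    Conn ends2 (enh (cellConfig 3 : Set Z2Edge)) u v := by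
  have e1 := conn_edge (ends := ends2) (Y := enh (cellConfig 3 : Set Z2Edge))
    (e := (-1, 0, false)) (by simp [enh, cellConfig])
  have e2 := conn_edge (ends := ends2) (Y := enh (cellConfig 3 : Set Z2Edge))
    (e := (-1, 1, true)) (by simp [enh, cellConfig])
  have e3 := conn_edge (ends := ends2) (Y := enh (cellConfig 3 : Set Z2Edge))
    (e := (0, -1, true)) (by simp [enh, cellConfig])
  have e4 := conn_edge (ends := ends2) (Y := enh (cellConfig 3 : Set Z2Edge))
    (e := (0, 0, true)) (by simp [enh, cellConfig])
  have e5 := conn_edge (ends := ends2) (Y := enh (cellConfig 3 : Set Z2Edge))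
    (e := (0, 1, false)) (by simp [enh, cellConfig])
  have e6 := conn_edge (ends := ends2) (Y := enh (cellConfig 3 : Set Z2Edge))
    (e := (0, 1, true)) (by simp [enh, cellConfig])
  have e7 := conn_edge (ends := ends2) (Y := enh (cellConfig 3 : Set Z2Edge))
    (e := (1, 0, true)) (by simp [enh, cellConfig])
  have e8 := conn_edge (ends := ends2) (Y := enh (cellConfig 3 : Set Z2Edge))
    (e := (0, 0, false)) (by simp [enh, cellConfig])
  have e9 := conn_edge (ends := ends2) (Y := enh (cellConfig 3 : Set Z2Edge))
    (e := (0, -1, false)) (by simp [enh, cellConfig])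
  have e85 := e8.trans e5
  refine conn_of_label (I := (cellInterior : Set (ℤ × ℤ)))
    (fun v => if v = (1, 0) then (0, 2) else if v = (0, 0) then (0, 2) else
      if v = (0, 1) then (0, 2) else
      if v = (-1, 1) then (0, 2) else if v = (1, -1) then (0, 2) else
      if v = (-1, 0) then (0, 2) else if v = (1, 1) then (0, 2) else
      if v = (0, -1) then (0, 2) else if v = (2, 0) then (0, 2) else v) ?_ ?_ hu hv h
  · simp only [Finset.mem_coe]; decide
  · intro v hv
    simp only [cellInterior, Finset.coe_insert, Finset.coe_singleton, Set.mem_insert_iff,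
      Set.mem_singleton_iff, not_or] at hv
    simp only [hv, if_false]
    split_ifs with h1 h2 h3 h4 h5 h6
    · subst h1
      exact e2.trans e5
    · subst h2
      exact e3.symm.trans (e9.trans e85)
    · subst h3
      exact e1.trans (e2.trans e5)
    · subst h4
      exact e6.symm.trans e5
    · subst h5
      exact e9.trans e85
    · subst h6
      exact e7.symm.trans (e4.symm.trans e85)
    · exact Conn.refl v

end Cell

section Perturbation

variable {α : Type*} [DecidableEq α]

theorem bernE_const_sub_le {a b : ℝ} (ha : 0 ≤ a) (hab : a ≤ b) (hb : b ≤ 1) (E : Finset α)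
    (f : Finset α → ℝ) (f0 : ∀ S, 0 ≤ f S) (f1 : ∀ S, f S ≤ 1) :
    bernE (fun _ => b) E f - bernE (fun _ => a) E f ≤ E.card * (b - a) := by
  induction E using Finset.induction_on generalizing f with
  | empty => simp [bernE_empty]
  | insert e E he ih =>
    rw [bernE_insert _ he, bernE_insert _ he, Finset.card_insert_of_notMem he]
    have i1 := ih (fun S => f (insert e S)) (fun S => f0 _) fun S => f1 _
    have i2 := ih f f0 f1
    have j1 : bernE (fun _ : α => b) E (fun S => f (insert e S)) ≤ 1 :=
      bernE_le_const (fun _ => ha.trans hab) (fun _ => hb) fun S _ => f1 _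
    have j2 : 0 ≤ bernE (fun _ : α => b) E f :=
      bernE_nonneg (fun _ => ha.trans hab) (fun _ => hb) fun S _ => f0 _
    have k1 := mul_le_mul_of_nonneg_left i1 ha
    have k2 := mul_le_mul_of_nonneg_left i2 (sub_nonneg.2 (hab.trans hb))
    push_cast
    nlinarith [mul_nonneg (sub_nonneg.2 hab) (sub_nonneg.2 j1), mul_nonneg (sub_nonneg.2 hab) j2]

/-- A pointwise larger function that is strictly larger at some configuration still has the larger
mean after a small decrease of the parameter. -/
theorem bernE_le_bernE_of_gain {ε : ℝ} (hε : 0 ≤ ε) (hε' : ε ≤ 1 / 4) {E : Finset α}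
    (hE : E.card * (2 * ε) ≤ (1 / 4) ^ E.card) {f g : Finset α → ℝ} (f0 : ∀ S, 0 ≤ f S)
    (f1 : ∀ S, f S ≤ 1) (hfg : ∀ S ⊆ E, f S ≤ g S) {S₀ : Finset α} (hS₀ : S₀ ⊆ E)
    (hgain : f S₀ + 1 ≤ g S₀) :
    bernE (fun _ => 1 / 2 + ε) E f ≤ bernE (fun _ => 1 / 2 - ε) E g := by
  have h1 := bernE_const_sub_le (a := 1 / 2 - ε) (b := 1 / 2 + ε) (by linarith) (by linarith)
    (by linarith) E f f0 f1
  have h2 : (1 / 4 : ℝ) ^ E.card ≤ bernE (fun _ => 1 / 2 - ε) E (fun S => g S - f S) := by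
    have hnn : ∀ S ∈ E.powerset, 0 ≤ (∏ _e ∈ S, (1 / 2 - ε)) *
        (∏ _e ∈ E \ S, (1 - (1 / 2 - ε))) * (g S - f S) := fun S hS =>
      mul_nonneg (bernE_weight_nonneg (p := fun _ => 1 / 2 - ε) (fun _ => by linarith)
        (fun _ => by linarith) E S) (sub_nonneg.2 (hfg S (Finset.mem_powerset.1 hS)))
    refine le_trans ?_ (Finset.single_le_sum hnn (Finset.mem_powerset.2 hS₀))
    rw [Finset.prod_const, Finset.prod_const]
    have hc : E.card = S₀.card + (E \ S₀).card := by
      rw [Finset.card_sdiff_of_subset hS₀]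
      have := Finset.card_le_card hS₀
      omega
    have a1 : (1 / 4 : ℝ) ^ S₀.card ≤ (1 / 2 - ε) ^ S₀.card :=
      pow_le_pow_left₀ (by norm_num) (by linarith) _
    have a2 : (1 / 4 : ℝ) ^ (E \ S₀).card ≤ (1 - (1 / 2 - ε)) ^ (E \ S₀).card :=
      pow_le_pow_left₀ (by norm_num) (by linarith) _
    have a3 := mul_le_mul a1 a2 (by positivity) (pow_nonneg (by linarith) _)
    rw [hc, pow_add]
    refine a3.trans (le_mul_of_one_le_right (mul_nonneg (pow_nonneg (by linarith) _)
      (pow_nonneg (by linarith) _)) (by linarith))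
  rw [bernE_sub] at h2
  have h3 : (E.card : ℝ) * (1 / 2 + ε - (1 / 2 - ε)) = E.card * (2 * ε) := by ring
  linarith

end Perturbation

/-- The amount by which the enhancement lowers the critical parameter in the argument below. -/
noncomputable def enhGain : ℝ := 1 / 2 ^ 30

theorem enhGain_pos : 0 < enhGain := by unfold enhGain; positivity

/-- Inside one cell, the enhancement at the parameter `1/2 - ε` connects at least as well as bond
percolation at the parameter `1/2 + ε`, whatever the configuration outside: either the cell does not
matter, or the enhancement of one of the four configurations `cellConfig` makes a difference. -/
theorem bernE_cell_le {R : Set Z2Edge}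
    (hR : ∀ e ∈ R, (ends2 e).1 ∉ (cellInterior : Set (ℤ × ℤ)) ∧
      (ends2 e).2 ∉ (cellInterior : Set (ℤ × ℤ))) {a : ℤ × ℤ} {B : Set (ℤ × ℤ)}
    (ha : a ∉ (cellInterior : Set (ℤ × ℤ))) (hB : ∀ b ∈ B, b ∉ (cellInterior : Set (ℤ × ℤ))) :
    bernE (fun _ => 1 / 2 + enhGain) cell
      (fun S => ind (∃ b ∈ B, Conn ends2 (R ∪ (S : Set Z2Edge)) a b)) ≤
    bernE (fun _ => 1 / 2 - enhGain) cell
      (fun S => ind (∃ b ∈ B, Conn ends2 (R ∪ enh (S : Set Z2Edge)) a b)) := by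
  set F : Set Z2Edge → Prop := fun X => ∃ b ∈ B, Conn ends2 (R ∪ X) a b with hF
  have Fmono : ∀ {X Y : Set Z2Edge}, X ⊆ Y → F X → F Y := fun h ⟨b, hb, hc⟩ =>
    ⟨b, hb, hc.mono (Set.union_subset_union_right _ h)⟩
  have Fle : ∀ {X Y : Set Z2Edge}, (∀ u v, u ∉ (cellInterior : Set (ℤ × ℤ)) →
      v ∉ (cellInterior : Set (ℤ × ℤ)) → Conn ends2 X u v → Conn ends2 Y u v) → F X → F Y :=
    fun h ⟨b, hb, hc⟩ => ⟨b, hb, conn_union_of_conn hR h ha (hB b hb) hc⟩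
  by_cases hgain : ∃ k, ¬ F (cellConfig k : Set Z2Edge) ∧ F (enh (cellConfig k : Set Z2Edge))
  · obtain ⟨k, hk, hk'⟩ := hgain
    refine bernE_le_bernE_of_gain enhGain_pos.le (by unfold enhGain; norm_num) ?_
      (fun S => ind_nonneg _) (fun S => ind_le_one _)
      (fun S _ => ind_mono (Fmono (subset_enh _))) (cellConfig_subset k) ?_
    · have : cell.card = 12 := by decide
      rw [this]; unfold enhGain; norm_num
    · rw [ind_of_not hk, ind_of hk']; norm_num
  · push Not at hgain
    have hstep : ∀ k, F (enh (cellConfig k : Set Z2Edge)) → F (cellConfig k : Set Z2Edge) :=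
      fun k h => by
        by_contra h'
        exact hgain k h' h
    -- no enhancement makes a difference, hence neither does the cell
    have hfull : F (cell : Set Z2Edge) → F ∅ := fun h =>
      Fle (fun _ _ => cellConfig_zero_conn) (hstep 0 (Fle (fun _ _ => cellConfig_one_conn)
        (hstep 1 (Fle (fun _ _ => cellConfig_two_conn) (hstep 2
          (Fle (fun _ _ => cellConfig_three_conn) (hstep 3 (Fle (fun _ _ => cell_conn) h))))))))
    have e0 : (0 : ℝ) ≤ 1 / 2 + enhGain := by unfold enhGain; norm_num
    have e1 : 1 / 2 + enhGain ≤ 1 := by unfold enhGain; norm_num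
    have e2 : (0 : ℝ) ≤ 1 / 2 - enhGain := by unfold enhGain; norm_num
    have e3 : 1 / 2 - enhGain ≤ 1 := by unfold enhGain; norm_num
    refine (bernE_le_const (c := ind (F ∅)) (fun _ => e0) (fun _ => e1) fun S hS =>
      ind_mono fun h => hfull (Fmono (by exact_mod_cast hS) h)).trans ?_
    rw [← bernE_const (fun _ => 1 / 2 - enhGain) cell (ind (F ∅))]
    exact bernE_mono (fun _ => e2) (fun _ => e3) fun S _ => ind_mono (Fmono (Set.empty_subset _))

/-! ### The enhancement percolates below one half -/

theorem bernE_comm {α β : Type*} [DecidableEq α] [DecidableEq β] (p : α → ℝ) (q : β → ℝ)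
    (E : Finset α) (E' : Finset β) (f : Finset α → Finset β → ℝ) :
    bernE p E (fun S => bernE q E' (f S)) = bernE q E' (fun T => bernE p E (fun S => f S T)) := by
  simp only [bernE, Finset.mul_sum]
  rw [Finset.sum_comm]
  exact Finset.sum_congr rfl fun _ _ => Finset.sum_congr rfl fun _ _ => by ring

theorem conn_shift_iff (x : ℤ × ℤ) (S : Set Z2Edge) (u v : ℤ × ℤ) :
    Conn ends2 (shiftEdge x '' S) (u + x) (v + x) ↔ Conn ends2 S u v := by
  constructor
  · intro h
    have := Conn.map (ends' := ends2) (σ := shiftEdge (-x)) (φ := fun w => w + -x)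
      (fun e => ends2_shiftEdge (-x) e) (T := S) (by
        rintro _ ⟨e, he, rfl⟩
        rwa [shiftEdge_neg']) h
    simpa using this
  · intro h
    exact Conn.map (ends' := ends2) (σ := shiftEdge x) (φ := fun w => w + x)
      (fun e => ends2_shiftEdge x e) (fun e he => Set.mem_image_of_mem _ he) h

theorem shiftEdge_mem_enh {x : ℤ × ℤ} {S : Set Z2Edge} {e : Z2Edge} (he : e ∈ enh S) :
    shiftEdge x e ∈ enh (shiftEdge x '' S) := by
  obtain ⟨a, b, k⟩ := e
  rcases he with h | ⟨h0, h1, h2⟩ | ⟨h0, h1, h2⟩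
  · exact Or.inl ⟨_, h, rfl⟩
  · refine Or.inr (Or.inl ⟨h0, ⟨_, h1, rfl⟩, ⟨_, h2, ?_⟩⟩)
    simp [shiftEdge_apply]; ring
  · refine Or.inr (Or.inr ⟨h0, ⟨_, h1, rfl⟩, ⟨_, h2, ?_⟩⟩)
    simp [shiftEdge_apply]; ring

theorem exists_mem_of_mem_enh {S : Set Z2Edge} {e : Z2Edge} (he : e ∈ enh S) :
    (∃ f ∈ S, (ends2 e).1 = (ends2 f).1 ∨ (ends2 e).1 = (ends2 f).2) ∧
    (∃ f ∈ S, (ends2 e).2 = (ends2 f).1 ∨ (ends2 e).2 = (ends2 f).2) := by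
  obtain ⟨a, b, k⟩ := e
  rcases he with h | ⟨h0, h1, h2⟩ | ⟨h0, h1, h2⟩
  · exact ⟨⟨_, h, Or.inl rfl⟩, ⟨_, h, Or.inr rfl⟩⟩
  · simp only at h0; subst h0
    exact ⟨⟨_, h1, Or.inl (by simp)⟩, ⟨_, h2, Or.inl (by simp)⟩⟩
  · simp only at h0; subst h0
    exact ⟨⟨_, h1, Or.inl (by simp)⟩, ⟨_, h2, Or.inl (by simp)⟩⟩

/-- The position of the cell number `c`. The shift by `(1, 0)` keeps the origin out of the interiors
of the cells. -/
def tileAt (c : ℤ × ℤ) : ℤ × ℤ := (3 * c.1 + c.2 + 1, 2 * c.2)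

/-- The translates of the cell that partition the edges of the square lattice. -/
def tile (c : ℤ × ℤ) : Finset Z2Edge := cell.map (shiftEdge (tileAt c))

theorem mem_cellInterior {v : ℤ × ℤ} :
    v ∈ (cellInterior : Set (ℤ × ℤ)) ↔
      (v.1 = 0 ∧ v.2 = 0) ∨ (v.1 = 1 ∧ v.2 = 0) ∨ (v.1 = 0 ∧ v.2 = 1) := by
  obtain ⟨a, b⟩ := v
  simp [cellInterior]

/-- Bounds on the endpoints of the edges of the cell, from which `omega` can separate the tiles. -/
theorem ends2_cell_bound : ∀ e ∈ cell,
    (-1 ≤ (ends2 e).1.1 ∧ (ends2 e).1.1 ≤ 1 ∧ -1 ≤ (ends2 e).1.2 ∧ (ends2 e).1.2 ≤ 1 ∧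
      ((ends2 e).1.1 = -1 → 0 ≤ (ends2 e).1.2)) ∧
    ((ends2 e).2.1 = 2 ∧ (ends2 e).2.2 = 0 ∨ (ends2 e).2.1 = 0 ∧ (ends2 e).2.2 = 2 ∨
    (-1 ≤ (ends2 e).2.1 ∧ (ends2 e).2.1 ≤ 1 ∧ -1 ≤ (ends2 e).2.2 ∧ (ends2 e).2.2 ≤ 1 ∧
      ((ends2 e).2.1 = -1 → 0 ≤ (ends2 e).2.2))) := by decide

/-- The edges of a tile do not touch the interiors of the other tiles. -/
theorem ends2_tile {c c' : ℤ × ℤ} (hc : c ≠ c') {e : Z2Edge} (he : e ∈ tile c) :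
    (ends2 e).1 - tileAt c' ∉ (cellInterior : Set (ℤ × ℤ)) ∧
      (ends2 e).2 - tileAt c' ∉ (cellInterior : Set (ℤ × ℤ)) := by
  obtain ⟨f, hf, rfl⟩ := Finset.mem_map.1 he
  have h := ends2_cell_bound f hf
  obtain ⟨i, j⟩ := c
  obtain ⟨i', j'⟩ := c'
  rw [ends2_shiftEdge]
  rcases h with ⟨h1, h2⟩
  simp only [ne_eq, Prod.mk.injEq] at hc
  simp only [mem_cellInterior, tileAt, Prod.fst_sub, Prod.snd_sub, Prod.fst_add, Prod.snd_add]
  constructor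
  · clear h2
    omega
  · clear h1
    omega

theorem tile_disjoint {c c' : ℤ × ℤ} (hc : c ≠ c') : Disjoint (tile c) (tile c') := by
  rw [Finset.disjoint_left]
  intro e he he'
  obtain ⟨⟨a, b, k⟩, hf, rfl⟩ := Finset.mem_map.1 he
  obtain ⟨⟨a', b', k'⟩, hf', h⟩ := Finset.mem_map.1 he'
  obtain ⟨i, j⟩ := c
  obtain ⟨i', j'⟩ := c'
  simp only [cell, Finset.mem_insert, Finset.mem_singleton, Prod.mk.injEq] at hf hf'
  simp only [shiftEdge_apply, tileAt, Prod.mk.injEq] at h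
  obtain ⟨h1, h2, h3⟩ := h
  subst h3
  simp only [ne_eq, Prod.mk.injEq] at hc
  cases k' <;> simp only [and_true, and_false, or_false, false_or, Bool.false_eq_true,
    Bool.true_eq_false] at hf hf' <;> omega

theorem exists_mem_tile (e : Z2Edge) : ∃ c, e ∈ tile c := by
  obtain ⟨x, y, k⟩ := e
  suffices h : ∃ i j a b : ℤ, (a, b, k) ∈ cell ∧ a + (3 * i + j + 1) = x ∧ b + 2 * j = y by
    obtain ⟨i, j, a, b, h1, h2, h3⟩ := h
    refine ⟨(i, j), Finset.mem_map.2 ⟨(a, b, k), h1, ?_⟩⟩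
    simp [shiftEdge_apply, tileAt, h2, h3]
  have hy : y % 2 = 0 ∨ y % 2 = 1 := by omega
  have hx : (x - y / 2) % 3 = 0 ∨ (x - y / 2) % 3 = 1 ∨ (x - y / 2) % 3 = 2 := by omega
  cases k <;> rcases hy with hy | hy <;> rcases hx with hx | hx | hx
  · exact ⟨(x - y / 2) / 3, y / 2, -1, 0, by decide, by omega, by omega⟩
  · exact ⟨(x - y / 2) / 3, y / 2, 0, 0, by decide, by omega, by omega⟩
  · exact ⟨(x - y / 2) / 3, y / 2, 1, 0, by decide, by omega, by omega⟩
  · exact ⟨(x - y / 2) / 3 - 1, y / 2 + 1, 1, -1, by decide, by omega, by omega⟩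
  · exact ⟨(x - y / 2) / 3, y / 2, 0, 1, by decide, by omega, by omega⟩
  · exact ⟨(x - y / 2) / 3, y / 2 + 1, 0, -1, by decide, by omega, by omega⟩
  · exact ⟨(x - y / 2) / 3, y / 2, -1, 0, by decide, by omega, by omega⟩
  · exact ⟨(x - y / 2) / 3, y / 2, 0, 0, by decide, by omega, by omega⟩
  · exact ⟨(x - y / 2) / 3, y / 2, 1, 0, by decide, by omega, by omega⟩
  · exact ⟨(x - y / 2) / 3, y / 2, -1, 1, by decide, by omega, by omega⟩
  · exact ⟨(x - y / 2) / 3, y / 2, 0, 1, by decide, by omega, by omega⟩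
  · exact ⟨(x - y / 2) / 3, y / 2 + 1, 0, -1, by decide, by omega, by omega⟩

/-- The vertices that are not in the interior of any tile. -/
def ports : Set (ℤ × ℤ) := {v | ∀ c, v - tileAt c ∉ (cellInterior : Set (ℤ × ℤ))}

theorem zero_mem_ports : (0 : ℤ × ℤ) ∈ ports := by
  rintro ⟨i, j⟩
  simp only [mem_cellInterior, tileAt, Prod.fst_sub, Prod.snd_sub, Prod.fst_zero, Prod.snd_zero]
  omega

/-- The comparison of `bernE_cell_le` in a translate of the cell. -/
theorem bernE_tile_le {R : Set Z2Edge} (c : ℤ × ℤ)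
    (hR : ∀ e ∈ R, (ends2 e).1 - tileAt c ∉ (cellInterior : Set (ℤ × ℤ)) ∧
      (ends2 e).2 - tileAt c ∉ (cellInterior : Set (ℤ × ℤ))) {a : ℤ × ℤ} {B : Set (ℤ × ℤ)}
    (ha : a ∈ ports) (hB : B ⊆ ports) :
    bernE (fun _ => 1 / 2 + enhGain) (tile c)
      (fun S => ind (∃ b ∈ B, Conn ends2 (R ∪ (S : Set Z2Edge)) a b)) ≤
    bernE (fun _ => 1 / 2 - enhGain) (tile c)
      (fun S => ind (∃ b ∈ B, Conn ends2 (R ∪ enh (S : Set Z2Edge)) a b)) := by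
  have e0 : (0 : ℝ) ≤ 1 / 2 - enhGain := by unfold enhGain; norm_num
  have e1 : 1 / 2 - enhGain ≤ 1 := by unfold enhGain; norm_num
  have h0 : (0 : ℝ) ≤ 1 / 2 + enhGain := by unfold enhGain; norm_num
  have h1 : 1 / 2 + enhGain ≤ 1 := by unfold enhGain; norm_num
  set o := tileAt c with ho
  have hRim : shiftEdge o '' (shiftEdge (-o) '' R) = R := by
    rw [Set.image_image]; simp only [shiftEdge_neg, Set.image_id']
  have key := bernE_cell_le (R := shiftEdge (-o) '' R) (a := a - o) (B := (fun b => b - o) '' B)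
    (by
      rintro _ ⟨e, he, rfl⟩
      rw [ends2_shiftEdge, ← sub_eq_add_neg, ← sub_eq_add_neg]
      exact hR e he) (ha c) (by
      rintro _ ⟨b, hb, rfl⟩
      exact hB hb c)
  rw [tile, bernE_map, bernE_map]
  refine (bernE_mono (fun _ => h0) (fun _ => h1) fun S _ => ind_mono ?_).trans
    (key.trans (bernE_mono (fun _ => e0) (fun _ => e1) fun S _ => ind_mono ?_))
  · rintro ⟨b, hb, h⟩
    refine ⟨_, ⟨b, hb, rfl⟩, ?_⟩
    rw [← conn_shift_iff o, sub_add_cancel, sub_add_cancel, Set.image_union, hRim]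
    rwa [Finset.coe_map] at h
  · rintro ⟨_, ⟨b, hb, rfl⟩, h⟩
    refine ⟨b, hb, ?_⟩
    rw [← conn_shift_iff o, sub_add_cancel, sub_add_cancel, Set.image_union, hRim] at h
    refine h.mono (Set.union_subset_union_right _ ?_)
    rintro _ ⟨e, he, rfl⟩
    rw [Finset.coe_map]
    exact shiftEdge_mem_enh he

/-- The comparison of `bernE_cell_le`, made in one tile after the other. -/
theorem bernE_biUnion_tile_le (C : Finset (ℤ × ℤ)) {R : Set Z2Edge}
    (hR : ∀ c ∈ C, ∀ e ∈ R, (ends2 e).1 - tileAt c ∉ (cellInterior : Set (ℤ × ℤ)) ∧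
      (ends2 e).2 - tileAt c ∉ (cellInterior : Set (ℤ × ℤ))) {a : ℤ × ℤ} {B : Set (ℤ × ℤ)}
    (ha : a ∈ ports) (hB : B ⊆ ports) :
    bernE (fun _ => 1 / 2 + enhGain) (C.biUnion tile)
      (fun S => ind (∃ b ∈ B, Conn ends2 (R ∪ (S : Set Z2Edge)) a b)) ≤
    bernE (fun _ => 1 / 2 - enhGain) (C.biUnion tile)
      (fun S => ind (∃ b ∈ B, Conn ends2
        (R ∪ ⋃ c ∈ C, enh ((S : Set Z2Edge) ∩ tile c)) a b)) := by
  have e0 : (0 : ℝ) ≤ 1 / 2 - enhGain := by unfold enhGain; norm_num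
  have e1 : 1 / 2 - enhGain ≤ 1 := by unfold enhGain; norm_num
  have h0 : (0 : ℝ) ≤ 1 / 2 + enhGain := by unfold enhGain; norm_num
  have h1 : 1 / 2 + enhGain ≤ 1 := by unfold enhGain; norm_num
  induction C using Finset.induction_on generalizing R with
  | empty => simp [bernE_empty]
  | insert c C hc ih =>
    have hne : ∀ c' ∈ C, c ≠ c' := fun c' hc' h => hc (h ▸ hc')
    have hd : Disjoint (tile c) (C.biUnion tile) := by
      rw [Finset.disjoint_biUnion_right]
      exact fun c' hc' => tile_disjoint (hne c' hc')
    rw [Finset.biUnion_insert, bernE_union _ hd, bernE_union _ hd]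
    -- first the tiles in `C`, for each configuration in the tile `c`
    have s1 : bernE (fun _ => 1 / 2 + enhGain) (tile c) (fun S₁ =>
        bernE (fun _ => 1 / 2 + enhGain) (C.biUnion tile) (fun S₂ =>
          ind (∃ b ∈ B, Conn ends2 (R ∪ ((S₁ ∪ S₂ : Finset Z2Edge) : Set Z2Edge)) a b))) ≤
        bernE (fun _ => 1 / 2 + enhGain) (tile c) (fun S₁ =>
        bernE (fun _ => 1 / 2 - enhGain) (C.biUnion tile) (fun S₂ =>
          ind (∃ b ∈ B, Conn ends2 ((R ∪ ⋃ c' ∈ C, enh ((S₂ : Set Z2Edge) ∩ tile c')) ∪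
            (S₁ : Set Z2Edge)) a b))) := by
      refine bernE_mono (fun _ => h0) (fun _ => h1) fun S₁ hS₁ => ?_
      have := ih (R := R ∪ (S₁ : Set Z2Edge)) fun c' hc' e he => by
        rcases he with he | he
        · exact hR c' (Finset.mem_insert_of_mem hc') e he
        · exact ends2_tile (hne c' hc') (hS₁ he)
      simp only [Finset.coe_union, ← Set.union_assoc]
      simpa only [Set.union_right_comm] using this
    refine s1.trans ?_
    -- then the tile `c`, for each configuration in the others
    rw [bernE_comm, bernE_comm (fun _ => 1 / 2 - enhGain) (fun _ => 1 / 2 - enhGain)]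
    refine bernE_mono (fun _ => e0) (fun _ => e1) fun S₂ _ => ?_
    refine (bernE_tile_le c ?_ ha hB).trans
      (bernE_mono (fun _ => e0) (fun _ => e1) fun S₁ hS₁ => ind_mono ?_)
    · rintro e (he | he)
      · exact hR c (Finset.mem_insert_self _ _) e he
      · simp only [Set.mem_iUnion] at he
        obtain ⟨c', hc', he⟩ := he
        obtain ⟨⟨f, hf, h1⟩, ⟨g, hg, h2⟩⟩ := exists_mem_of_mem_enh he
        have hf' := ends2_tile (hne c' hc').symm hf.2
        have hg' := ends2_tile (hne c' hc').symm hg.2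
        constructor
        · rcases h1 with h | h <;> rw [h]
          exacts [hf'.1, hf'.2]
        · rcases h2 with h | h <;> rw [h]
          exacts [hg'.1, hg'.2]
    · rintro ⟨b, hb, h⟩
      refine ⟨b, hb, h.mono ?_⟩
      rintro e ((he | he) | he)
      · exact Or.inl he
      · right
        simp only [Set.mem_iUnion] at he ⊢
        obtain ⟨c', hc', he⟩ := he
        refine ⟨c', Finset.mem_insert_of_mem hc', enh_mono ?_ he⟩
        exact Set.inter_subset_inter_left _ (by simp)
      · right
        simp only [Set.mem_iUnion]
        refine ⟨c, Finset.mem_insert_self _ _, enh_mono ?_ he⟩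
        exact fun f hf => ⟨by simp [Finset.mem_coe.1 hf], hS₁ hf⟩

/-- Next to every vertex on an open path from the origin, the path contains a port. -/
theorem exists_port {S : Set Z2Edge} {v : ℤ × ℤ} (h : Conn ends2 S 0 v) :
    ∃ w ∈ ports, Conn ends2 S 0 w ∧ (w = v ∨ ∃ c, v - tileAt c ∈ (cellInterior : Set (ℤ × ℤ)) ∧
      -2 ≤ w.1 - (tileAt c).1 ∧ w.1 - (tileAt c).1 ≤ 2 ∧
      -2 ≤ w.2 - (tileAt c).2 ∧ w.2 - (tileAt c).2 ≤ 2) := by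
  induction h with
  | refl => exact ⟨0, zero_mem_ports, Conn.refl _, Or.inl rfl⟩
  | tail h1 h2 ih =>
    rename_i u v
    by_cases hv : v ∈ ports
    · exact ⟨v, hv, h1.tail h2, Or.inl rfl⟩
    · have hv' : ∃ c, v - tileAt c ∈ (cellInterior : Set (ℤ × ℤ)) := by
        simpa only [ports, Set.mem_ofPred_eq, not_forall, not_not] using hv
      obtain ⟨c, hc⟩ := hv'
      have hadj : (u.1 - v.1 = 0 ∨ u.2 - v.2 = 0) ∧ -1 ≤ u.1 - v.1 ∧ u.1 - v.1 ≤ 1 ∧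
          -1 ≤ u.2 - v.2 ∧ u.2 - v.2 ≤ 1 := by
        obtain ⟨⟨x, y, _ | _⟩, -, h | h⟩ := h2 <;>
          simp only [ends2_true, ends2_false, Prod.mk.injEq] at h <;>
          obtain ⟨rfl, rfl⟩ := h <;> simp
      obtain ⟨w, hw, hw', hw2⟩ := ih
      refine ⟨w, hw, hw', Or.inr ⟨c, hc, ?_⟩⟩
      obtain ⟨v1, v2⟩ := v
      obtain ⟨u1, u2⟩ := u
      obtain ⟨w1, w2⟩ := w
      obtain ⟨i, j⟩ := c
      rcases hw2 with h | ⟨⟨i', j'⟩, hu, hb⟩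
      · simp only [Prod.mk.injEq] at h
        simp only [mem_cellInterior, tileAt, Prod.fst_sub, Prod.snd_sub] at hc hadj ⊢
        omega
      · simp only [mem_cellInterior, tileAt, Prod.fst_sub, Prod.snd_sub] at hc hadj hu hb ⊢
        have hj : j = j' := by omega
        have hi : i = i' := by omega
        subst hi; subst hj
        exact hb

/-- Bond percolation on the square lattice, enhanced by joining opposite open edges of faces,
percolates at some parameter smaller than one half. -/
theorem exists_pos_le_bernE_enh : ∃ c, 0 < c ∧ ∀ n : ℕ, ∃ E : Finset Z2Edge,
    c ≤ bernE (fun _ => 1 / 2 - enhGain) E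
      (fun S => ind (∃ b ∈ far 0 n, Conn ends2 (enh (S : Set Z2Edge)) 0 b)) := by
  have e0 : (0 : ℝ) ≤ 1 / 2 - enhGain := by unfold enhGain; norm_num
  have e1 : 1 / 2 - enhGain ≤ 1 := by unfold enhGain; norm_num
  have h0 : (0 : ℝ) < 1 / 2 + enhGain := by unfold enhGain; norm_num
  have h1 : 1 / 2 + enhGain < 1 := by unfold enhGain; norm_num
  obtain ⟨c, hc, H⟩ := exists_pos_le_bernE_conn (p := fun _ => 1 / 2 + enhGain)
    (fun _ => h0) (fun _ => h1) (by have := enhGain_pos; linarith)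
  refine ⟨c, hc, fun n => ?_⟩
  -- The box has the radius `n + 4`, since a port may be used in place of the endpoint of the path.
  choose τ hτ using exists_mem_tile
  have hsub : boxEdges (n + 4) ⊆ ((boxEdges (n + 4)).image τ).biUnion tile := fun e he =>
    Finset.mem_biUnion.2 ⟨τ e, Finset.mem_image_of_mem _ he, hτ e⟩
  refine ⟨((boxEdges (n + 4)).image τ).biUnion tile, (H (n + 4) _ hsub).trans ?_⟩
  refine (bernE_mono (fun _ => h0.le) (fun _ => h1.le) fun S _ => ind_mono ?_).trans
    ((bernE_biUnion_tile_le ((boxEdges (n + 4)).image τ) (R := ∅) (a := 0) (B := ports ∩ far 0 n)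
      (by simp) zero_mem_ports Set.inter_subset_left).trans
      (bernE_mono (fun _ => e0) (fun _ => e1) fun S _ => ind_mono ?_))
  · rintro ⟨b, hb, h⟩
    obtain ⟨w, hw, hw', hb'⟩ := exists_port h
    refine ⟨w, ⟨hw, ?_⟩, by simpa using hw'⟩
    rcases hb' with rfl | ⟨⟨i, j⟩, h2, h3⟩
    · simp only [mem_far, le_abs, Prod.fst_zero, Prod.snd_zero] at hb ⊢
      push_cast at hb
      omega
    · simp only [mem_far, le_abs, Prod.fst_zero, Prod.snd_zero] at hb ⊢
      simp only [mem_cellInterior, tileAt, Prod.fst_sub, Prod.snd_sub] at h2 h3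
      push_cast at hb
      omega
  · rintro ⟨b, hb, h⟩
    refine ⟨b, hb.2, h.mono ?_⟩
    intro e he
    simp only [Set.empty_union, Set.mem_iUnion] at he
    obtain ⟨c', -, he⟩ := he
    exact enh_mono Set.inter_subset_left he

/-! ### Site percolation on the square lattice with diagonals -/

/-- Two sites of `T` that are equal or neighbours horizontally, vertically or diagonally. -/
def StarStep (T : Set (ℤ × ℤ)) (u v : ℤ × ℤ) : Prop :=
  u ∈ T ∧ v ∈ T ∧ |v.1 - u.1| ≤ 1 ∧ |v.2 - u.2| ≤ 1

/-- The sites `u` and `v` are joined by a path of sites of `T`, diagonal steps being allowed. -/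
def StarConn (T : Set (ℤ × ℤ)) : ℤ × ℤ → ℤ × ℤ → Prop := Relation.ReflTransGen (StarStep T)

/-- The site `u` is joined in `T` to the sites at distance at least `n`. -/
def Arm (T : Set (ℤ × ℤ)) (u : ℤ × ℤ) (n : ℤ) : Prop := ∃ b ∈ far u n, StarConn T u b

theorem StarConn.mono {T T' : Set (ℤ × ℤ)} (h : T ⊆ T') {u v : ℤ × ℤ} (hc : StarConn T u v) :
    StarConn T' u v :=
  Relation.ReflTransGen.mono (fun _ _ h' => ⟨h h'.1, h h'.2.1, h'.2.2⟩) _ _ hc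

theorem Arm.mono {T T' : Set (ℤ × ℤ)} (h : T ⊆ T') {u : ℤ × ℤ} {n : ℤ} (ha : Arm T u n) :
    Arm T' u n := by
  obtain ⟨b, hb, hc⟩ := ha
  exact ⟨b, hb, hc.mono h⟩

theorem far_anti {u : ℤ × ℤ} {m n : ℤ} (h : m ≤ n) : far u n ⊆ far u m := fun _ hv =>
  hv.imp h.trans h.trans

theorem Arm.anti {T : Set (ℤ × ℤ)} {u : ℤ × ℤ} {m n : ℤ} (h : m ≤ n) (ha : Arm T u n) :
    Arm T u m := by
  obtain ⟨b, hb, hc⟩ := ha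
  exact ⟨b, far_anti h hb, hc⟩

/-- The sites at distance at most `n` from `u`. -/
noncomputable def sbox (u : ℤ × ℤ) (n : ℤ) : Finset (ℤ × ℤ) :=
  Finset.Icc (u.1 - n) (u.1 + n) ×ˢ Finset.Icc (u.2 - n) (u.2 + n)

theorem mem_sbox {u v : ℤ × ℤ} {n : ℤ} :
    v ∈ sbox u n ↔ (u.1 - n ≤ v.1 ∧ v.1 ≤ u.1 + n) ∧ (u.2 - n ≤ v.2 ∧ v.2 ≤ u.2 + n) := by
  simp [sbox]

theorem arm_inter_sbox {T : Set (ℤ × ℤ)} {u : ℤ × ℤ} {n : ℤ} (h : Arm T u n) :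
    Arm (T ∩ sbox u n) u n := by
  obtain ⟨b, hb, hc⟩ := h
  by_contra hno
  have key : StarConn (T ∩ sbox u n) u b := by
    clear hb
    induction hc with
    | refl => exact Relation.ReflTransGen.refl
    | tail h1 h2 ih =>
      rename_i v w
      have hv : v ∉ far u n := fun hv => hno ⟨v, hv, ih⟩
      simp only [mem_far, not_or, not_le, abs_lt] at hv
      obtain ⟨h3, h4, h5, h6⟩ := h2
      rw [abs_le] at h5 h6
      refine ih.tail ⟨⟨h3, ?_⟩, ⟨h4, ?_⟩, abs_le.2 h5, abs_le.2 h6⟩ <;>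
        rw [Finset.mem_coe, mem_sbox] <;> omega
  exact hno ⟨b, hb, key⟩

theorem arm_inter_iff {S : Finset (ℤ × ℤ)} {u : ℤ × ℤ} {n : ℤ} :
    Arm ((S ∩ sbox u n : Finset (ℤ × ℤ)) : Set (ℤ × ℤ)) u n ↔ Arm (S : Set (ℤ × ℤ)) u n := by
  rw [Finset.coe_inter]
  exact ⟨Arm.mono Set.inter_subset_left, arm_inter_sbox⟩

/-- The probability that site percolation at parameter `q` joins the origin to distance `n`. -/
noncomputable def armProb (q : ℝ) (n : ℤ) : ℝ :=
  bernE (fun _ => q) (sbox 0 n) (fun S : Finset (ℤ × ℤ) => ind (Arm (S : Set (ℤ × ℤ)) 0 n))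

theorem arm_shift {T T' : Set (ℤ × ℤ)} {u x : ℤ × ℤ} {n : ℤ} (hT : ∀ v ∈ T, v + x ∈ T')
    (h : Arm T u n) : Arm T' (u + x) n := by
  obtain ⟨b, hb, hc⟩ := h
  refine ⟨b + x, ?_, ?_⟩
  · simpa [mem_far] using hb
  · clear hb
    induction hc with
    | refl => exact Relation.ReflTransGen.refl
    | tail _ h2 ih =>
      refine ih.tail ⟨hT _ h2.1, hT _ h2.2.1, ?_, ?_⟩
      · simpa using h2.2.2.1
      · simpa using h2.2.2.2

theorem bernE_sbox_arm (q : ℝ) (u : ℤ × ℤ) (n : ℤ) :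
    bernE (fun _ => q) (sbox u n) (fun S : Finset (ℤ × ℤ) => ind (Arm (S : Set (ℤ × ℤ)) u n)) =
      armProb q n := by
  have hmap : sbox u n = (sbox 0 n).map (Equiv.addRight u).toEmbedding := by
    ext v
    simp only [Finset.mem_map_equiv, Equiv.addRight_symm, Equiv.coe_addRight, mem_sbox,
      Prod.fst_add, Prod.snd_add, Prod.fst_neg, Prod.snd_neg, Prod.fst_zero, Prod.snd_zero]
    omega
  rw [hmap, bernE_map, armProb]
  refine bernE_congr _ fun S _ => ind_congr ⟨fun h => ?_, fun h => ?_⟩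
  · have := arm_shift (x := -u) (T' := (S : Set (ℤ × ℤ))) (fun v hv => by
      obtain ⟨w, hw, rfl⟩ := Finset.mem_map.1 (Finset.mem_coe.1 hv)
      simpa using hw) h
    simpa using this
  · have := arm_shift (x := u) (T' := ((S.map (Equiv.addRight u).toEmbedding :
      Finset (ℤ × ℤ)) : Set (ℤ × ℤ))) (fun v hv => by
        rw [Finset.mem_coe]
        exact Finset.mem_map.2 ⟨v, hv, rfl⟩) h
    simpa using this

theorem bernE_arm (q : ℝ) {E : Finset (ℤ × ℤ)} {u : ℤ × ℤ} {n : ℤ} (hE : sbox u n ⊆ E) :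
    bernE (fun _ => q) E (fun S : Finset (ℤ × ℤ) => ind (Arm (S : Set (ℤ × ℤ)) u n)) =
      armProb q n := by
  rw [← bernE_sbox_arm q u n, ← bernE_inter _ hE]
  exact bernE_congr _ fun S _ => ind_congr arm_inter_iff.symm

section Sites

variable {q : ℝ} (q0 : 0 ≤ q) (q1 : q ≤ 1)

include q0 q1

theorem bernE_arm_le (E : Finset (ℤ × ℤ)) (u : ℤ × ℤ) (n : ℤ) :
    bernE (fun _ => q) E (fun S : Finset (ℤ × ℤ) => ind (Arm (S : Set (ℤ × ℤ)) u n)) ≤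
      armProb q n := by
  rw [← bernE_arm q (Finset.subset_union_right : sbox u n ⊆ E ∪ sbox u n)]
  exact bernE_mono_set (fun _ => q0) (fun _ => q1) Finset.subset_union_left _
    fun S T h => ind_mono (Arm.mono (by exact_mod_cast h))

omit q0 q1 in
/-- Arms in disjoint boxes are independent. -/
theorem bernE_forall_not_arm {m : ℤ} (hm : 0 ≤ m) (k : ℕ) {E : Finset (ℤ × ℤ)}
    (hE : ∀ i < k, sbox ((2 * m + 1) * i, 0) m ⊆ E) :
    bernE (fun _ => q) E (fun S : Finset (ℤ × ℤ) =>
      ind (∀ i < k, ¬ Arm (S : Set (ℤ × ℤ)) ((2 * m + 1) * i, 0) m)) = (1 - armProb q m) ^ k := by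
  induction k with
  | zero => simp [ind_of, bernE_const]
  | succ k ih =>
    set U : Finset (ℤ × ℤ) := (Finset.range k).biUnion fun i => sbox ((2 * m + 1) * i, 0) m with hU
    have hUE : U ⊆ E := Finset.biUnion_subset.2 fun i hi =>
      hE i ((Finset.mem_range.1 hi).trans (Nat.lt_succ_self k))
    have hd : Disjoint U (sbox ((2 * m + 1) * k, 0) m) := by
      rw [Finset.disjoint_biUnion_left]
      intro i hi
      rw [Finset.disjoint_left]
      intro v hv hv'
      rw [mem_sbox] at hv hv'
      have hik : (i : ℤ) + 1 ≤ k := by exact_mod_cast Finset.mem_range.1 hi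
      have := mul_le_mul_of_nonneg_left hik (by omega : 0 ≤ 2 * m + 1)
      simp only at hv hv'
      rw [mul_add, mul_one] at this
      omega
    have h1 := ih fun i hi => hE i (hi.trans (Nat.lt_succ_self k))
    have hloc : ∀ S : Finset (ℤ × ℤ), (∀ i < k, ¬ Arm ((S ∩ U : Finset (ℤ × ℤ)) : Set (ℤ × ℤ))
        ((2 * m + 1) * i, 0) m) ↔ ∀ i < k, ¬ Arm (S : Set (ℤ × ℤ)) ((2 * m + 1) * i, 0) m := by
      intro S
      refine forall₂_congr fun i hi => not_congr
        ⟨Arm.mono (by exact_mod_cast Finset.inter_subset_left), fun h => ?_⟩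
      refine (arm_inter_sbox h).mono fun v hv => ?_
      have : v ∈ U := Finset.mem_biUnion.2 ⟨i, Finset.mem_range.2 hi, hv.2⟩
      exact Finset.mem_coe.2 (Finset.mem_inter.2 ⟨hv.1, this⟩)
    have h2 := bernE_mul_of_disjoint (fun _ => q) hUE (hE k (Nat.lt_succ_self k)) hd
      (fun S : Finset (ℤ × ℤ) => ind (∀ i < k, ¬ Arm (S : Set (ℤ × ℤ)) ((2 * m + 1) * i, 0) m))
      (fun S : Finset (ℤ × ℤ) => ind (¬ Arm (S : Set (ℤ × ℤ)) ((2 * m + 1) * k, 0) m))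
    have h3 : bernE (fun _ => q) U (fun S : Finset (ℤ × ℤ) =>
        ind (∀ i < k, ¬ Arm (S : Set (ℤ × ℤ)) ((2 * m + 1) * i, 0) m)) =
        (1 - armProb q m) ^ k := by
      rw [← h1, ← bernE_inter (fun _ => q) hUE]
      exact bernE_congr _ fun S _ => ind_congr (hloc S)
    have h4 : bernE (fun _ => q) (sbox ((2 * m + 1) * k, 0) m) (fun S : Finset (ℤ × ℤ) =>
        ind (¬ Arm (S : Set (ℤ × ℤ)) ((2 * m + 1) * k, 0) m)) = 1 - armProb q m := by
      simp only [ind_not]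
      rw [bernE_sub, bernE_const, bernE_sbox_arm]
    rw [pow_succ, ← h3, ← h4, ← h2]
    refine bernE_congr _ fun S _ => ?_
    rw [← ind_and, hloc, arm_inter_iff]
    exact ind_congr Nat.forall_lt_succ_right

/-- If site percolation percolates, then the origin can be replaced by a large box in order to bring
the probability of an arm close to one: many distant sites have independent arms of moderate
length, and an arm of moderate length is unlikely to stop later. -/
theorem exists_arm_box {c : ℝ} (hc : 0 < c) (h : ∀ n : ℕ, c ≤ armProb q n) {δ : ℝ} (hδ : 0 < δ) :
    ∃ K : ℕ, ∀ (n : ℕ) (E : Finset (ℤ × ℤ)), sbox 0 (K + n) ⊆ E →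
      1 - δ ≤ bernE (fun _ => q) E (fun S : Finset (ℤ × ℤ) =>
        ind (∃ u ∈ sbox 0 K, Arm (S : Set (ℤ × ℤ)) u n)) := by
  have hc1 : c ≤ 1 := (h 0).trans (bernE_le_const (fun _ => q0) (fun _ => q1)
    fun S _ => ind_le_one _)
  obtain ⟨M, hM⟩ := exists_pow_lt_of_lt_one (half_pos hδ) (by linarith : 1 - c < 1)
  -- the probabilities of arms of length `m` and of all longer ones differ by at most `η`
  set η : ℝ := δ / (2 * (M + 1)) with hη
  have hη0 : 0 < η := by positivity
  obtain ⟨m, hm⟩ : ∃ m : ℕ, ∀ n : ℕ, armProb q m - armProb q n ≤ η := by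
    have hbdd : BddBelow (Set.range fun n : ℕ => armProb q n) :=
      ⟨c, by rintro _ ⟨n, rfl⟩; exact h n⟩
    obtain ⟨_, ⟨m, rfl⟩, hm⟩ := Real.lt_sInf_add_pos (s := Set.range fun n : ℕ => armProb q n)
      ⟨_, 0, rfl⟩ hη0
    refine ⟨m, fun n => ?_⟩
    have := csInf_le hbdd ⟨n, rfl⟩
    simp only at hm this
    linarith
  set K : ℕ := (2 * m + 1) * (M + 1) + m with hK
  refine ⟨K, fun n E hE => ?_⟩
  set u : ℕ → ℤ × ℤ := fun i => ((2 * (m : ℤ) + 1) * i, 0) with hu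
  have hb : ∀ i < M, 0 ≤ (2 * (m : ℤ) + 1) * i ∧ (2 * (m : ℤ) + 1) * i + m ≤ K := by
    intro i hi
    have h1 : (i : ℤ) ≤ M + 1 := by omega
    have h2 := mul_le_mul_of_nonneg_left h1 (by omega : 0 ≤ 2 * (m : ℤ) + 1)
    refine ⟨by positivity, ?_⟩
    rw [hK]; push_cast
    linarith
  have huK : ∀ i < M, u i ∈ sbox 0 K := fun i hi => by
    have := hb i hi
    rw [mem_sbox, hu]; simp only [Prod.fst_zero, Prod.snd_zero]
    omega
  have hbE : ∀ i < M, ∀ l : ℕ, l ≤ m ∨ l ≤ n → sbox (u i) l ⊆ E := fun i hi l hl v hv => by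
    have := hb i hi
    refine hE ?_
    rw [hu, mem_sbox] at hv
    rw [mem_sbox]
    simp only [Prod.fst_zero, Prod.snd_zero] at hv ⊢
    omega
  have e1 := bernE_forall_not_arm (q := q) (m := m) (by omega) M
    (fun i hi => hbE i hi m (Or.inl le_rfl))
  have e2 : (1 - armProb q m) ^ M ≤ (1 - c) ^ M := by
    refine pow_le_pow_left₀ ?_ (by linarith [h m]) M
    have : armProb q m ≤ 1 := bernE_le_const (fun _ => q0) (fun _ => q1) fun S _ => ind_le_one _
    linarith
  -- arms of length `max m n` suffice, and they lie in `E`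
  set N : ℕ := max m n with hN
  have hmN : m ≤ N := le_max_left _ _
  have hNle : N ≤ m ∨ N ≤ n := by omega
  have e3 : bernE (fun _ => q) E (fun S : Finset (ℤ × ℤ) =>
      ∑ i ∈ Finset.range M, (ind (Arm (S : Set (ℤ × ℤ)) (u i) m) -
        ind (Arm (S : Set (ℤ × ℤ)) (u i) N))) ≤ M * η := by
    rw [bernE_sum]
    refine (Finset.sum_le_card_nsmul _ _ η fun i hi => ?_).trans (by simp)
    have hi := Finset.mem_range.1 hi
    rw [bernE_sub, bernE_arm q (hbE i hi m (Or.inl le_rfl)), bernE_arm q (hbE i hi N hNle)]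
    exact hm N
  have e4 : (1 : ℝ) ≤ bernE (fun _ => q) E (fun S : Finset (ℤ × ℤ) =>
      (ind (∀ i < M, ¬ Arm (S : Set (ℤ × ℤ)) ((2 * m + 1) * i, 0) m) +
        ∑ i ∈ Finset.range M, (ind (Arm (S : Set (ℤ × ℤ)) (u i) m) -
        ind (Arm (S : Set (ℤ × ℤ)) (u i) N))) +
        ind (∃ u ∈ sbox 0 K, Arm (S : Set (ℤ × ℤ)) u n)) := by
    rw [← bernE_const (fun _ => q) E 1]
    refine bernE_mono (fun _ => q0) (fun _ => q1) fun S _ => ?_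
    have hterm : ∀ i ∈ Finset.range M, 0 ≤ ind (Arm (S : Set (ℤ × ℤ)) (u i) m) -
        ind (Arm (S : Set (ℤ × ℤ)) (u i) N) := fun i _ =>
      sub_nonneg.2 (ind_mono (Arm.anti (by exact_mod_cast hmN)))
    have hsum := Finset.sum_nonneg hterm
    by_cases h1 : ∀ i < M, ¬ Arm (S : Set (ℤ × ℤ)) ((2 * m + 1) * i, 0) m
    · rw [ind_of h1]
      linarith [ind_nonneg (∃ u ∈ sbox 0 (K : ℤ), Arm (S : Set (ℤ × ℤ)) u n)]
    · push Not at h1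
      obtain ⟨i, hi, h1⟩ := h1
      have h0 := ind_nonneg (∀ i < M, ¬ Arm (S : Set (ℤ × ℤ)) ((2 * m + 1) * i, 0) m)
      by_cases h2 : Arm (S : Set (ℤ × ℤ)) (u i) N
      · rw [ind_of (P := ∃ u ∈ sbox 0 (K : ℤ), Arm (S : Set (ℤ × ℤ)) u n)
          ⟨u i, huK i hi, h2.anti (by exact_mod_cast le_max_right m n)⟩]
        linarith
      · have h3 := Finset.single_le_sum hterm (Finset.mem_range.2 hi)
        rw [ind_of h1, ind_of_not h2] at h3
        linarith [ind_nonneg (∃ u ∈ sbox 0 (K : ℤ), Arm (S : Set (ℤ × ℤ)) u n)]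
  rw [bernE_add, bernE_add, e1] at e4
  have e5 : (M : ℝ) * η ≤ δ / 2 := by
    rw [hη, mul_div_assoc', div_le_div_iff₀ (by positivity) (by norm_num)]
    nlinarith
  linarith

end Sites

/-! ### Bonds as sites -/

/-- The site that represents an edge. Edges with a common endpoint, and opposite edges of a face,
become neighbours, possibly diagonally. -/
def edgeSite (e : Z2Edge) : ℤ × ℤ :=
  (e.1 + e.2.1, if e.2.2 then e.2.1 - e.1 - 1 else e.2.1 - e.1)

theorem edgeSite_injective : Function.Injective edgeSite := by
  rintro ⟨a, b, _ | _⟩ ⟨a', b', _ | _⟩ h <;> simp only [edgeSite, Prod.mk.injEq] at h <;>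
    simp at h ⊢ <;> omega

/-- The sites of the edges at `v` form a square with two sites on each side. -/
theorem edgeSite_near {e : Z2Edge} {v : ℤ × ℤ} (h : v = (ends2 e).1 ∨ v = (ends2 e).2) :
    (v.1 + v.2 - 1 ≤ (edgeSite e).1 ∧ (edgeSite e).1 ≤ v.1 + v.2) ∧
    (v.2 - v.1 - 1 ≤ (edgeSite e).2 ∧ (edgeSite e).2 ≤ v.2 - v.1) := by
  obtain ⟨a, b, _ | _⟩ := e <;> simp only [ends2_true, ends2_false] at h <;>
    rcases h with rfl | rfl <;> simp [edgeSite] <;> omega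

/-- An edge of the enhancement joins endpoints of two open edges whose sites are equal or
neighbours. -/
theorem exists_star_of_mem_enh {S : Set Z2Edge} {e : Z2Edge} (he : e ∈ enh S) :
    ∃ f ∈ S, ∃ g ∈ S, ((ends2 e).1 = (ends2 f).1) ∧
      ((ends2 e).2 = (ends2 g).1 ∨ (ends2 e).2 = (ends2 g).2) ∧
      |(edgeSite g).1 - (edgeSite f).1| ≤ 1 ∧ |(edgeSite g).2 - (edgeSite f).2| ≤ 1 := by
  obtain ⟨a, b, k⟩ := e
  rcases he with h | ⟨h0, h1, h2⟩ | ⟨h0, h1, h2⟩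
  · exact ⟨_, h, _, h, rfl, Or.inr rfl, by simp, by simp⟩
  · simp only at h0; subst h0
    refine ⟨_, h1, _, h2, by simp, by simp, ?_, ?_⟩ <;> simp [edgeSite]
  · simp only at h0; subst h0
    refine ⟨_, h1, _, h2, by simp, by simp, ?_, ?_⟩ <;> simp [edgeSite]

theorem starConn_of_conn_enh {S : Set Z2Edge} {v : ℤ × ℤ} (h : Conn ends2 (enh S) 0 v) :
    v = 0 ∨ ∃ f ∈ S, ∃ g ∈ S, (0 = (ends2 f).1 ∨ 0 = (ends2 f).2) ∧
      (v = (ends2 g).1 ∨ v = (ends2 g).2) ∧ StarConn (edgeSite '' S) (edgeSite f) (edgeSite g) := by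
  induction h with
  | refl => exact Or.inl rfl
  | tail h1 h2 ih =>
    rename_i u v
    have hstep : ∃ f ∈ S, ∃ g ∈ S, (u = (ends2 f).1 ∨ u = (ends2 f).2) ∧
        (v = (ends2 g).1 ∨ v = (ends2 g).2) ∧
        StarStep (edgeSite '' S) (edgeSite f) (edgeSite g) := by
      obtain ⟨e, he, hends⟩ := h2
      obtain ⟨f, hf, g, hg, h3, h4, h5, h6⟩ := exists_star_of_mem_enh he
      rcases hends with h | h <;> rw [h] at h3 h4
      · exact ⟨f, hf, g, hg, Or.inl h3, h4, ⟨f, hf, rfl⟩, ⟨g, hg, rfl⟩, h5, h6⟩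
      · rw [abs_sub_comm] at h5 h6
        exact ⟨g, hg, f, hf, h4, Or.inl h3, ⟨g, hg, rfl⟩, ⟨f, hf, rfl⟩, h5, h6⟩
    obtain ⟨f, hf, g, hg, hu, hv, hfg⟩ := hstep
    right
    rcases ih with rfl | ⟨f', hf', g', hg', h0, hu', hc⟩
    · exact ⟨f, hf, g, hg, hu, hv, Relation.ReflTransGen.single hfg⟩
    · refine ⟨f', hf', g, hg, h0, hv, (hc.tail ⟨⟨g', hg', rfl⟩, ⟨f, hf, rfl⟩, ?_⟩).tail hfg⟩
      have n1 := edgeSite_near hu'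
      have n2 := edgeSite_near hu
      constructor <;> rw [abs_le] <;> omega

/-- Site percolation on the square lattice with diagonals percolates at some parameter smaller than
one half. -/
theorem exists_pos_le_armProb : ∃ c, 0 < c ∧ ∀ n : ℕ, c ≤ armProb (1 / 2 - enhGain) n := by
  have e0 : (0 : ℝ) ≤ 1 / 2 - enhGain := by unfold enhGain; norm_num
  have e1 : 1 / 2 - enhGain ≤ 1 := by unfold enhGain; norm_num
  obtain ⟨c, hc, H⟩ := exists_pos_le_bernE_enh
  refine ⟨c / 4, by positivity, fun n => ?_⟩
  obtain ⟨E, hE⟩ := H (n + 3)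
  -- the sites of the edges at the origin
  set Q : Finset (ℤ × ℤ) := {(0, 0), (-1, 0), (0, -1), (-1, -1)} with hQ
  have h1 : bernE (fun _ => 1 / 2 - enhGain) E
      (fun S => ind (∃ b ∈ far 0 (n + 3 : ℕ), Conn ends2 (enh (S : Set Z2Edge)) 0 b)) ≤
      bernE (fun _ => 1 / 2 - enhGain) (E.map ⟨edgeSite, edgeSite_injective⟩)
        (fun S : Finset (ℤ × ℤ) => ∑ u ∈ Q, ind (Arm (S : Set (ℤ × ℤ)) u n)) := by
    rw [bernE_map]
    refine bernE_mono (fun _ => e0) (fun _ => e1) fun S _ =>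
      (ind_mono ?_).trans (ind_exists_le Q _)
    rintro ⟨b, hb, h⟩
    simp only [mem_far, le_abs, Prod.fst_zero, Prod.snd_zero] at hb
    push_cast at hb
    rcases starConn_of_conn_enh h with rfl | ⟨f, hf, g, hg, h0, hv, hc⟩
    · simp at hb; omega
    · have n1 := edgeSite_near h0
      have n2 := edgeSite_near hv
      simp only [Prod.fst_zero, Prod.snd_zero] at n1
      refine ⟨edgeSite f, ?_, edgeSite g, ?_, ?_⟩
      · simp only [hQ, Finset.mem_insert, Finset.mem_singleton, Prod.ext_iff]
        omega
      · simp only [mem_far, le_abs]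
        omega
      · rw [Finset.coe_map]
        exact hc
  rw [bernE_sum] at h1
  have h2 : ∑ u ∈ Q, bernE (fun _ => 1 / 2 - enhGain) (E.map ⟨edgeSite, edgeSite_injective⟩)
      (fun S : Finset (ℤ × ℤ) => ind (Arm (S : Set (ℤ × ℤ)) u n)) ≤
      Q.card • armProb (1 / 2 - enhGain) n :=
    Finset.sum_le_card_nsmul _ _ _ fun u _ => bernE_arm_le e0 e1 _ _ _
  have h3 : Q.card = 4 := by decide
  rw [h3, nsmul_eq_mul] at h2
  push_cast at h2
  linarith

/-! ### Correlation inequalities for weighted even subgraphs -/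

section Griffiths

variable {α M : Type*} [AddCommGroup M] (bd : α → M)

/-- The weight of all subsets of `F` with boundary `A`; the set `η` has the weight `x ^ |η|`. The
boundary of a set is the sum of the boundaries `bd e` of its elements. -/
noncomputable def bdZ (x : ℝ) (F : Finset α) (A : M) : ℝ :=
  ∑ η ∈ F.powerset, x ^ η.card * ind (∑ e ∈ η, bd e = A)

theorem bdZ_insert [DecidableEq α] (x : ℝ) {F : Finset α} {e : α} (he : e ∉ F) (A : M) :
    bdZ bd x (insert e F) A = bdZ bd x F A + x * bdZ bd x F (A - bd e) := by
  rw [bdZ, Finset.sum_powerset_insert he, bdZ, bdZ, Finset.mul_sum]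
  congr 1
  refine Finset.sum_congr rfl fun η hη => ?_
  have heη : e ∉ η := fun h => he (Finset.mem_powerset.1 hη h)
  rw [Finset.card_insert_of_notMem heη, Finset.sum_insert heη, pow_succ,
    ind_congr (P := bd e + ∑ e ∈ η, bd e = A) (Q := ∑ e ∈ η, bd e = A - bd e)
      (by rw [eq_sub_iff_add_eq, add_comm])]
  ring

/-- The weight of the pairs of subsets of `F` with total boundary `d`, such that the boundary of the
first one is in the coset `H + a`. -/
noncomputable def pairZ (x : ℝ) (F : Finset α) (H : AddSubgroup M) (a d : M) : ℝ :=
  ∑ η ∈ F.powerset, ∑ ζ ∈ F.powerset, x ^ η.card * x ^ ζ.card *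
    ind (∑ e ∈ η, bd e - a ∈ H ∧ ∑ e ∈ η, bd e + ∑ e ∈ ζ, bd e = d)

theorem pairZ_insert [DecidableEq α] (x : ℝ) {F : Finset α} {e : α} (he : e ∉ F)
    (H : AddSubgroup M) (a d : M) :
    pairZ bd x (insert e F) H a d =
      pairZ bd x F H a d + x * pairZ bd x F H a (d - bd e) +
        (x * pairZ bd x F H (a - bd e) (d - bd e) +
          x * x * pairZ bd x F H (a - bd e) (d - bd e - bd e)) := by
  have hnot : ∀ η ∈ F.powerset, e ∉ η := fun η hη h => he (Finset.mem_powerset.1 hη h)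
  have i1 : ∀ b s t d : M, s + (b + t) = d ↔ s + t = d - b := fun b s t d => by
    rw [eq_sub_iff_add_eq, ← add_assoc, add_right_comm]
  have i2 : ∀ b s t d : M, b + s + t = d ↔ s + t = d - b := fun b s t d => by
    rw [eq_sub_iff_add_eq, add_assoc, add_comm b]
  simp only [pairZ, Finset.mul_sum]
  rw [Finset.sum_powerset_insert he]
  congr 1
  · rw [← Finset.sum_add_distrib]
    refine Finset.sum_congr rfl fun η hη => ?_
    rw [Finset.sum_powerset_insert he]
    congr 1
    refine Finset.sum_congr rfl fun ζ hζ => ?_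
    rw [Finset.card_insert_of_notMem (hnot ζ hζ), Finset.sum_insert (hnot ζ hζ), pow_succ,
      ind_congr (and_congr_right' (i1 _ _ _ _))]
    ring
  · rw [← Finset.sum_add_distrib]
    refine Finset.sum_congr rfl fun η hη => ?_
    have h1 : bd e + ∑ e ∈ η, bd e - a = ∑ e ∈ η, bd e - (a - bd e) := by abel
    rw [Finset.sum_powerset_insert he, Finset.card_insert_of_notMem (hnot η hη),
      Finset.sum_insert (hnot η hη), h1]
    congr 1
    · refine Finset.sum_congr rfl fun ζ hζ => ?_
      rw [pow_succ, ind_congr (and_congr_right' (i2 _ _ _ _))]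
      ring
    · refine Finset.sum_congr rfl fun ζ hζ => ?_
      rw [Finset.card_insert_of_notMem (hnot ζ hζ), Finset.sum_insert (hnot ζ hζ), pow_succ,
        pow_succ,
        ind_congr (and_congr_right' ((i1 _ _ _ _).trans (i2 _ _ _ _)))]
      ring

theorem pairZ_congr {x : ℝ} {F : Finset α} {H : AddSubgroup M} {a a' d : M} (h : a - a' ∈ H) :
    pairZ bd x F H a d = pairZ bd x F H a' d := by
  refine Finset.sum_congr rfl fun η _ => Finset.sum_congr rfl fun ζ _ => ?_
  congr 1
  refine ind_congr (and_congr_left' ?_)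
  constructor <;> intro h'
  · simpa using H.add_mem h' h
  · simpa using H.sub_mem h' h

/-- Adjoining an element `b` of order two to the subgroup unites the cosets `H + a` and
`H + a - b`. -/
theorem pairZ_add (x : ℝ) (F : Finset α) {H : AddSubgroup M} (a d : M) {b : M} (hb : b + b = 0)
    (hbH : b ∉ H) :
    pairZ bd x F H a d + pairZ bd x F H (a - b) d =
      pairZ bd x F (H ⊔ AddSubgroup.zmultiples b) a d := by
  have hmem : ∀ m, m ∈ H ⊔ AddSubgroup.zmultiples b ↔ m ∈ H ∨ m + b ∈ H := by
    intro m
    rw [AddSubgroup.mem_sup]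
    constructor
    · rintro ⟨h, hh, z, hz, rfl⟩
      obtain ⟨k, rfl⟩ := AddSubgroup.mem_zmultiples_iff.1 hz
      have hk : ∀ k : ℤ, (2 * k) • b = 0 := fun k => by
        rw [mul_comm, mul_zsmul, two_zsmul, hb, smul_zero]
      rcases Int.even_or_odd' k with ⟨l, rfl | rfl⟩
      · left; rw [hk]; simpa using hh
      · right
        rw [add_zsmul, hk, one_zsmul, zero_add, add_assoc, hb]
        simpa using hh
    · rintro (h | h)
      · exact ⟨m, h, 0, AddSubgroup.zero_mem _, by simp⟩
      · exact ⟨m + b, h, b, AddSubgroup.mem_zmultiples b, by rw [add_assoc, hb, add_zero]⟩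
  simp only [pairZ]
  rw [← Finset.sum_add_distrib]
  refine Finset.sum_congr rfl fun η _ => ?_
  rw [← Finset.sum_add_distrib]
  refine Finset.sum_congr rfl fun ζ _ => ?_
  rw [← mul_add]
  congr 1
  simp only [ind_and, ← add_mul]
  congr 1
  set m := ∑ e ∈ η, bd e - a
  have e1 : ∑ e ∈ η, bd e - (a - b) = m + b := by simp only [m]; abel
  rw [e1]
  by_cases h1 : m ∈ H
  · have h2 : m + b ∉ H := fun h => hbH (by simpa using H.sub_mem h h1)
    rw [ind_of h1, ind_of_not h2, ind_of ((hmem m).2 (Or.inl h1)), add_zero]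
  · rw [ind_of_not h1, zero_add]
    exact ind_congr ⟨fun h => (hmem m).2 (Or.inr h), fun h => ((hmem m).1 h).resolve_left h1⟩

variable {bd} (hbd : ∀ e, bd e + bd e = 0)

include hbd

theorem pairZ_add_le {x : ℝ} {F : Finset α}
    (ih : ∀ (H : AddSubgroup M) (a d : M), pairZ bd x F H a d ≤ pairZ bd x F H 0 d)
    (H : AddSubgroup M) (a d : M) (e : α) :
    pairZ bd x F H a d + pairZ bd x F H (a - bd e) d ≤
      pairZ bd x F H 0 d + pairZ bd x F H (0 - bd e) d := by
  by_cases he : bd e ∈ H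
  · rw [pairZ_congr bd (a := a - bd e) (a' := a) (by simpa using he),
      pairZ_congr bd (a := 0 - bd e) (a' := 0) (by simpa using he)]
    linarith [ih H a d]
  · rw [pairZ_add bd x F a d (hbd e) he, pairZ_add bd x F 0 d (hbd e) he]
    exact ih _ a d

/-- The coset of zero has the largest weight. In the induction step, the terms where exactly one of
the two sets contains the new edge are combined with each other, as are those where both or none
do; this replaces `H` by a larger subgroup. -/
theorem pairZ_le [DecidableEq α] {x : ℝ} (hx : 0 ≤ x) (hx1 : x ≤ 1) (F : Finset α)
    (H : AddSubgroup M) (a d : M) :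
    pairZ bd x F H a d ≤ pairZ bd x F H 0 d := by
  induction F using Finset.induction_on generalizing H a d with
  | empty =>
    simp only [pairZ, Finset.powerset_empty, Finset.sum_singleton, Finset.card_empty, pow_zero,
      one_mul, Finset.sum_empty]
    exact ind_mono fun h => ⟨by simp, h.2⟩
  | insert e F he ih =>
    rw [pairZ_insert bd x he, pairZ_insert bd x he]
    have hd : d - bd e - bd e = d := by rw [sub_sub, hbd, sub_zero]
    rw [hd]
    have h1 := pairZ_add_le hbd ih H a (d - bd e) e
    have h2 := pairZ_add_le hbd ih H a d e
    have h3 := mul_le_mul_of_nonneg_left h1 hx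
    have h4 := mul_le_mul_of_nonneg_left h2 (mul_nonneg hx hx)
    have h5 := mul_le_mul_of_nonneg_left (ih H a d) (by nlinarith : 0 ≤ 1 - x * x)
    linarith

/-- Griffiths' second inequality for the high-temperature expansion of the Ising model, that is
`⟨σ_A⟩ ⟨σ_B⟩ ≤ ⟨σ_A σ_B⟩`. -/
theorem bdZ_mul_le [DecidableEq α] {x : ℝ} (hx : 0 ≤ x) (hx1 : x ≤ 1) (F : Finset α) (A B : M) :
    bdZ bd x F A * bdZ bd x F B ≤ bdZ bd x F 0 * bdZ bd x F (A + B) := by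
  have key : ∀ A d : M, pairZ bd x F ⊥ A d = bdZ bd x F A * bdZ bd x F (d - A) := by
    intro A d
    rw [bdZ, bdZ, Finset.sum_mul_sum]
    refine Finset.sum_congr rfl fun η _ => Finset.sum_congr rfl fun ζ _ => ?_
    rw [mul_mul_mul_comm, ← ind_and]
    congr 1
    refine ind_congr ?_
    rw [AddSubgroup.mem_bot, sub_eq_zero]
    refine and_congr_right fun h => ?_
    rw [h, eq_sub_iff_add_eq, add_comm]
  -- for the trivial subgroup the weight of pairs factorizes
  have := pairZ_le hbd hx hx1 F ⊥ A (A + B)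
  rwa [key, key, add_sub_cancel_left, sub_zero] at this

omit hbd in
theorem bdZ_nonneg {x : ℝ} (hx : 0 ≤ x) (F : Finset α) (A : M) : 0 ≤ bdZ bd x F A :=
  Finset.sum_nonneg fun _ _ => mul_nonneg (by positivity) (ind_nonneg _)

omit hbd in
theorem one_le_bdZ_zero {x : ℝ} (hx : 0 ≤ x) (F : Finset α) : 1 ≤ bdZ bd x F 0 := by
  have h := Finset.single_le_sum (f := fun η : Finset α => x ^ η.card * ind (∑ e ∈ η, bd e = 0))
    (fun _ _ => mul_nonneg (by positivity) (ind_nonneg _)) (Finset.empty_mem_powerset F)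
  simpa [ind_of, bdZ] using h

/-- The correlations are at most one. -/
theorem bdZ_le_zero [DecidableEq α] {x : ℝ} (hx : 0 ≤ x) (hx1 : x ≤ 1) (F : Finset α) (A : M) :
    bdZ bd x F A ≤ bdZ bd x F 0 := by
  have h1 := bdZ_mul_le hbd hx hx1 F A (-A)
  rw [add_neg_cancel] at h1
  have hneg : bdZ bd x F (-A) = bdZ bd x F A := by
    refine Finset.sum_congr rfl fun η _ => ?_
    congr 1
    refine ind_congr ?_
    have h2 : ∑ e ∈ η, bd e + ∑ e ∈ η, bd e = 0 := by
      rw [← Finset.sum_add_distrib]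
      exact Finset.sum_eq_zero fun e _ => hbd e
    rw [← neg_eq_iff_eq_neg, ← eq_neg_of_add_eq_zero_left h2]
  rw [hneg] at h1
  nlinarith [bdZ_nonneg (bd := bd) hx F A, bdZ_nonneg (bd := bd) hx F (0 : M)]

/-- The correlations increase with the graph. -/
theorem bdZ_ratio_mono [DecidableEq α] {x : ℝ} (hx : 0 ≤ x) (hx1 : x ≤ 1) (A : M) :
    Monotone fun F : Finset α => bdZ bd x F A / bdZ bd x F 0 := by
  intro F F' hFF
  obtain ⟨D, rfl⟩ : ∃ D, F' = D ∪ F := ⟨F', (Finset.union_eq_left.2 hFF).symm⟩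
  clear hFF
  induction D using Finset.induction_on with
  | empty => simp
  | insert e D _ ih =>
    refine ih.trans ?_
    rw [Finset.insert_union]
    by_cases he : e ∈ D ∪ F
    · rw [Finset.insert_eq_of_mem he]
    · have p1 := one_le_bdZ_zero (bd := bd) hx (D ∪ F)
      have p2 := one_le_bdZ_zero (bd := bd) hx (insert e (D ∪ F))
      have hz : (0 : M) - bd e = bd e := by
        rw [zero_sub]; exact (eq_neg_of_add_eq_zero_left (hbd e)).symm
      simp only
      rw [div_le_div_iff₀ (by linarith) (by linarith), bdZ_insert bd x he, bdZ_insert bd x he, hz]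
      have h := bdZ_mul_le hbd hx hx1 (D ∪ F) A (bd e)
      have hA : A + bd e = A - bd e := by
        rw [sub_eq_add_neg, ← eq_neg_of_add_eq_zero_left (hbd e)]
      rw [hA] at h
      have := mul_le_mul_of_nonneg_left h hx
      linarith

end Griffiths

/-! ### Expectations of local functions of random even subgraphs, and their limits -/

section Local

variable {α M : Type*} [AddCommGroup M] (bd : α → M)

/-- The unnormalized expectation of `f` over the subsets of `F` without boundary. -/
noncomputable def evW (x : ℝ) (F : Finset α) (f : Finset α → ℝ) : ℝ :=
  ∑ η ∈ F.powerset, x ^ η.card * ind (∑ e ∈ η, bd e = 0) * f η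

/-- The expectation of `f` over the random subset of `F` without boundary. -/
noncomputable def evE (x : ℝ) (F : Finset α) (f : Finset α → ℝ) : ℝ :=
  evW bd x F f / bdZ bd x F 0

theorem evW_one (x : ℝ) (F : Finset α) : evW bd x F (fun _ => 1) = bdZ bd x F 0 := by
  simp [evW, bdZ]

theorem evW_mono {x : ℝ} (hx : 0 ≤ x) {F : Finset α} {f g : Finset α → ℝ}
    (h : ∀ η ⊆ F, ∑ e ∈ η, bd e = 0 → f η ≤ g η) : evW bd x F f ≤ evW bd x F g := by
  refine Finset.sum_le_sum fun η hη => ?_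
  by_cases h0 : ∑ e ∈ η, bd e = 0
  · exact mul_le_mul_of_nonneg_left (h η (Finset.mem_powerset.1 hη) h0)
      (mul_nonneg (by positivity) (ind_nonneg _))
  · rw [ind_of_not h0]; simp

theorem evW_add (x : ℝ) (F : Finset α) (f g : Finset α → ℝ) :
    evW bd x F (fun η => f η + g η) = evW bd x F f + evW bd x F g := by
  simp only [evW, mul_add, Finset.sum_add_distrib]

theorem evW_const_mul (x : ℝ) (F : Finset α) (c : ℝ) (f : Finset α → ℝ) :
    evW bd x F (fun η => c * f η) = c * evW bd x F f := by
  simp only [evW, Finset.mul_sum]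
  exact Finset.sum_congr rfl fun _ _ => by ring

theorem evW_sum {ι : Type*} (x : ℝ) (F : Finset α) (s : Finset ι) (f : ι → Finset α → ℝ) :
    evW bd x F (fun η => ∑ i ∈ s, f i η) = ∑ i ∈ s, evW bd x F (f i) := by
  simp only [evW, Finset.mul_sum]
  exact Finset.sum_comm

theorem evE_mono {x : ℝ} (hx : 0 ≤ x) {F : Finset α} {f g : Finset α → ℝ}
    (h : ∀ η ⊆ F, ∑ e ∈ η, bd e = 0 → f η ≤ g η) : evE bd x F f ≤ evE bd x F g :=
  div_le_div_of_nonneg_right (evW_mono bd hx h) (bdZ_nonneg hx F 0)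

theorem evE_const {x : ℝ} (hx : 0 ≤ x) (F : Finset α) (c : ℝ) : evE bd x F (fun _ => c) = c := by
  have := one_le_bdZ_zero (bd := bd) hx F
  have h := evW_const_mul bd x F c (fun _ => 1)
  rw [evW_one] at h
  simp only [mul_one] at h
  rw [evE, h, mul_div_assoc, div_self (by linarith), mul_one]

theorem evE_sum {ι : Type*} (x : ℝ) (F : Finset α) (s : Finset ι) (f : ι → Finset α → ℝ) :
    evE bd x F (fun η => ∑ i ∈ s, f i η) = ∑ i ∈ s, evE bd x F (f i) := by
  simp only [evE, evW_sum, Finset.sum_div]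

theorem evE_add (x : ℝ) (F : Finset α) (f g : Finset α → ℝ) :
    evE bd x F (fun η => f η + g η) = evE bd x F f + evE bd x F g := by
  simp only [evE, evW_add, add_div]

variable [DecidableEq α]

theorem sum_powerset_union {B D : Finset α} (hd : Disjoint B D) (g : Finset α → ℝ) :
    ∑ η ∈ (B ∪ D).powerset, g η = ∑ b ∈ B.powerset, ∑ ζ ∈ D.powerset, g (b ∪ ζ) := by
  induction B using Finset.induction_on generalizing g with
  | empty => simp
  | insert e B he ih =>
    rw [Finset.disjoint_insert_left] at hd
    have hne : e ∉ B ∪ D := by simp [he, hd.1]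
    rw [Finset.insert_union, Finset.sum_powerset_insert hne, Finset.sum_powerset_insert he,
      ih hd.2, ih hd.2]
    simp only [Finset.insert_union]

variable {bd} (hbd : ∀ e, bd e + bd e = 0)

include hbd in
/-- Summing over the configuration outside `B` turns a local weight into correlations. -/
theorem evW_local (x : ℝ) {F B : Finset α} (hB : B ⊆ F) {f : Finset α → ℝ}
    (hf : ∀ η, f η = f (η ∩ B)) :
    evW bd x F f = ∑ b ∈ B.powerset, f b * x ^ b.card * bdZ bd x (F \ B) (∑ e ∈ b, bd e) := by
  have hF : F = B ∪ F \ B := (Finset.union_sdiff_of_subset hB).symm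
  conv_lhs => rw [hF]
  rw [evW, sum_powerset_union Finset.disjoint_sdiff]
  refine Finset.sum_congr rfl fun b hb => ?_
  rw [bdZ, Finset.mul_sum]
  refine Finset.sum_congr rfl fun ζ hζ => ?_
  have hb := Finset.mem_powerset.1 hb
  have hζ := Finset.mem_powerset.1 hζ
  have hd : Disjoint b ζ := Finset.disjoint_of_subset_left hb
    (Finset.disjoint_of_subset_right hζ Finset.disjoint_sdiff)
  have hi : (b ∪ ζ) ∩ B = b := by
    ext e
    have h1 := @hb e
    have h2 := @hζ e
    simp only [Finset.mem_sdiff] at h2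
    simp only [Finset.mem_inter, Finset.mem_union]
    tauto
  rw [hf (b ∪ ζ), hi, Finset.card_union_of_disjoint hd, Finset.sum_union hd, pow_add,
    ind_congr (P := _ + _ = 0) (Q := ∑ e ∈ ζ, bd e = ∑ e ∈ b, bd e)]
  · ring
  · have : ∑ e ∈ b, bd e + ∑ e ∈ b, bd e = 0 := by
      rw [← Finset.sum_add_distrib]
      exact Finset.sum_eq_zero fun e _ => hbd e
    rw [add_comm, add_eq_zero_iff_eq_neg, ← eq_neg_of_add_eq_zero_left this]

include hbd in
/-- A local function has a limiting expectation, since the correlations increase with the graph. -/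
theorem exists_tendsto_evE {x : ℝ} (hx : 0 ≤ x) (hx1 : x ≤ 1) {B : Finset α} {f : Finset α → ℝ}
    (hf : ∀ η, f η = f (η ∩ B)) : ∃ L, Tendsto (fun F => evE bd x F f) atTop (𝓝 L) := by
  have hr : ∀ A : M, ∃ L, Tendsto (fun F : Finset α => bdZ bd x (F \ B) A / bdZ bd x (F \ B) 0)
      atTop (𝓝 L) := fun A => by
    refine ⟨_, tendsto_atTop_ciSup (fun F F' h =>
      bdZ_ratio_mono hbd hx hx1 A (Finset.sdiff_subset_sdiff h le_rfl)) ⟨1, ?_⟩⟩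
    rintro _ ⟨F, rfl⟩
    exact div_le_one_of_le₀ (bdZ_le_zero hbd hx hx1 _ A) (bdZ_nonneg hx _ 0)
  choose r hr using hr
  -- an expectation is a ratio of finite sums of correlations of the graph `F \ B`
  have key : ∀ F, B ⊆ F → evE bd x F f =
      (∑ b ∈ B.powerset, f b * x ^ b.card *
        (bdZ bd x (F \ B) (∑ e ∈ b, bd e) / bdZ bd x (F \ B) 0)) /
      (∑ b ∈ B.powerset, 1 * x ^ b.card *
        (bdZ bd x (F \ B) (∑ e ∈ b, bd e) / bdZ bd x (F \ B) 0)) := by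
    intro F hF
    have h1 := one_le_bdZ_zero (bd := bd) hx (F \ B)
    rw [evE, ← evW_one, evW_local hbd x hF hf,
      evW_local hbd x hF (f := fun _ => 1) (fun _ => rfl)]
    simp only [mul_div_assoc']
    rw [← Finset.sum_div, ← Finset.sum_div, div_div_div_cancel_right₀ (by linarith)]
  have hlim : ∀ g : Finset α → ℝ, Tendsto (fun F : Finset α => ∑ b ∈ B.powerset, g b * x ^ b.card *
        (bdZ bd x (F \ B) (∑ e ∈ b, bd e) / bdZ bd x (F \ B) 0)) atTop
      (𝓝 (∑ b ∈ B.powerset, g b * x ^ b.card * r (∑ e ∈ b, bd e))) := fun g =>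
    tendsto_finsetSum _ fun b _ => (hr _).const_mul _
  have hden : 1 ≤ ∑ b ∈ B.powerset, 1 * x ^ b.card * r (∑ e ∈ b, bd e) := by
    refine ge_of_tendsto' (hlim fun _ => 1) fun F => ?_
    have h1 := one_le_bdZ_zero (bd := bd) hx (F \ B)
    have := Finset.single_le_sum (f := fun b => 1 * x ^ b.card *
        (bdZ bd x (F \ B) (∑ e ∈ b, bd e) / bdZ bd x (F \ B) 0)) (fun b _ =>
          mul_nonneg (by positivity) (div_nonneg (bdZ_nonneg hx _ _) (bdZ_nonneg hx _ _)))
        (Finset.empty_mem_powerset B)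
    refine le_trans ?_ this
    simp [div_self (show bdZ bd x (F \ B) 0 ≠ 0 by linarith)]
  refine ⟨_, Tendsto.congr' ?_ ((hlim f).div (hlim fun _ => 1) (by linarith))⟩
  filter_upwards [eventually_ge_atTop B] with F hF
  exact (key F hF).symm

include hbd in
/-- A set of `k` edges is contained in the random subset with probability at most `x ^ k`. -/
theorem evE_subset_le {x : ℝ} (hx : 0 ≤ x) (hx1 : x ≤ 1) (F B : Finset α) :
    evE bd x F (fun η => ind (B ⊆ η)) ≤ x ^ B.card := by
  by_cases hB : B ⊆ F
  · have hmono : bdZ bd x (F \ B) 0 ≤ bdZ bd x F 0 :=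
      Finset.sum_le_sum_of_subset_of_nonneg (Finset.powerset_mono.2 Finset.sdiff_subset)
        fun _ _ _ => mul_nonneg (by positivity) (ind_nonneg _)
    have h1 := one_le_bdZ_zero (bd := bd) hx F
    rw [evE, div_le_iff₀ (by linarith), evW_local hbd x hB (f := fun η => ind (B ⊆ η))
      (fun η => ind_congr (by simp [Finset.subset_inter_iff])),
      Finset.sum_eq_single_of_mem B (Finset.mem_powerset_self B)]
    · rw [ind_of (Finset.Subset.refl B), one_mul]
      exact mul_le_mul_of_nonneg_left ((bdZ_le_zero hbd hx hx1 _ _).trans hmono) (by positivity)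
    · intro b hb hne
      rw [ind_of_not fun h => hne ((Finset.mem_powerset.1 hb).antisymm h)]
      simp
  · refine le_trans (le_of_eq ?_) (pow_nonneg hx B.card)
    rw [← evE_const bd hx F 0, evE, evE]
    congr 1
    refine Finset.sum_congr rfl fun η hη => ?_
    have : ind (B ⊆ η) = 0 := ind_of_not fun h => hB (h.trans (Finset.mem_powerset.1 hη))
    simp only [this]

end Local

/-! ### Existence and uniqueness of the infinite-volume measure -/

section Graph

variable {V : Type*} (G : SimpleGraph V)

open Classical in
/-- The boundary of an edge modulo 2: the indicator function of its endpoints. -/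
noncomputable def edgeBd (e : G.edgeSet) : V → ZMod 2 := fun v => if v ∈ e.1 then 1 else 0

theorem edgeBd_add_self (e : G.edgeSet) : edgeBd G e + edgeBd G e = 0 := by
  ext v
  exact CharTwo.add_self_eq_zero _

theorem isEvenEdgeSet_iff (η : Finset G.edgeSet) :
    IsEvenEdgeSet G η ↔ ∑ e ∈ η, edgeBd G e = 0 := by
  classical
  rw [funext_iff]
  refine forall_congr' fun v => ?_
  have h1 : {e : G.edgeSet | e ∈ η ∧ v ∈ e.1} = ((η.filter fun e => v ∈ e.1 : Finset G.edgeSet) :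
      Set G.edgeSet) := by ext e; simp
  have h2 : (∑ e ∈ η, edgeBd G e) v = ((η.filter fun e => v ∈ e.1).card : ZMod 2) := by
    rw [Finset.sum_apply]
    simp only [edgeBd, Finset.sum_boole]
  rw [h1, Set.ncard_coe_finset, h2, Pi.zero_apply, ZMod.natCast_eq_zero_iff_even]

theorem sum_evenSubgraphs (F : Finset G.edgeSet) (x : ℝ) (f : Finset G.edgeSet → ℝ) :
    ∑ η ∈ evenSubgraphs G F, x ^ η.card * f η = evW (edgeBd G) x F f := by
  classical
  rw [evenSubgraphs, Finset.sum_filter, evW]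
  refine Finset.sum_congr rfl fun η _ => ?_
  split_ifs with h
  · rw [ind_of ((isEvenEdgeSet_iff G η).1 h), mul_one]
  · rw [ind_of_not fun h' => h ((isEvenEdgeSet_iff G η).2 h'), mul_zero, zero_mul]

theorem loopO1Z_eq (F : Finset G.edgeSet) (x : ℝ) : loopO1Z G F x = bdZ (edgeBd G) x F 0 := by
  rw [← evW_one, ← sum_evenSubgraphs, loopO1Z]
  simp

theorem toConfig_eq_true {η : Finset G.edgeSet} {e : G.edgeSet} :
    toConfig G η e = true ↔ e ∈ η := by
  simp [toConfig]

variable [Countable V]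

instance countable_edgeSet : Countable G.edgeSet := by
  have : Countable (Sym2 V) := Quotient.countable
  infer_instance

theorem integral_loopO1Finite {x : ℝ} (hx : 0 ≤ x) (F : Finset G.edgeSet) (f : PercConfig G → ℝ) :
    ∫ ω, f ω ∂(loopO1Finite G F x) = evE (edgeBd G) x F (fun η => f (toConfig G η)) := by
  have hZ := one_le_bdZ_zero (bd := edgeBd G) hx F
  rw [loopO1Finite, integral_finsetSum_measure fun η _ =>
    (integrable_dirac (by simp)).smul_measure ENNReal.ofReal_ne_top]
  simp only [integral_smul_measure, integral_dirac, smul_eq_mul, loopO1Z_eq]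
  rw [evE, ← sum_evenSubgraphs, Finset.sum_div]
  refine Finset.sum_congr rfl fun η _ => ?_
  rw [ENNReal.toReal_ofReal (by positivity)]
  ring

omit [Countable V] in
theorem isProbabilityMeasure_loopO1Finite {x : ℝ} (hx : 0 ≤ x) (F : Finset G.edgeSet) :
    IsProbabilityMeasure (loopO1Finite G F x) := by
  have hZ := one_le_bdZ_zero (bd := edgeBd G) hx F
  constructor
  rw [loopO1Finite, Measure.finsetSum_apply]
  simp only [Measure.smul_apply, measure_univ, smul_eq_mul, mul_one, loopO1Z_eq]
  rw [← ENNReal.ofReal_sum_of_nonneg fun η _ => by positivity, ← Finset.sum_div]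
  have := sum_evenSubgraphs G F x (fun _ => 1)
  simp only [mul_one] at this
  rw [this, evW_one, div_self (by linarith), ENNReal.ofReal_one]

omit [Countable V] in
/-- A continuous function of the configuration depends, up to a small error, on finitely many
edges. -/
theorem exists_finset_approx {f : PercConfig G → ℝ} (hf : Continuous f) {ε : ℝ} (hε : 0 < ε) :
    ∃ B : Finset G.edgeSet, ∀ ω ω' : PercConfig G, (∀ e ∈ B, ω e = ω' e) →
      dist (f ω) (f ω') < ε := by
  have h := CompactSpace.uniformContinuous_of_continuous hf (Metric.dist_mem_uniformity hε)
  rw [Filter.mem_map, Pi.uniformity, Filter.mem_iInf] at h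
  obtain ⟨I, hI, W, hW, hI'⟩ := h
  refine ⟨hI.toFinset, fun ω ω' hω => ?_⟩
  have : (ω, ω') ∈ ⋂ i, W i := by
    refine Set.mem_iInter.2 fun i => ?_
    obtain ⟨U, hU, hUW⟩ := hW i
    refine hUW ?_
    change (ω i, ω' i) ∈ U
    rw [hω i (hI.mem_toFinset.2 i.2)]
    exact refl_mem_uniformity hU
  rw [← hI'] at this
  exact this

omit [Countable V] in
/-- Expectations of continuous functions converge along all exhaustions of the graph. -/
theorem exists_tendsto_integral {x : ℝ} (hx : 0 ≤ x) (hx1 : x ≤ 1) {f : PercConfig G → ℝ}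
    (hf : Continuous f) :
    ∃ L, Tendsto (fun F => evE (edgeBd G) x F (fun η => f (toConfig G η))) atTop (𝓝 L) := by
  classical
  refine cauchySeq_tendsto_of_complete (Metric.cauchySeq_iff'.2 fun ε hε => ?_)
  obtain ⟨B, hB⟩ := exists_finset_approx G hf (show 0 < ε / 4 by positivity)
  obtain ⟨L, hL⟩ := exists_tendsto_evE (edgeBd_add_self G) hx hx1 (B := B)
    (f := fun η => f (toConfig G (η ∩ B))) (fun η => by simp [Finset.inter_assoc])
  have hapx : ∀ F, |evE (edgeBd G) x F (fun η => f (toConfig G η)) -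
      evE (edgeBd G) x F (fun η => f (toConfig G (η ∩ B)))| ≤ ε / 4 := by
    intro F
    have hd : ∀ η : Finset G.edgeSet, |f (toConfig G η) - f (toConfig G (η ∩ B))| < ε / 4 := by
      intro η
      rw [← Real.dist_eq]
      refine hB _ _ fun e he => ?_
      simp [toConfig, he]
    have h1 := evE_mono (edgeBd G) hx (F := F) (f := fun η => f (toConfig G η))
      (g := fun η => f (toConfig G (η ∩ B)) + ε / 4)
      fun η _ _ => by have := (abs_lt.1 (hd η)).2; linarith
    have h2 := evE_mono (edgeBd G) hx (F := F) (f := fun η => f (toConfig G (η ∩ B)))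
      (g := fun η => f (toConfig G η) + ε / 4)
      fun η _ _ => by have := (abs_lt.1 (hd η)).1; linarith
    rw [evE_add, evE_const _ hx] at h1 h2
    rw [abs_le]
    constructor <;> linarith
  obtain ⟨N, hN⟩ := Metric.cauchySeq_iff'.1 hL.cauchySeq (ε / 4) (by positivity)
  refine ⟨N, fun F hF => ?_⟩
  have h1 := abs_le.1 (hapx F)
  have h2 := abs_le.1 (hapx N)
  have h3 := hN F hF
  rw [Real.dist_eq, abs_lt] at h3 ⊢
  constructor <;> linarith

end Graph

section LatticeLimit

variable {d : ℕ}

theorem tendsto_boxEdgeSet (d : ℕ) :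
    Tendsto (fun n => (boxEdgeSet_finite d n).toFinset) atTop atTop := by
  refine tendsto_atTop_finset_of_monotone (fun m n h => ?_) fun e => ?_
  · rw [Set.Finite.toFinset_subset_toFinset]
    exact fun e he v hv i => (he v hv i).trans (by exact_mod_cast h)
  · obtain ⟨e, he⟩ := e
    induction e using Sym2.ind with
    | _ u v =>
      refine ⟨∑ i, (u i).natAbs + ∑ i, (v i).natAbs, ?_⟩
      rw [Set.Finite.mem_toFinset]
      intro w hw i
      have h1 := Finset.single_le_sum (f := fun i => (u i).natAbs) (fun _ _ => Nat.zero_le _)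
        (Finset.mem_univ i)
      have h2 := Finset.single_le_sum (f := fun i => (v i).natAbs) (fun _ _ => Nat.zero_le _)
        (Finset.mem_univ i)
      rw [Int.abs_eq_natAbs]
      rcases Sym2.mem_iff.1 hw with rfl | rfl <;> omega

theorem integral_loopO1Box {x : ℝ} (hx : 0 ≤ x) (n : ℕ)
    (f : PercConfig (hypercubicLattice d) → ℝ) :
    ∫ ω, f ω ∂(loopO1Box d n x) = evE (edgeBd (hypercubicLattice d)) x
      (boxEdgeSet_finite d n).toFinset (fun η => f (toConfig _ η)) :=
  integral_loopO1Finite _ hx _ f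

/-- The weak limit exists by compactness, and is determined by the limits of the expectations. -/
theorem existsUnique_isLoopO1Lattice {x : ℝ} (hx : x ∈ Set.Icc (0 : ℝ) 1) :
    ∃! μ : Measure (PercConfig (hypercubicLattice d)), IsLoopO1Lattice d x μ := by
  have hlim : ∀ f : PercConfig (hypercubicLattice d) →ᵇ ℝ, ∃ L,
      Tendsto (fun n : ℕ => ∫ ω, f ω ∂(loopO1Box d n x)) atTop (𝓝 L) := fun f => by
    obtain ⟨L, hL⟩ := exists_tendsto_integral (hypercubicLattice d) hx.1 hx.2 f.continuous
    refine ⟨L, ?_⟩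
    simp only [integral_loopO1Box hx.1]
    exact hL.comp (tendsto_boxEdgeSet d)
  have hprob : ∀ n, IsProbabilityMeasure (loopO1Box d n x) := fun n =>
    isProbabilityMeasure_loopO1Finite _ hx.1 _
  let P : ℕ → ProbabilityMeasure (PercConfig (hypercubicLattice d)) := fun n =>
    ⟨loopO1Box d n x, hprob n⟩
  obtain ⟨μ, hμ⟩ : ∃ μ, ClusterPt μ (map P atTop) := exists_clusterPt_of_compactSpace _
  have hU : (map P atTop ⊓ 𝓝 μ).NeBot := by rw [inf_comm]; exact hμ
  have hμL : ∀ (f : PercConfig (hypercubicLattice d) →ᵇ ℝ) (L : ℝ),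
      Tendsto (fun n : ℕ => ∫ ω, f ω ∂(loopO1Box d n x)) atTop (𝓝 L) →
      L = ∫ ω, f ω ∂(μ : Measure _) := fun f L hL => by
    have h1 : Tendsto (fun Q : ProbabilityMeasure (PercConfig (hypercubicLattice d)) =>
        ∫ ω, f ω ∂(Q : Measure _)) (map P atTop ⊓ 𝓝 μ) (𝓝 L) :=
      (tendsto_map'_iff.2 hL).mono_left inf_le_left
    exact tendsto_nhds_unique h1
      ((ProbabilityMeasure.tendsto_iff_forall_integral_tendsto.1 tendsto_id f).mono_left
        inf_le_right)
  refine ⟨μ, ⟨inferInstance, fun f => ?_⟩, fun ν hν => ?_⟩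
  · obtain ⟨L, hL⟩ := hlim f
    rwa [← hμL f L hL]
  · have := hν.1
    exact ext_of_forall_integral_eq_of_IsFiniteMeasure fun f => hμL f _ (hν.2 f)

end LatticeLimit

/-! ### Open paths, and percolation in the infinite-volume measure -/

section Paths

variable {d : ℕ}

/-- The unit vector in the direction `s.1`, with the sign `s.2`. -/
def unitStep (s : Fin d × Bool) : Fin d → ℤ := Pi.single s.1 (if s.2 then 1 else -1)

theorem exists_unitStep {u v : Fin d → ℤ} (h : (hypercubicLattice d).Adj u v) :
    ∃ s, v = u + unitStep s := by
  have h' : ∑ i, |u i - v i| = 1 := h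
  obtain ⟨i, hi⟩ : ∃ i, u i ≠ v i := by
    by_contra! hno
    simp [hno] at h'
  have hpos : 1 ≤ |u i - v i| := Int.one_le_abs (sub_ne_zero.2 hi)
  have hsplit := Finset.add_sum_erase Finset.univ (fun i => |u i - v i|) (Finset.mem_univ i)
  have hrest : ∀ j ≠ i, u j = v j := by
    intro j hj
    have h1 := Finset.single_le_sum (f := fun i => |u i - v i|) (fun _ _ => abs_nonneg _)
      (Finset.mem_erase.2 ⟨hj, Finset.mem_univ j⟩)
    have h2 : |u j - v j| = 0 := le_antisymm (by omega) (abs_nonneg _)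
    exact sub_eq_zero.1 (abs_eq_zero.1 h2)
  have hle : |u i - v i| ≤ 1 := by
    have : 0 ≤ ∑ j ∈ Finset.univ.erase i, |u j - v j| := Finset.sum_nonneg fun _ _ => abs_nonneg _
    omega
  have hone : u i - v i = 1 ∨ u i - v i = -1 := by
    rw [abs_le] at hle
    rcases le_abs.1 hpos with h | h <;> omega
  have hmk : ∀ b : Bool, v i = u i + (if b then 1 else -1) → ∃ s, v = u + unitStep s := by
    intro b hb
    refine ⟨(i, b), funext fun j => ?_⟩
    by_cases hj : j = i
    · subst hj; simpa [unitStep] using hb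
    · simp [unitStep, Pi.single_eq_of_ne hj, hrest j hj]
  rcases hone with h | h
  · exact hmk false (by simp; omega)
  · exact hmk true (by simp; omega)

/-- The path that starts at `o` and follows the steps of the word `w`. -/
def wordPath (o : Fin d → ℤ) {n : ℕ} (w : Fin n → Fin d × Bool) (k : ℕ) : Fin d → ℤ :=
  o + ∑ m ∈ Finset.range k, if h : m < n then unitStep (w ⟨m, h⟩) else 0

theorem wordPath_zero (o : Fin d → ℤ) {n : ℕ} (w : Fin n → Fin d × Bool) :
    wordPath o w 0 = o := by simp [wordPath]

theorem wordPath_castLE (o : Fin d → ℤ) {m n k : ℕ} (h : m ≤ n) (w : Fin n → Fin d × Bool)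
    (hk : k ≤ m) : wordPath o (w ∘ Fin.castLE h) k = wordPath o w k := by
  unfold wordPath
  congr 1
  refine Finset.sum_congr rfl fun j hj => ?_
  have hj := Finset.mem_range.1 hj
  rw [dif_pos (show j < m by omega), dif_pos (show j < n by omega)]
  rfl

theorem exists_wordPath (n : ℕ) (γ : ℕ → Fin d → ℤ)
    (h : ∀ k < n, (hypercubicLattice d).Adj (γ k) (γ (k + 1))) :
    ∃ w : Fin n → Fin d × Bool, ∀ k ≤ n, wordPath (γ 0) w k = γ k := by
  choose s hs using fun k (hk : k < n) => exists_unitStep (h k hk)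
  refine ⟨fun j => s j j.2, fun k hk => ?_⟩
  induction k with
  | zero => exact wordPath_zero _ _
  | succ k ih =>
    rw [hs k hk, ← ih (Nat.le_of_succ_le hk)]
    unfold wordPath
    rw [Finset.sum_range_succ, dif_pos (show k < n from hk), add_assoc]

/-- The word `w` describes a self-avoiding open path starting at `o`. -/
def IsOpenWord (ω : PercConfig (hypercubicLattice d)) (o : Fin d → ℤ) {n : ℕ}
    (w : Fin n → Fin d × Bool) : Prop :=
  Set.InjOn (wordPath o w) (Set.Iic n) ∧
    ∀ k < n, (openSubgraph _ ω).Adj (wordPath o w k) (wordPath o w (k + 1))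

/-- The event that a self-avoiding open path of length `n` starts at `o`. -/
def pathEvent (o : Fin d → ℤ) (n : ℕ) : Set (PercConfig (hypercubicLattice d)) :=
  {ω | ∃ w : Fin n → Fin d × Bool, IsOpenWord ω o w}

theorem mem_pathEvent_of_seq {ω : PercConfig (hypercubicLattice d)} {n : ℕ} {γ : ℕ → Fin d → ℤ}
    (hinj : Set.InjOn γ (Set.Iic n))
    (h : ∀ k < n, (openSubgraph _ ω).Adj (γ k) (γ (k + 1))) : ω ∈ pathEvent (γ 0) n := by
  obtain ⟨w, hw⟩ := exists_wordPath n γ fun k hk => (h k hk).1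
  refine ⟨w, hinj.congr fun k hk => (hw k hk).symm, fun k hk => ?_⟩
  rw [hw k hk.le, hw (k + 1) hk]
  exact h k hk

theorem IsOpenWord.castLE {ω : PercConfig (hypercubicLattice d)} {o : Fin d → ℤ} {m n : ℕ}
    (h : m ≤ n) {w : Fin n → Fin d × Bool} (hw : IsOpenWord ω o w) :
    IsOpenWord ω o (w ∘ Fin.castLE h) := by
  refine ⟨?_, fun k hk => ?_⟩
  · refine (hw.1.mono (Set.Iic_subset_Iic.2 h)).congr fun k hk => ?_
    exact (wordPath_castLE o h w hk).symm
  · rw [wordPath_castLE o h w hk.le, wordPath_castLE o h w hk]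
    exact hw.2 k (by omega)

theorem pathEvent_antitone (o : Fin d → ℤ) : Antitone (pathEvent (d := d) o) := by
  rintro m n h ω ⟨w, hw⟩
  exact ⟨_, hw.castLE h⟩

/-- König's lemma: there is an infinite path if there are paths of all lengths. -/
theorem connectedToInfinity_eq :
    connectedToInfinity (hypercubicLattice d) 0 = ⋂ n, pathEvent (d := d) 0 n := by
  ext ω
  rw [Set.mem_iInter]
  constructor
  · rintro ⟨γ, hinj, h0, h⟩ n
    rw [← h0]
    exact mem_pathEvent_of_seq hinj.injOn fun k _ => h k
  · intro h
    have hne : ∀ n, Nonempty {w : Fin n → Fin d × Bool // IsOpenWord ω 0 w} := fun n => by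
      obtain ⟨w, hw⟩ := h n
      exact ⟨⟨w, hw⟩⟩
    obtain ⟨f, hf⟩ := exists_seq_forall_proj_of_forall_finite
      (α := fun n => {w : Fin n → Fin d × Bool // IsOpenWord ω 0 w})
      (fun hij w => ⟨w.1 ∘ Fin.castLE hij, w.2.castLE hij⟩) (fun _ _ => rfl)
      (fun _ _ _ _ _ _ => rfl) (fun _ _ => Set.toFinite _)
    have key : ∀ {k n : ℕ}, k ≤ n → wordPath 0 (f k).1 k = wordPath 0 (f n).1 k := by
      intro k n hkn
      rw [← hf hkn]
      exact wordPath_castLE 0 hkn _ le_rfl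
    refine ⟨fun k => wordPath 0 (f k).1 k, fun j k hjk => ?_, wordPath_zero _ _, fun k => ?_⟩
    · simp only at hjk
      have h1 := key (le_max_left j k)
      have h2 := key (le_max_right j k)
      rw [h1, h2] at hjk
      exact (f (max j k)).2.1 (le_max_left j k) (le_max_right j k) hjk
    · simp only
      rw [key (Nat.le_succ k)]
      exact (f (k + 1)).2.2 k (Nat.lt_succ_self k)

theorem isClopen_pathEvent (o : Fin d → ℤ) (n : ℕ) : IsClopen (pathEvent (d := d) o n) := by
  have hadj : ∀ u v, IsClopen {ω : PercConfig (hypercubicLattice d) |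
      (openSubgraph _ ω).Adj u v} := by
    intro u v
    by_cases h : (hypercubicLattice d).Adj u v
    · have : {ω : PercConfig (hypercubicLattice d) | (openSubgraph _ ω).Adj u v} =
          (fun ω => ω ⟨s(u, v), h⟩) ⁻¹' {true} := by
        ext ω
        exact ⟨fun ⟨_, h'⟩ => h', fun h' => ⟨h, h'⟩⟩
      rw [this]
      exact (isClopen_discrete _).preimage (continuous_apply _)
    · have : {ω : PercConfig (hypercubicLattice d) | (openSubgraph _ ω).Adj u v} = ∅ := by
        ext ω
        exact ⟨fun ⟨h', _⟩ => h h', fun h' => h'.elim⟩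
      rw [this]
      exact isClopen_empty
  have : pathEvent (d := d) o n = ⋃ w : Fin n → Fin d × Bool, {ω | IsOpenWord ω o w} := by
    ext ω; simp [pathEvent]
  rw [this]
  refine isClopen_iUnion_of_finite fun w => ?_
  by_cases hinj : Set.InjOn (wordPath o w) (Set.Iic n)
  · have : {ω : PercConfig (hypercubicLattice d) | IsOpenWord ω o w} =
        ⋂ k ∈ Set.Iio n, {ω | (openSubgraph _ ω).Adj (wordPath o w k) (wordPath o w (k + 1))} := by
      ext ω
      simp only [Set.mem_iInter, Set.mem_ofPred_eq, Set.mem_Iio]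
      exact ⟨fun h => h.2, fun h => ⟨hinj, h⟩⟩
    rw [this]
    exact (Set.finite_Iio n).isClopen_biInter fun k _ => hadj _ _
  · have : {ω : PercConfig (hypercubicLattice d) | IsOpenWord ω o w} = ∅ := by
      ext ω
      exact ⟨fun h => hinj h.1, fun h' => h'.elim⟩
    rw [this]
    exact isClopen_empty

/-- A path from `o` to a vertex at distance at least `n` has length at least `n`. -/
theorem mem_pathEvent_of_reachable {ω : PercConfig (hypercubicLattice d)} {o v : Fin d → ℤ}
    {n : ℕ} {i : Fin d} (hv : (n : ℤ) ≤ |v i - o i|) (h : (openSubgraph _ ω).Reachable o v) :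
    ω ∈ pathEvent o n := by
  classical
  obtain ⟨p, hp⟩ := h.exists_isPath
  have hlen : ∀ {u v : Fin d → ℤ} (p : (openSubgraph _ ω).Walk u v), |v i - u i| ≤ p.length := by
    intro u v p
    induction p with
    | nil => simp
    | cons h _ ih =>
      obtain ⟨⟨j, b⟩, hs⟩ := exists_unitStep h.1
      rename_i u v w _
      have h1 : |v i - u i| ≤ 1 := by
        rw [hs, Pi.add_apply, add_sub_cancel_left, unitStep]
        by_cases hij : i = j
        · subst hij; cases b <;> simp
        · simp [Pi.single_eq_of_ne hij]
      rw [SimpleGraph.Walk.length_cons]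
      push_cast
      calc |w i - u i| = |(w i - v i) + (v i - u i)| := by ring_nf
        _ ≤ |w i - v i| + |v i - u i| := abs_add_le _ _
        _ ≤ _ := by omega
  have hn : n ≤ p.length := by exact_mod_cast hv.trans (hlen p)
  have := mem_pathEvent_of_seq (ω := ω) (n := n) (γ := p.getVert)
    (hp.getVert_injOn.mono fun k hk => le_trans hk hn)
    fun k hk => p.adj_getVert_succ (hk.trans_le hn)
  rwa [SimpleGraph.Walk.getVert_zero] at this

end Paths

section Translation

variable {d : ℕ}

/-- The translation of the edges by `o`. -/
def translateEdge (o : Fin d → ℤ) :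
    (hypercubicLattice d).edgeSet ≃ (hypercubicLattice d).edgeSet :=
  SimpleGraph.Iso.mapEdgeSet
    ⟨Equiv.addRight o, fun {a b} => by simp [hypercubicLattice]⟩

theorem translateEdge_mk (o u v : Fin d → ℤ) (h : (hypercubicLattice d).Adj u v)
    (h' : (hypercubicLattice d).Adj (u + o) (v + o)) :
    translateEdge o ⟨s(u, v), h⟩ = ⟨s(u + o, v + o), h'⟩ := rfl

theorem edgeBd_translateEdge (o v : Fin d → ℤ) (e : (hypercubicLattice d).edgeSet) :
    edgeBd _ (translateEdge o e) (v + o) = edgeBd _ e v := by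
  obtain ⟨e, he⟩ := e
  induction e using Sym2.ind with
  | _ a b =>
    rw [translateEdge_mk o a b he (by
      simpa [hypercubicLattice] using (SimpleGraph.mem_edgeSet _).1 he)]
    simp [edgeBd]

theorem evE_translate (x : ℝ) (o : Fin d → ℤ) (F : Finset (hypercubicLattice d).edgeSet)
    (f : Finset (hypercubicLattice d).edgeSet → ℝ) :
    evE (edgeBd _) x (F.map (translateEdge o).toEmbedding) f =
      evE (edgeBd _) x F (fun η => f (η.map (translateEdge o).toEmbedding)) := by
  have key : ∀ f, evW (edgeBd _) x (F.map (translateEdge o).toEmbedding) f =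
      evW (edgeBd _) x F (fun η => f (η.map (translateEdge o).toEmbedding)) := by
    intro f
    symm
    refine Finset.sum_equiv (translateEdge o).finsetCongr (fun η => ?_) fun η _ => ?_
    · simp [Equiv.finsetCongr_apply]
    · rw [Equiv.finsetCongr_apply, Finset.card_map, Finset.sum_map]
      congr 2
      refine ind_congr ?_
      rw [funext_iff, funext_iff]
      refine Equiv.forall_congr (Equiv.addRight o) fun v => ?_
      simp only [Finset.sum_apply, Equiv.coe_toEmbedding, Equiv.coe_addRight,
        edgeBd_translateEdge, Pi.zero_apply]
  rw [evE, evE, ← evW_one, ← evW_one, key, key]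

theorem openSubgraph_translate (o u v : Fin d → ℤ) (η : Finset (hypercubicLattice d).edgeSet) :
    (openSubgraph _ (toConfig _ (η.map (translateEdge o).toEmbedding))).Adj (u + o) (v + o) ↔
      (openSubgraph _ (toConfig _ η)).Adj u v := by
  have hadj : (hypercubicLattice d).Adj (u + o) (v + o) ↔ (hypercubicLattice d).Adj u v := by
    simp [hypercubicLattice]
  constructor
  · rintro ⟨h, h'⟩
    rw [toConfig_eq_true, ← translateEdge_mk o u v (hadj.1 h)] at h'
    exact ⟨hadj.1 h, (toConfig_eq_true _).2 ((Finset.mem_map' _).1 h')⟩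
  · rintro ⟨h, h'⟩
    refine ⟨hadj.2 h, ?_⟩
    rw [toConfig_eq_true, ← translateEdge_mk o u v h]
    exact (Finset.mem_map' _).2 ((toConfig_eq_true _).1 h')

theorem pathEvent_translate (o : Fin d → ℤ) (n : ℕ) (η : Finset (hypercubicLattice d).edgeSet) :
    toConfig _ (η.map (translateEdge o).toEmbedding) ∈ pathEvent o n ↔
      toConfig _ η ∈ pathEvent 0 n := by
  refine exists_congr fun w => ?_
  have hw : ∀ k, wordPath o w k = wordPath 0 w k + o := fun k => by
    rw [wordPath, wordPath, zero_add, add_comm]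
  refine and_congr ⟨fun h j hj k hk hjk => ?_, fun h j hj k hk hjk => ?_⟩
    (forall₂_congr fun k _ => ?_)
  · exact h hj hk (by rw [hw, hw, hjk])
  · rw [hw, hw] at hjk
    exact h hj hk (add_right_cancel hjk)
  · rw [hw, hw, openSubgraph_translate]

theorem indicator_eq_ind (A : Set (PercConfig (hypercubicLattice d)))
    (ω : PercConfig (hypercubicLattice d)) : A.indicator (fun _ => (1 : ℝ)) ω = ind (ω ∈ A) := by
  classical
  by_cases h : ω ∈ A
  · rw [Set.indicator_of_mem h, ind_of h]
  · rw [Set.indicator_of_notMem h, ind_of_not h]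

/-- The finite-volume probabilities of a clopen event converge. -/
theorem tendsto_evE_of_isClopen {x : ℝ} (hx : 0 ≤ x)
    {μ : Measure (PercConfig (hypercubicLattice d))} (hμ : IsLoopO1Lattice d x μ)
    {A : Set (PercConfig (hypercubicLattice d))} (hA : IsClopen A) :
    Tendsto (fun n : ℕ => evE (edgeBd _) x (boxEdgeSet_finite d n).toFinset
      (fun η => ind (toConfig _ η ∈ A))) atTop (𝓝 (μ.real A)) := by
  have h := hμ.2 (BoundedContinuousFunction.mkOfCompact
    ⟨A.indicator fun _ => (1 : ℝ), hA.continuous_indicator continuous_const⟩)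
  simp only [BoundedContinuousFunction.mkOfCompact_apply, ContinuousMap.coe_mk,
    integral_loopO1Box hx] at h
  rw [integral_indicator hA.isOpen.measurableSet, integral_const, smul_eq_mul, mul_one,
    measureReal_restrict_apply MeasurableSet.univ, Set.univ_inter] at h
  simpa only [indicator_eq_ind] using h

/-- The infinite-volume measure is translation invariant: the limit does not depend on the finite
graphs that exhaust the lattice. -/
theorem measureReal_pathEvent {x : ℝ} (hx : x ∈ Set.Icc (0 : ℝ) 1)
    {μ : Measure (PercConfig (hypercubicLattice d))} (hμ : IsLoopO1Lattice d x μ)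
    (o : Fin d → ℤ) (n : ℕ) : μ.real (pathEvent o n) = μ.real (pathEvent 0 n) := by
  have hcont : Continuous ((pathEvent (d := d) 0 n).indicator fun _ => (1 : ℝ)) :=
    (isClopen_pathEvent 0 n).continuous_indicator continuous_const
  obtain ⟨L, hL⟩ := exists_tendsto_integral (hypercubicLattice d) hx.1 hx.2 hcont
  simp only [indicator_eq_ind] at hL
  have h0 : μ.real (pathEvent 0 n) = L :=
    tendsto_nhds_unique (tendsto_evE_of_isClopen hx.1 hμ (isClopen_pathEvent 0 n))
      (hL.comp (tendsto_boxEdgeSet d))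
  rw [h0]
  have hshift : Tendsto (fun m : ℕ => (boxEdgeSet_finite d m).toFinset.map
      (translateEdge o).symm.toEmbedding) atTop atTop := by
    refine tendsto_atTop.2 fun B => ?_
    filter_upwards [(tendsto_boxEdgeSet d).eventually_ge_atTop
      (B.map (translateEdge o).toEmbedding)] with m hm
    intro e he
    rw [Finset.mem_map_equiv, Equiv.symm_symm]
    exact hm ((Finset.mem_map' _).2 he)
  refine tendsto_nhds_unique (tendsto_evE_of_isClopen hx.1 hμ (isClopen_pathEvent o n))
    (Tendsto.congr (fun m => ?_) (hL.comp hshift))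
  simp only [Function.comp_apply, ← pathEvent_translate o n]
  rw [← evE_translate x o _ (fun η => ind (toConfig _ η ∈ pathEvent o n)), Finset.map_map]
  congr 1
  convert Finset.map_refl
  ext e
  simp

/-- Percolation occurs if, uniformly in `n` and in sufficiently large boxes, some vertex of a fixed
finite set is the starting point of a path of length `n` with a probability bounded below. -/
theorem connectedToInfinity_pos {x : ℝ} (hx : x ∈ Set.Icc (0 : ℝ) 1)
    {μ : Measure (PercConfig (hypercubicLattice d))} (hμ : IsLoopO1Lattice d x μ)
    (A : Finset (Fin d → ℤ)) {c : ℝ} (hc : 0 < c)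
    (h : ∀ n : ℕ, ∀ᶠ N in atTop, c ≤ evE (edgeBd _) x (boxEdgeSet_finite d N).toFinset
      (fun η => ∑ o ∈ A, ind (toConfig _ η ∈ pathEvent o n))) :
    0 < μ (connectedToInfinity (hypercubicLattice d) 0) := by
  have := hμ.1
  have h1 : ∀ n, c ≤ A.card * μ.real (pathEvent (d := d) 0 n) := fun n => by
    have hlim := tendsto_finsetSum A fun o _ =>
      tendsto_evE_of_isClopen hx.1 hμ (isClopen_pathEvent (d := d) o n)
    have h2 := ge_of_tendsto hlim (by
      filter_upwards [h n] with N hN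
      rwa [evE_sum] at hN)
    simpa [measureReal_pathEvent hx hμ] using h2
  have hA : (0 : ℝ) < A.card := by
    rcases Nat.eq_zero_or_pos A.card with h0 | h0
    · have := h1 0
      rw [h0] at this
      simp at this
      linarith
    · exact_mod_cast h0
  have hlim := tendsto_measure_iInter_atTop (μ := μ) (s := pathEvent (d := d) 0)
    (fun n => (isClopen_pathEvent 0 n).isOpen.measurableSet.nullMeasurableSet)
    (pathEvent_antitone 0) ⟨0, measure_ne_top _ _⟩
  rw [← connectedToInfinity_eq] at hlim
  have hge : ENNReal.ofReal (c / A.card) ≤ μ (connectedToInfinity (hypercubicLattice d) 0) := by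
    refine ge_of_tendsto' hlim fun n => ?_
    rw [Function.comp_apply, ← ofReal_measureReal]
    refine ENNReal.ofReal_le_ofReal ?_
    rw [div_le_iff₀ hA, mul_comm]
    exact h1 n
  exact lt_of_lt_of_le (ENNReal.ofReal_pos.2 (by positivity)) hge

/-- A union bound over the self-avoiding paths of length `n` shows that there is no percolation for
small `x`. -/
theorem connectedToInfinity_eq_zero {x : ℝ} (hx : x ∈ Set.Icc (0 : ℝ) 1) (hxd : 2 * d * x < 1)
    {μ : Measure (PercConfig (hypercubicLattice d))} (hμ : IsLoopO1Lattice d x μ) :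
    μ (connectedToInfinity (hypercubicLattice d) 0) = 0 := by
  classical
  have := hμ.1
  have hfin : ∀ (n : ℕ) (F : Finset (hypercubicLattice d).edgeSet),
      evE (edgeBd _) x F (fun η => ind (toConfig _ η ∈ pathEvent 0 n)) ≤ (2 * d * x) ^ n := by
    intro n F
    have hword : ∀ w : Fin n → Fin d × Bool,
        evE (edgeBd _) x F (fun η => ind (IsOpenWord (toConfig _ η) 0 w)) ≤ x ^ n := by
      intro w
      by_cases hw : ∃ η, IsOpenWord (toConfig _ η) 0 w
      · obtain ⟨η₀, hinj, hη₀⟩ := hw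
        -- the edges of the path
        set b : Fin n → (hypercubicLattice d).edgeSet := fun k =>
          ⟨s(wordPath 0 w k, wordPath 0 w (k + 1)), (hη₀ k k.2).1⟩ with hb
        have hbinj : Function.Injective b := by
          intro j k hjk
          have hj := j.2
          have hk := k.2
          have heq : s(wordPath 0 w j, wordPath 0 w (j + 1)) =
              s(wordPath 0 w k, wordPath 0 w (k + 1)) := congrArg Subtype.val hjk
          rw [Sym2.eq_iff] at heq
          have hI : ∀ {i : ℕ}, i ≤ n → i ∈ Set.Iic n := fun h => h
          rcases heq with ⟨h1, -⟩ | ⟨h1, h2⟩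
          · exact Fin.ext (hinj (hI hj.le) (hI hk.le) h1)
          · have e1 := hinj (hI hj.le) (hI hk) h1
            have e2 := hinj (hI hj) (hI hk.le) h2
            omega
        have hcard : (Finset.univ.image b).card = n := by
          rw [Finset.card_image_of_injective _ hbinj, Finset.card_univ, Fintype.card_fin]
        refine (evE_mono _ hx.1 fun η _ _ => ind_mono fun h => ?_).trans
          ((evE_subset_le (edgeBd_add_self _) hx.1 hx.2 F (Finset.univ.image b)).trans_eq
            (by rw [hcard]))
        intro e he
        obtain ⟨k, -, rfl⟩ := Finset.mem_image.1 he
        obtain ⟨_, h'⟩ := h.2 k k.2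
        exact (toConfig_eq_true _).1 h'
      · refine le_trans (le_of_eq ?_) (pow_nonneg hx.1 n)
        rw [← evE_const (edgeBd _) hx.1 F 0]
        congr 1
        funext η
        exact ind_of_not fun h => hw ⟨η, h⟩
    have hunion : evE (edgeBd _) x F (fun η => ind (toConfig _ η ∈ pathEvent 0 n)) ≤
        ∑ w : Fin n → Fin d × Bool,
          evE (edgeBd _) x F (fun η => ind (IsOpenWord (toConfig _ η) 0 w)) := by
      rw [← evE_sum]
      refine evE_mono _ hx.1 fun η _ _ => ?_
      refine (ind_mono fun h => ?_).trans (ind_exists_le Finset.univ _)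
      obtain ⟨w, hw⟩ := h
      exact ⟨w, Finset.mem_univ _, hw⟩
    refine hunion.trans ((Finset.sum_le_card_nsmul _ _ _ fun w _ => hword w).trans_eq ?_)
    rw [Finset.card_univ, Fintype.card_fun, Fintype.card_prod, Fintype.card_bool,
      Fintype.card_fin, Fintype.card_fin, nsmul_eq_mul, mul_pow]
    push_cast
    ring
  have hle : ∀ n, μ.real (connectedToInfinity (hypercubicLattice d) 0) ≤ (2 * d * x) ^ n := by
    intro n
    refine (measureReal_mono ?_).trans
      (le_of_tendsto' (tendsto_evE_of_isClopen hx.1 hμ (isClopen_pathEvent 0 n)) fun N => hfin n _)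
    rw [connectedToInfinity_eq]
    exact Set.iInter_subset _ n
  have h0 : μ.real (connectedToInfinity (hypercubicLattice d) 0) ≤ 0 := by
    have hnn : 0 ≤ 2 * d * x := mul_nonneg (by positivity) hx.1
    exact ge_of_tendsto' (tendsto_pow_atTop_nhds_zero_of_lt_one hnn hxd) hle
  rw [← ofReal_measureReal, ENNReal.ofReal_eq_zero]
  exact h0

end Translation

/-! ### Stochastic domination by toggling cycles -/

section Toggle

variable {α M : Type*} [AddCommGroup M] {bd : α → M}
  (hbd : ∀ e, bd e + bd e = 0)

include hbd

theorem sum_symmDiff [DecidableEq α] (η g : Finset α) :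
    ∑ e ∈ symmDiff η g, bd e = ∑ e ∈ η, bd e + ∑ e ∈ g, bd e := by
  have h1 := Finset.sum_sdiff (f := bd) (Finset.inter_subset_left : η ∩ g ⊆ η)
  have h2 := Finset.sum_sdiff (f := bd) (Finset.inter_subset_right : η ∩ g ⊆ g)
  have h3 : ∑ e ∈ η ∩ g, bd e + ∑ e ∈ η ∩ g, bd e = 0 := by
    rw [← Finset.sum_add_distrib]
    exact Finset.sum_eq_zero fun e _ => hbd e
  rw [Finset.sdiff_inter_self_left] at h1
  rw [Finset.sdiff_inter_self_right] at h2
  rw [symmDiff_def, Finset.sup_eq_union, Finset.sum_union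
    (disjoint_sdiff_sdiff), ← h1, ← h2, add_add_add_comm, h3, add_zero]

/-- Toggling the edges of a cycle with at most `k` edges is injective, and costs at most a
factor `x ^ k`. -/
theorem evW_toggle [DecidableEq α] {x : ℝ} (hx : 0 ≤ x) (hx1 : x ≤ 1) {F g : Finset α}
    (hg : ∑ e ∈ g, bd e = 0) (hgF : g ⊆ F) {k : ℕ} (hk : g.card ≤ k) {P Q : Finset α → Prop}
    (hPQ : ∀ η ⊆ F, ∑ e ∈ η, bd e = 0 → P η → Q (symmDiff η g)) :
    x ^ k * evW bd x F (fun η => ind (P η)) ≤ evW bd x F (fun η => ind (Q η)) := by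
  have hsub : ∀ η ∈ F.powerset, symmDiff η g ∈ F.powerset := fun η hη =>
    Finset.mem_powerset.2 (symmDiff_le_sup.trans
      (Finset.union_subset (Finset.mem_powerset.1 hη) hgF))
  have hre : evW bd x F (fun η => ind (Q η)) = ∑ η ∈ F.powerset, x ^ (symmDiff η g).card *
      ind (∑ e ∈ symmDiff η g, bd e = 0) * ind (Q (symmDiff η g)) := by
    refine Finset.sum_nbij' (fun η => symmDiff η g) (fun η => symmDiff η g) hsub hsub
      (fun η _ => symmDiff_symmDiff_cancel_right g η)
      (fun η _ => symmDiff_symmDiff_cancel_right g η) fun η _ => ?_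
    rw [symmDiff_symmDiff_cancel_right]
  rw [hre, evW, Finset.mul_sum]
  refine Finset.sum_le_sum fun η hη => ?_
  rw [sum_symmDiff hbd, hg, add_zero]
  by_cases h0 : ∑ e ∈ η, bd e = 0
  · have h1 := ind_mono (hPQ η (Finset.mem_powerset.1 hη) h0)
    have h2 : x ^ (k + η.card) ≤ x ^ (symmDiff η g).card := by
      refine pow_le_pow_of_le_one hx hx1 ?_
      have := (Finset.card_le_card (symmDiff_le_sup (a := η) (b := g))).trans
        (Finset.card_union_le η g)
      omega
    rw [ind_of h0, mul_one, mul_one, ← mul_assoc, ← pow_add]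
    exact mul_le_mul h2 h1 (ind_nonneg _) (by positivity)
  · rw [ind_of_not h0]
    simp

/-- If the configurations with a property `P` can be made to satisfy also `Q`, where necessary, by
toggling one cycle, then `Q` holds with a conditional probability bounded below. -/
theorem evW_le_of_toggle [DecidableEq α] {x : ℝ} (hx : 0 < x) (hx1 : x ≤ 1) {F g : Finset α}
    (hg : ∑ e ∈ g, bd e = 0) (hgF : g ⊆ F) {k : ℕ} (hk : g.card ≤ k) {P Q : Finset α → Prop}
    (hPQ : ∀ η ⊆ F, ∑ e ∈ η, bd e = 0 → P η → ¬ Q η →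
      P (symmDiff η g) ∧ Q (symmDiff η g)) :
    x ^ k * evW bd x F (fun η => ind (P η)) ≤ 2 * evW bd x F (fun η => ind (P η ∧ Q η)) := by
  have h1 := evW_toggle hbd hx.le hx1 hg hgF hk (P := fun η => P η ∧ ¬ Q η)
    (Q := fun η => P η ∧ Q η) fun η h h0 hη => hPQ η h h0 hη.1 hη.2
  have h2 : evW bd x F (fun η => ind (P η)) ≤ evW bd x F (fun η => ind (P η ∧ Q η)) +
      evW bd x F (fun η => ind (P η ∧ ¬ Q η)) := by
    rw [← evW_add]
    refine evW_mono bd hx.le fun η _ _ => (ind_mono fun h => ?_).trans (ind_or_le _ _)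
    by_cases hQ : Q η
    exacts [Or.inl ⟨h, hQ⟩, Or.inr ⟨h, hQ⟩]
  have h3 := mul_le_mul_of_nonneg_left h2 (pow_nonneg hx.le k)
  have h4 : 0 ≤ evW bd x F (fun η => ind (P η ∧ Q η)) := by
    have := evW_mono bd hx.le (F := F) (f := fun _ => 0) (g := fun η => ind (P η ∧ Q η))
      fun _ _ _ => ind_nonneg _
    simpa [evW] using this
  have h5 := mul_le_mul_of_nonneg_right (pow_le_one₀ hx.le hx1 : x ^ k ≤ 1) h4
  linarith

omit hbd in
/-- A random set `τ η`, each of whose conditional one-point probabilities is at least that of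
Bernoulli percolation, dominates Bernoulli percolation. -/
theorem bernE_le_evE {β : Type*} [DecidableEq β] {p : β → ℝ} (h0 : ∀ e, 0 ≤ p e)
    (h1 : ∀ e, p e ≤ 1) {x : ℝ} (hx : 0 ≤ x) {F : Finset α} {E : Finset β}
    {τ : Finset α → Finset β} (hτ : ∀ η, τ η ⊆ E)
    (h : ∀ e ∈ E, ∀ S ⊆ E, e ∉ S → p e * evW bd x F (fun η => ind (τ η = S)) ≤
      (1 - p e) * evW bd x F (fun η => ind (τ η = insert e S)))
    {f : Finset β → ℝ} (hf : ∀ S T, S ⊆ T → f S ≤ f T) :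
    bernE p E f ≤ evE bd x F (fun η => f (τ η)) := by
  have key := bernE_le_of_conditional h0 h1 E (fun S => evW bd x F (fun η => ind (τ η = S))) f h hf
  have hsum : ∀ g : Finset β → ℝ,
      ∑ S ∈ E.powerset, evW bd x F (fun η => ind (τ η = S)) * g S =
        evW bd x F (fun η => g (τ η)) := by
    intro g
    simp only [mul_comm _ (g _), ← evW_const_mul]
    rw [← evW_sum]
    congr 1
    funext η
    rw [Finset.sum_eq_single_of_mem (τ η) (Finset.mem_powerset.2 (hτ η)) fun S _ hS => by
      rw [ind_of_not hS.symm, mul_zero], ind_of rfl, mul_one]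
  have hone := hsum fun _ => 1
  simp only [mul_one] at hone
  rw [hone, hsum, evW_one] at key
  have hZ := one_le_bdZ_zero (bd := bd) hx F
  rw [evE, le_div_iff₀ (by linarith)]
  linarith

end Toggle

/-! ### Plaquettes of the hypercubic lattice -/

section Plaquette

variable {d : ℕ}

theorem adj_add_single (v : Fin d → ℤ) (i : Fin d) :
    (hypercubicLattice d).Adj v (v + Pi.single i 1) := by
  change ∑ j, |v j - (v + Pi.single i 1 : Fin d → ℤ) j| = 1
  rw [Finset.sum_eq_single i]
  · simp
  · intro j _ hj
    simp [Pi.single_eq_of_ne hj]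
  · simp

/-- The edge from `v` to `v + eᵢ`. -/
def edgeOf (v : Fin d → ℤ) (i : Fin d) : (hypercubicLattice d).edgeSet :=
  ⟨s(v, v + Pi.single i 1), adj_add_single v i⟩

theorem edgeOf_inj {v w : Fin d → ℤ} {i j : Fin d} : edgeOf v i = edgeOf w j ↔ v = w ∧ i = j := by
  constructor
  · intro h
    have h' : s(v, v + Pi.single i 1) = s(w, w + Pi.single j 1) := congrArg Subtype.val h
    rcases Sym2.eq_iff.1 h' with ⟨rfl, h2⟩ | ⟨rfl, h2⟩
    · refine ⟨rfl, ?_⟩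
      by_contra hij
      have := congrFun (add_left_cancel h2) i
      rw [Pi.single_eq_same, Pi.single_eq_of_ne hij] at this
      exact one_ne_zero this
    · exfalso
      have := congrFun h2 i
      by_cases hij : i = j
      · subst hij; simp at this; omega
      · simp [Pi.single_eq_of_ne hij] at this
  · rintro ⟨rfl, rfl⟩; rfl

theorem exists_eq_edgeOf (e : (hypercubicLattice d).edgeSet) : ∃ v i, e = edgeOf v i := by
  obtain ⟨e, he⟩ := e
  induction e using Sym2.ind with
  | _ u v =>
    obtain ⟨⟨i, b⟩, hs⟩ := exists_unitStep he
    have hs : v = u + unitStep (i, b) := hs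
    subst hs
    cases b
    · refine ⟨u + unitStep (i, false), i, Subtype.ext ?_⟩
      have : u + unitStep (i, false) + Pi.single i 1 = u := by
        funext j
        by_cases hj : j = i
        · subst hj; simp [unitStep]
        · simp [unitStep, Pi.single_eq_of_ne hj]
      simp only [edgeOf, this]
      exact Sym2.eq_swap
    · exact ⟨u, i, rfl⟩

/-- The sum of the values of `L` at the two endpoints of an edge. -/
def coboundary (L : (Fin d → ℤ) → ZMod 2) (e : (hypercubicLattice d).edgeSet) : ZMod 2 :=
  Sym2.lift ⟨fun u v => L u + L v, fun _ _ => add_comm _ _⟩ e.1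

theorem coboundary_edgeOf (L : (Fin d → ℤ) → ZMod 2) (v : Fin d → ℤ) (i : Fin d) :
    coboundary L (edgeOf v i) = L v + L (v + Pi.single i 1) := rfl

theorem sum_mul_edgeBd (L : (Fin d → ℤ) → ZMod 2) {e : (hypercubicLattice d).edgeSet}
    {W : Finset (Fin d → ℤ)} (hW : ∀ v ∈ e.1, v ∈ W) :
    ∑ v ∈ W, L v * edgeBd _ e v = coboundary L e := by
  classical
  obtain ⟨u, i, rfl⟩ := exists_eq_edgeOf e
  have hu : u ∈ W := hW u (Sym2.mem_mk_left _ _)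
  have hv : u + Pi.single i 1 ∈ W := hW _ (Sym2.mem_mk_right _ _)
  have hne : u ≠ u + Pi.single i 1 := (adj_add_single u i).ne
  rw [coboundary_edgeOf, ← Finset.sum_pair (f := L) hne,
    ← Finset.sum_subset (s₁ := {u, u + Pi.single i 1}) (f := fun v => L v * edgeBd _ _ v)]
  · refine Finset.sum_congr rfl fun v hv => ?_
    have : v ∈ (edgeOf u i).1 := by
      rw [Finset.mem_insert, Finset.mem_singleton] at hv
      exact Sym2.mem_iff.2 hv
    rw [edgeBd, if_pos this, mul_one]
  · intro v hv
    rw [Finset.mem_insert, Finset.mem_singleton] at hv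
    rcases hv with rfl | rfl <;> assumption
  · intro v _ hv
    have : v ∉ (edgeOf u i).1 := fun h => hv (by
      rw [Finset.mem_insert, Finset.mem_singleton]
      exact Sym2.mem_iff.1 h)
    rw [edgeBd, if_neg this, mul_zero]

/-- Even sets of edges are orthogonal to coboundaries. -/
theorem sum_coboundary_eq_zero (L : (Fin d → ℤ) → ZMod 2)
    {η : Finset (hypercubicLattice d).edgeSet} (hη : ∑ e ∈ η, edgeBd _ e = 0) :
    ∑ e ∈ η, coboundary L e = 0 := by
  classical
  set W : Finset (Fin d → ℤ) := η.biUnion fun e => e.1.toFinset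
  have : ∑ e ∈ η, coboundary L e = ∑ e ∈ η, ∑ v ∈ W, L v * edgeBd _ e v := by
    refine Finset.sum_congr rfl fun e he => (sum_mul_edgeBd L fun v hv => ?_).symm
    exact Finset.mem_biUnion.2 ⟨e, he, Sym2.mem_toFinset.2 hv⟩
  rw [this, Finset.sum_comm]
  refine Finset.sum_eq_zero fun v _ => ?_
  rw [← Finset.mul_sum, ← Finset.sum_apply, hη, Pi.zero_apply, mul_zero]

open Classical in
/-- The plaquette at `v` in the directions `i` and `j`. -/
noncomputable def plaq (v : Fin d → ℤ) (i j : Fin d) : Finset (hypercubicLattice d).edgeSet :=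
  {edgeOf v i, edgeOf v j, edgeOf (v + Pi.single j 1) i, edgeOf (v + Pi.single i 1) j}

theorem mem_plaq {v : Fin d → ℤ} {i j : Fin d} {e : (hypercubicLattice d).edgeSet} :
    e ∈ plaq v i j ↔ e = edgeOf v i ∨ e = edgeOf v j ∨ e = edgeOf (v + Pi.single j 1) i ∨
      e = edgeOf (v + Pi.single i 1) j := by
  simp [plaq]

theorem card_plaq_le (v : Fin d → ℤ) (i j : Fin d) : (plaq v i j).card ≤ 4 :=
  Finset.card_le_four

theorem sum_plaq {M : Type*} [AddCommMonoid M] (v : Fin d → ℤ) {i j : Fin d} (hij : i ≠ j)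
    (g : (hypercubicLattice d).edgeSet → M) :
    ∑ e ∈ plaq v i j, g e = g (edgeOf v i) + (g (edgeOf v j) +
      (g (edgeOf (v + Pi.single j 1) i) + g (edgeOf (v + Pi.single i 1) j))) := by
  classical
  have hne : ∀ k, v ≠ v + Pi.single k 1 := fun k => (adj_add_single v k).ne
  rw [plaq, Finset.sum_insert, Finset.sum_insert, Finset.sum_insert, Finset.sum_singleton] <;>
    simp [edgeOf_inj, hij, hij.symm, hne]

theorem sum_edgeBd_plaq (v : Fin d → ℤ) {i j : Fin d} (hij : i ≠ j) :
    ∑ e ∈ plaq v i j, edgeBd _ e = 0 := by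
  classical
  rw [sum_plaq v hij]
  have hb : ∀ (u : Fin d → ℤ) (k : Fin d), edgeBd (hypercubicLattice d) (edgeOf u k) =
      fun w => (if w = u then 1 else 0) + (if w = u + Pi.single k 1 then 1 else 0) := by
    intro u k
    funext w
    have hne : u ≠ u + Pi.single k 1 := (adj_add_single u k).ne
    simp only [edgeBd, edgeOf, Sym2.mem_iff]
    by_cases h1 : w = u
    · subst h1
      simp [hne]
    · simp [h1]
  rw [hb, hb, hb, hb, add_right_comm v (Pi.single j 1) (Pi.single i 1)]
  funext w
  simp only [Pi.add_apply, Pi.zero_apply]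
  have two : ∀ z : ZMod 2, z + z = 0 := CharTwo.add_self_eq_zero
  generalize (if w = v then (1 : ZMod 2) else 0) = a
  generalize (if w = v + Pi.single i 1 then (1 : ZMod 2) else 0) = b
  generalize (if w = v + Pi.single j 1 then (1 : ZMod 2) else 0) = c
  generalize (if w = v + Pi.single i 1 + Pi.single j 1 then (1 : ZMod 2) else 0) = e
  calc a + b + (a + c + (c + e + (b + e))) = (a + a) + (b + b) + (c + c) + (e + e) := by ring
    _ = 0 := by simp [two]

end Plaquette

/-! ### The planar lattice: face spins -/

section Planar

/-- A pair of integers as a vertex of the hypercubic lattice in dimension two. -/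
def vtx (v : ℤ × ℤ) : Fin 2 → ℤ := ![v.1, v.2]

theorem vtx_injective : Function.Injective vtx := by
  rintro ⟨a, b⟩ ⟨a', b'⟩ h
  have h0 := congrFun h 0
  have h1 := congrFun h 1
  simp only [vtx, Matrix.cons_val_zero, Matrix.cons_val_one] at h0 h1
  rw [h0, h1]

theorem vtx_add_zero (a b : ℤ) : vtx (a, b) + Pi.single 0 1 = vtx (a + 1, b) := by
  funext i
  fin_cases i <;> simp [vtx]

theorem vtx_add_one (a b : ℤ) : vtx (a, b) + Pi.single 1 1 = vtx (a, b + 1) := by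
  funext i
  fin_cases i <;> simp [vtx]

/-- An edge of the square lattice as an edge of the hypercubic lattice in dimension two. -/
def edge2 (e : Z2Edge) : (hypercubicLattice 2).edgeSet :=
  edgeOf (vtx (e.1, e.2.1)) (if e.2.2 then 0 else 1)

theorem edge2_injective : Function.Injective edge2 := by
  rintro ⟨a, b, k⟩ ⟨a', b', k'⟩ h
  obtain ⟨h1, h2⟩ := edgeOf_inj.1 h
  have := vtx_injective h1
  simp only [Prod.mk.injEq] at this
  cases k <;> cases k' <;> simp_all

theorem exists_eq_edge2 (e : (hypercubicLattice 2).edgeSet) : ∃ e', e = edge2 e' := by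
  obtain ⟨v, i, rfl⟩ := exists_eq_edgeOf e
  have hv : v = vtx (v 0, v 1) := by
    funext j
    fin_cases j <;> rfl
  refine ⟨(v 0, v 1, decide (i = 0)), ?_⟩
  rw [edge2, ← hv]
  congr 1
  fin_cases i <;> simp

open Classical in
/-- The indicator function of the vertical edges to the right of the face `f`. -/
noncomputable def ray (f : ℤ × ℤ) (e : (hypercubicLattice 2).edgeSet) : ZMod 2 :=
  if ∃ x, f.1 < x ∧ e = edge2 (x, f.2, false) then 1 else 0

theorem ray_true (f : ℤ × ℤ) (x y : ℤ) : ray f (edge2 (x, y, true)) = 0 := by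
  rw [ray, if_neg]
  rintro ⟨x', -, h⟩
  simpa using edge2_injective h

theorem ray_false (f : ℤ × ℤ) (x y : ℤ) :
    ray f (edge2 (x, y, false)) = if f.1 < x ∧ y = f.2 then 1 else 0 := by
  by_cases h : f.1 < x ∧ y = f.2
  · rw [if_pos h, ray, if_pos ⟨x, h.1, by rw [h.2]⟩]
  · rw [if_neg h, ray, if_neg]
    rintro ⟨x', h1, h2⟩
    have := edge2_injective h2
    simp only [Prod.mk.injEq, and_true] at this
    obtain ⟨rfl, rfl⟩ := this
    exact h ⟨h1, rfl⟩

/-- The spin of the face `f`: the parity of the number of edges of `η` that the horizontal ray to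
the right of `f` crosses. -/
noncomputable def spin (η : Finset (hypercubicLattice 2).edgeSet) (f : ℤ × ℤ) : ZMod 2 :=
  ∑ e ∈ η, ray f e

/-- The boundary of the face `f`. -/
noncomputable def facePlaq (f : ℤ × ℤ) : Finset (hypercubicLattice 2).edgeSet := plaq (vtx f) 0 1

theorem sum_facePlaq {M : Type*} [AddCommMonoid M] (f : ℤ × ℤ)
    (g : (hypercubicLattice 2).edgeSet → M) :
    ∑ e ∈ facePlaq f, g e = g (edge2 (f.1, f.2, true)) + (g (edge2 (f.1, f.2, false)) +
      (g (edge2 (f.1, f.2 + 1, true)) + g (edge2 (f.1 + 1, f.2, false)))) := by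
  rw [facePlaq, sum_plaq (vtx f) (by decide : (0 : Fin 2) ≠ 1), vtx_add_zero, vtx_add_one]
  rfl

open Classical in
/-- Toggling the boundary of a face flips the spin of this face only. -/
theorem spin_toggle (η : Finset (hypercubicLattice 2).edgeSet) (f g : ℤ × ℤ) :
    spin (symmDiff η (facePlaq f)) g = spin η g + if f = g then 1 else 0 := by
  rw [spin, sum_symmDiff (bd := ray g) (fun e => CharTwo.add_self_eq_zero _), ← spin,
    sum_facePlaq]
  congr 1
  obtain ⟨a, b⟩ := f
  obtain ⟨a', b'⟩ := g
  rw [ray_true, ray_true, ray_false, ray_false, zero_add, zero_add]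
  simp only [Prod.mk.injEq]
  by_cases hb : b = b'
  · by_cases h1 : a' < a
    · rw [if_pos ⟨h1, hb⟩, if_pos ⟨by omega, hb⟩, if_neg (by omega)]
      exact CharTwo.add_self_eq_zero _
    · by_cases h2 : a = a'
      · rw [if_neg (by omega), if_pos ⟨by omega, hb⟩, if_pos ⟨h2, hb⟩, zero_add]
      · rw [if_neg (by omega), if_neg (by omega), if_neg (by omega), zero_add]
  · rw [if_neg (by omega), if_neg (by omega), if_neg (by omega), zero_add]

open Classical in
/-- An edge is open if and only if the spins on its two sides differ. -/
theorem spin_faceA_add {η : Finset (hypercubicLattice 2).edgeSet}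
    (hη : ∑ e ∈ η, edgeBd _ e = 0) (e : Z2Edge) :
    spin η (faceA e) + spin η (faceB e) = if edge2 e ∈ η then 1 else 0 := by
  have hone : ∑ e' ∈ η, (if e' = edge2 e then (1 : ZMod 2) else 0) =
      if edge2 e ∈ η then 1 else 0 := by
    rw [Finset.sum_ite_eq']
  have two : ∀ z : ZMod 2, z + z = 0 := CharTwo.add_self_eq_zero
  rw [spin, spin, ← Finset.sum_add_distrib, ← hone]
  obtain ⟨a, b, k⟩ := e
  cases k
  · refine Finset.sum_congr rfl fun e' _ => ?_
    obtain ⟨⟨x, y, l⟩, rfl⟩ := exists_eq_edge2 e'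
    cases l
    · simp only [faceA_mk, faceB_false, ray_false, edge2_injective.eq_iff, Prod.mk.injEq, and_true]
      by_cases hy : y = b
      · by_cases h1 : a < x
        · rw [if_pos ⟨h1, hy⟩, if_pos ⟨by omega, hy⟩, if_neg (by omega), two]
        · by_cases h2 : x = a
          · rw [if_neg (by omega), if_pos ⟨by omega, hy⟩, if_pos ⟨h2, hy⟩, zero_add]
          · rw [if_neg (by omega), if_neg (by omega), if_neg (by omega), zero_add]
      · rw [if_neg (by omega), if_neg (by omega), if_neg (by omega), zero_add]
    · rw [ray_true, ray_true, if_neg, zero_add]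
      intro h
      simpa using edge2_injective h
  · set L : (Fin 2 → ℤ) → ZMod 2 := fun v => if v 1 = b ∧ a < v 0 then 1 else 0 with hL
    -- Together with the edge itself, the edges crossed by the two rays are those that leave the set
    -- of vertices between the rays, and an even set contains an even number of these.
    have hz : ∑ e' ∈ η, (if e' = edge2 (a, b, true) then (1 : ZMod 2) else 0) =
        ∑ e' ∈ η, ((if e' = edge2 (a, b, true) then (1 : ZMod 2) else 0) + coboundary L e') := by
      rw [Finset.sum_add_distrib, sum_coboundary_eq_zero L hη, add_zero]
    rw [hz]
    refine Finset.sum_congr rfl fun e' _ => ?_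
    obtain ⟨⟨x, y, l⟩, rfl⟩ := exists_eq_edge2 e'
    cases l
    · have hc : coboundary L (edge2 (x, y, false)) =
          (if y = b ∧ a < x then 1 else 0) + (if y + 1 = b ∧ a < x then 1 else 0) := by
        simp only [edge2, coboundary_edgeOf, Bool.false_eq_true, if_false, vtx_add_one]
        simp [hL, vtx]
      have hne : edge2 (x, y, false) ≠ edge2 (a, b, true) := fun h => by
        simpa using edge2_injective h
      rw [hc, ray_false, ray_false, if_neg hne, zero_add]
      simp only [faceA_mk, faceB_true]
      congr 1
      · exact if_congr and_comm rfl rfl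
      · exact if_congr ⟨fun h => ⟨by omega, h.1⟩, fun h => ⟨h.2, by omega⟩⟩ rfl rfl
    · have hc : coboundary L (edge2 (x, y, true)) =
          (if y = b ∧ a < x then 1 else 0) + (if y = b ∧ a < x + 1 then 1 else 0) := by
        simp only [edge2, coboundary_edgeOf, if_true, vtx_add_zero]
        simp [hL, vtx]
      rw [hc, ray_true, ray_true]
      simp only [edge2_injective.eq_iff, Prod.mk.injEq, and_true]
      by_cases hy : y = b
      · by_cases h1 : a < x
        · rw [if_neg (by omega : ¬ (x = a ∧ y = b)), if_pos ⟨hy, h1⟩, if_pos ⟨hy, by omega⟩, two,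
            two, add_zero]
        · by_cases h2 : x = a
          · rw [if_neg (by omega : ¬ (y = b ∧ a < x)), if_pos ⟨h2, hy⟩, if_pos ⟨hy, by omega⟩,
              zero_add, zero_add, two]
          · rw [if_neg (by omega : ¬ (y = b ∧ a < x)), if_neg (by omega), if_neg (by omega),
              zero_add, zero_add]
      · rw [if_neg (by omega : ¬ (y = b ∧ a < x)), if_neg (by omega), if_neg (by omega),
          zero_add, zero_add]

/-- The open edges of the configuration `η`. -/
def open2 (η : Finset (hypercubicLattice 2).edgeSet) : Set Z2Edge := {e | edge2 e ∈ η}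

theorem spin_eq_of_notMem {η : Finset (hypercubicLattice 2).edgeSet}
    (hη : ∑ e ∈ η, edgeBd _ e = 0) {e : Z2Edge} (he : e ∉ open2 η) :
    spin η (faceA e) = spin η (faceB e) := by
  classical
  have := spin_faceA_add hη e
  rw [if_neg (show edge2 e ∉ η from he)] at this
  rw [eq_neg_of_add_eq_zero_left this, ZMod.neg_eq_self_mod_two]

/-- A path of faces that starts inside `C` and ends outside `C` visits a face next to the cut. -/
theorem exists_cut_face {C : Set (ℤ × ℤ)} {T : Set (ℤ × ℤ)} {u b : ℤ × ℤ}
    (hu : (u.1, u.2) ∈ C ∧ (u.1 + 1, u.2) ∈ C ∧ (u.1, u.2 + 1) ∈ C ∧ (u.1 + 1, u.2 + 1) ∈ C)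
    (hb : b ∉ C) (h : StarConn T u b) :
    ∃ f ∈ T, ∃ e, IsCut C e ∧ (f = faceA e ∨ f = faceB e) := by
  by_contra hno
  have key : (b.1, b.2) ∈ C ∧ (b.1 + 1, b.2) ∈ C ∧ (b.1, b.2 + 1) ∈ C ∧
      (b.1 + 1, b.2 + 1) ∈ C := by
    clear hb
    induction h with
    | refl => exact hu
    | tail h1 h2 ih =>
      rename_i v w
      obtain ⟨x, y⟩ := w
      obtain ⟨x', y'⟩ := v
      have hcut : ∀ e, IsCut C e → (x, y) ≠ faceA e ∧ (x, y) ≠ faceB e := fun e he =>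
        ⟨fun hf => hno ⟨_, h2.2.1, e, he, Or.inl hf⟩, fun hf => hno ⟨_, h2.2.1, e, he, Or.inr hf⟩⟩
      have c1 : (x, y) ∈ C ↔ (x + 1, y) ∈ C := by
        by_contra hc
        exact (hcut (x, y, true) (by simpa [IsCut] using hc)).1 rfl
      have c2 : (x, y) ∈ C ↔ (x, y + 1) ∈ C := by
        by_contra hc
        exact (hcut (x, y, false) (by simpa [IsCut] using hc)).1 rfl
      have c3 : (x, y + 1) ∈ C ↔ (x + 1, y + 1) ∈ C := by
        by_contra hc
        exact (hcut (x, y + 1, true) (by simpa [IsCut] using hc)).2 (by simp)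
      obtain ⟨-, -, h3, h4⟩ := h2
      simp only at h3 h4 ih ⊢
      rw [abs_le] at h3 h4
      have hx : x = x' - 1 ∨ x = x' ∨ x = x' + 1 := by omega
      have hy : y = y' - 1 ∨ y = y' ∨ y = y' + 1 := by omega
      rcases hx with rfl | rfl | rfl <;> rcases hy with rfl | rfl | rfl <;>
        (try simp only [sub_add_cancel] at c1 c2 c3 ⊢) <;> tauto
  exact hb key.1

/-- If arms of both spins start in a box, then an open cluster that meets the box is as long as the
arms: otherwise a contour around the cluster would consist of faces with equal spins, and could not
be crossed by both arms. -/
theorem exists_conn_of_arms {η : Finset (hypercubicLattice 2).edgeSet}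
    (hη : ∑ e ∈ η, edgeBd _ e = 0) {K n m : ℤ} (hK : 0 ≤ K) (hm : m ≤ n - K)
    {T : ZMod 2 → Set (ℤ × ℤ)}
    (hT : ∀ s, ∀ f ∈ T s, spin η f = s) (h : ∀ s, ∃ u ∈ sbox 0 K, Arm (T s) u n) :
    ∃ v ∈ sbox 0 (K + 1), ∃ b ∈ far 0 m, Conn ends2 (open2 η) v b := by
  by_contra hno
  push Not at hno
  set C₀ : Set (ℤ × ℤ) := {v | ∃ u ∈ box2 (K + 1), Conn ends2 (open2 η) u v} with hC₀
  have hbox : ∀ v, v ∈ box2 (K + 1) → v ∈ sbox 0 (K + 1) := fun v hv => by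
    rw [mem_box2, abs_le, abs_le] at hv
    rw [mem_sbox]
    simp only [Prod.fst_zero, Prod.snd_zero]
    omega
  have hconn : LatticeConnected C₀ :=
    latticeConnected_cluster (latticeConnected_box2 (by omega)) _
  have hsub : box2 (K + 1) ⊆ C₀ := fun v hv => ⟨v, hv, Conn.refl v⟩
  have hzero : (0 : ℤ × ℤ) ∈ box2 (K + 1) := by
    rw [mem_box2]; simp only [Prod.fst_zero, Prod.snd_zero, abs_zero]; omega
  have hfar : Disjoint C₀ (far 0 m) := by
    rw [Set.disjoint_left]
    rintro b ⟨v, hv, hvb⟩ hb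
    exact hno v (hbox v hv) b hb hvb
  obtain ⟨C, hCC, hCfar, hC1, hC2, hCcut⟩ := exists_filling hconn ⟨0, hsub hzero⟩ hfar
  have hcut : ∀ e, IsCut C e → spin η (faceA e) = spin η (faceB e) := fun e he =>
    spin_eq_of_notMem hη (not_mem_of_isCut_cluster (hCcut e he))
  -- the arm with spin `s` crosses the contour of `C`, along which no edge is open
  have hface : ∀ s, ∃ e, IsCut C e ∧ spin η (faceA e) = s := by
    intro s
    obtain ⟨u, hu, b, hb, hub⟩ := h s
    rw [mem_sbox] at hu
    simp only [Prod.fst_zero, Prod.snd_zero] at hu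
    obtain ⟨f, hf, e, he, hfe⟩ := exists_cut_face (C := C) (T := T s) (u := u) (b := b)
      (by
        refine ⟨hCC (hsub ?_), hCC (hsub ?_), hCC (hsub ?_), hCC (hsub ?_)⟩ <;>
          rw [mem_box2, abs_le, abs_le] <;> simp only <;> omega)
      (by
        refine fun hbC => Set.disjoint_left.1 hCfar hbC ?_
        simp only [mem_far, le_abs, Prod.fst_zero, Prod.snd_zero] at hb ⊢
        omega) hub
    refine ⟨e, he, ?_⟩
    have hs := hT s f hf
    rcases hfe with rfl | rfl
    · exact hs
    · rw [hcut e he, hs]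
  obtain ⟨e₀, he₀, hs₀⟩ := hface 0
  obtain ⟨e₁, he₁, hs₁⟩ := hface 1
  have := faceA_mem_of_isCut hC1 hC2 (P := {f | spin η f = 0})
    (fun e he => by simp only [Set.mem_ofPred_eq, hcut e he]) he₀ he₁ hs₀
  simp only [Set.mem_ofPred_eq, hs₁] at this
  exact one_ne_zero this

theorem reachable_of_conn {η : Finset (hypercubicLattice 2).edgeSet} {u v : ℤ × ℤ}
    (h : Conn ends2 (open2 η) u v) :
    (openSubgraph _ (toConfig _ η)).Reachable (vtx u) (vtx v) := by
  induction h with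
  | refl => exact SimpleGraph.Reachable.refl _
  | tail h1 h2 ih =>
    rename_i v w
    refine ih.trans ?_
    obtain ⟨⟨a, b, k⟩, he, h⟩ := h2
    have hadj : (openSubgraph _ (toConfig _ η)).Adj (vtx (ends2 (a, b, k)).1)
        (vtx (ends2 (a, b, k)).2) := by
      have he' : edge2 (a, b, k) ∈ η := he
      have hlat : (hypercubicLattice 2).Adj (vtx (ends2 (a, b, k)).1)
          (vtx (ends2 (a, b, k)).2) := by
        cases k
        · rw [ends2_false, ← vtx_add_one]
          exact adj_add_single _ _
        · rw [ends2_true, ← vtx_add_zero]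
          exact adj_add_single _ _
      refine ⟨hlat, (toConfig_eq_true _).2 ?_⟩
      convert he' using 1
      refine Subtype.ext ?_
      cases k
      · simp only [edge2, edgeOf, Bool.false_eq_true, if_false, vtx_add_one, ends2_false]
      · simp only [edge2, edgeOf, if_true, vtx_add_zero, ends2_true]
    rcases h with h | h <;> rw [h] at hadj
    · exact hadj.reachable
    · exact hadj.reachable.symm

open Classical in
/-- The faces of `E` with spin `s`. -/
noncomputable def spinSet (E : Finset (ℤ × ℤ)) (s : ZMod 2)
    (η : Finset (hypercubicLattice 2).edgeSet) : Finset (ℤ × ℤ) := E.filter fun f => spin η f = s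

theorem spinSet_toggle {E S : Finset (ℤ × ℤ)} {s : ZMod 2} {f : ℤ × ℤ} (hf : f ∈ E) (hfS : f ∉ S)
    {η : Finset (hypercubicLattice 2).edgeSet} [DecidableEq (hypercubicLattice 2).edgeSet]
    (h : spinSet E s η = S) :
    spinSet E s (symmDiff η (facePlaq f)) = insert f S := by
  classical
  have htog : ∀ g, spin (symmDiff η (facePlaq f)) g = spin η g + if f = g then 1 else 0 := by
    intro g
    convert spin_toggle η f g
  subst h
  have hfs : spin η f ≠ s := fun h => hfS (Finset.mem_filter.2 ⟨hf, h⟩)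
  have hz : ∀ z s : ZMod 2, z ≠ s → z + 1 = s := by decide
  ext g
  rw [spinSet, Finset.mem_filter, htog, Finset.mem_insert, spinSet, Finset.mem_filter]
  by_cases hfg : f = g
  · subst hfg
    simp [hf, hz _ _ hfs]
  · simp [hfg, Ne.symm hfg]

/-- The faces of either spin dominate Bernoulli percolation with a parameter close to one half. -/
theorem bernE_le_evE_spinSet {p x : ℝ} (hp0 : 0 ≤ p) (hp1 : p ≤ 1) (hx : 0 ≤ x) (hx1 : x ≤ 1)
    (hpx : p ≤ (1 - p) * x ^ 4) {F : Finset (hypercubicLattice 2).edgeSet} {E : Finset (ℤ × ℤ)}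
    (hF : ∀ f ∈ E, facePlaq f ⊆ F) (s : ZMod 2) {φ : Finset (ℤ × ℤ) → ℝ}
    (hφ : ∀ S T, S ⊆ T → φ S ≤ φ T) :
    bernE (fun _ => p) E φ ≤ evE (edgeBd _) x F (fun η => φ (spinSet E s η)) := by
  classical
  refine bernE_le_evE (fun _ => hp0) (fun _ => hp1) hx (fun η => Finset.filter_subset _ _) ?_ hφ
  intro f hf S _ hfS
  have h1 := evW_toggle (edgeBd_add_self (hypercubicLattice 2)) hx hx1
    (sum_edgeBd_plaq (vtx f) (by decide : (0 : Fin 2) ≠ 1)) (hF f hf) (card_plaq_le _ _ _)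
    (P := fun η => spinSet E s η = S) (Q := fun η => spinSet E s η = insert f S)
    fun η _ _ h => spinSet_toggle hf hfS h
  have h2 : 0 ≤ evW (edgeBd (hypercubicLattice 2)) x F (fun η => ind (spinSet E s η = S)) :=
    Finset.sum_nonneg fun _ _ => mul_nonneg (mul_nonneg (by positivity) (ind_nonneg _))
      (ind_nonneg _)
  calc p * _ ≤ (1 - p) * x ^ 4 * _ := mul_le_mul_of_nonneg_right hpx h2
    _ ≤ _ := by
      rw [mul_assoc]
      exact mul_le_mul_of_nonneg_left h1 (by linarith)

/-- The loop O(1) model on the square lattice percolates if `x` is close to one. -/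
theorem percolates_two {x : ℝ} (hx : x ∈ Set.Ioc (1 - enhGain / 2) 1)
    {μ : Measure (PercConfig (hypercubicLattice 2))} (hμ : IsLoopO1Lattice 2 x μ) :
    0 < μ (connectedToInfinity (hypercubicLattice 2) 0) := by
  have hg : enhGain ≤ 1 / 4 := by unfold enhGain; norm_num
  have hg0 := enhGain_pos
  have hx0 : 0 ≤ x := by linarith [hx.1]
  have hpx : 1 / 2 - enhGain ≤ (1 - (1 / 2 - enhGain)) * x ^ 4 := by
    have h1 : 1 - 2 * enhGain ≤ x ^ 4 := by
      have := one_add_mul_le_pow (show (-2 : ℝ) ≤ x - 1 by linarith) 4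
      push_cast at this
      rw [add_sub_cancel] at this
      linarith [hx.1]
    nlinarith
  obtain ⟨c, hc, harm⟩ := exists_pos_le_armProb
  obtain ⟨K, hK⟩ := exists_arm_box (q := 1 / 2 - enhGain) (by linarith) (by linarith) hc harm
    (δ := 1 / 4) (by norm_num)
  refine connectedToInfinity_pos ⟨hx0, hx.2⟩ hμ ((sbox 0 (K + 1)).image vtx) (c := 1 / 2)
    (by norm_num) fun k => ?_
  -- The arms give an open path from the box of radius `K + 1` to distance `n - K`; it ends at
  -- distance at least `k` from its starting point.
  set n : ℕ := k + 2 * K + 1 with hn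
  set E := sbox 0 ((K : ℤ) + n) with hE
  filter_upwards [eventually_ge_atTop (K + n + 1)] with N hN
  set F := (boxEdgeSet_finite 2 N).toFinset with hF
  have hFE : ∀ f ∈ E, facePlaq f ⊆ F := by
    rintro ⟨a, b⟩ hf e he
    rw [hE, mem_sbox] at hf
    simp only [Prod.fst_zero, Prod.snd_zero] at hf
    rw [hF, Set.Finite.mem_toFinset]
    rw [facePlaq, mem_plaq, vtx_add_zero, vtx_add_one] at he
    intro v hv i
    rcases he with rfl | rfl | rfl | rfl <;>
      rw [edgeOf, Sym2.mem_iff] at hv <;> simp only [vtx_add_zero, vtx_add_one] at hv <;>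
      rcases hv with rfl | rfl <;> fin_cases i <;> simp [vtx, abs_le] <;> omega
  have hdom : ∀ s : ZMod 2, 1 - 1 / 4 ≤ evE (edgeBd (hypercubicLattice 2)) x F (fun η =>
      ind (∃ u ∈ sbox 0 (K : ℤ), Arm (spinSet E s η : Set (ℤ × ℤ)) u n)) := fun s =>
    (hK n E le_rfl).trans (bernE_le_evE_spinSet (by linarith) (by linarith) hx0 hx.2 hpx hFE s
      (φ := fun S => ind (∃ u ∈ sbox 0 (K : ℤ), Arm (S : Set (ℤ × ℤ)) u n))
      fun S T h => ind_mono fun ⟨u, hu, ha⟩ => ⟨u, hu, ha.mono (by exact_mod_cast h)⟩)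
  have hsum := add_le_add (hdom 0) (hdom 1)
  rw [← evE_add] at hsum
  have hle := evE_mono (edgeBd (hypercubicLattice 2)) hx0 (F := F)
    (f := fun η => ind (∃ u ∈ sbox 0 (K : ℤ), Arm (spinSet E 0 η : Set (ℤ × ℤ)) u n) +
      ind (∃ u ∈ sbox 0 (K : ℤ), Arm (spinSet E 1 η : Set (ℤ × ℤ)) u n))
    (g := fun η => (∑ o ∈ (sbox 0 ((K : ℤ) + 1)).image vtx, ind (toConfig _ η ∈ pathEvent o k)) + 1)
    (by
      intro η _ hη
      -- Unless the arms of one spin are missing, there is a long open path.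
      by_cases h0 : ∃ u ∈ sbox 0 (K : ℤ), Arm (spinSet E 0 η : Set (ℤ × ℤ)) u n
      · by_cases h1 : ∃ u ∈ sbox 0 (K : ℤ), Arm (spinSet E 1 η : Set (ℤ × ℤ)) u n
        · obtain ⟨v, hv, b, hb, hvb⟩ := exists_conn_of_arms hη (K := K) (n := n) (m := n - K)
            (by omega) le_rfl (T := fun s => (spinSet E s η : Set (ℤ × ℤ)))
            (fun s f hf => (Finset.mem_filter.1 (Finset.mem_coe.1 hf)).2)
            (fun s => by
              have : s = 0 ∨ s = 1 := by revert s; decide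
              rcases this with rfl | rfl
              exacts [h0, h1])
          have hpath : toConfig _ η ∈ pathEvent (vtx v) k := by
            have hr := reachable_of_conn hvb
            rw [mem_sbox] at hv
            simp only [mem_far, Prod.fst_zero, Prod.snd_zero, sub_zero] at hb hv
            rw [le_abs, le_abs] at hb
            by_cases hb' : (k : ℤ) ≤ |b.1 - v.1|
            · exact mem_pathEvent_of_reachable (i := 0) (by simpa [vtx] using hb') hr
            · refine mem_pathEvent_of_reachable (i := 1) ?_ hr
              have : (k : ℤ) ≤ |b.2 - v.2| := by
                rw [le_abs] at hb' ⊢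
                omega
              simpa [vtx] using this
          have h3 := Finset.single_le_sum
            (f := fun o => ind (toConfig (hypercubicLattice 2) η ∈ pathEvent o k))
            (fun _ _ => ind_nonneg _) (Finset.mem_image_of_mem vtx hv)
          simp only [ind_of hpath] at h3
          rw [ind_of h0, ind_of h1]
          linarith
        · rw [ind_of h0, ind_of_not h1]
          linarith [Finset.sum_nonneg (s := (sbox 0 ((K : ℤ) + 1)).image vtx) (f := fun o =>
            ind (toConfig (hypercubicLattice 2) η ∈ pathEvent o k)) fun _ _ => ind_nonneg _]
      · rw [ind_of_not h0]
        linarith [Finset.sum_nonneg (s := (sbox 0 ((K : ℤ) + 1)).image vtx) (f := fun o =>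
            ind (toConfig (hypercubicLattice 2) η ∈ pathEvent o k)) fun _ _ => ind_nonneg _,
          ind_le_one (∃ u ∈ sbox 0 (K : ℤ), Arm (spinSet E 1 η : Set (ℤ × ℤ)) u n)])
  rw [evE_add _ _ _ _ (fun _ => (1 : ℝ)), evE_const _ hx0] at hle
  linarith

end Planar

/-! ### Three and more dimensions: a plane with detours -/

section Space

variable {d : ℕ} (D : Fin 3 ↪ Fin d)

/-- The point with coordinates `a`, `b`, `c` in the three directions `D`. -/
def pos (a b c : ℤ) : Fin d → ℤ := Pi.single (D 0) a + Pi.single (D 1) b + Pi.single (D 2) c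

theorem pos_apply_zero (a b c : ℤ) : pos D a b c (D 0) = a := by
  simp [pos]

theorem pos_apply_one (a b c : ℤ) : pos D a b c (D 1) = b := by
  simp [pos]

theorem pos_apply_two (a b c : ℤ) : pos D a b c (D 2) = c := by
  simp [pos]

theorem pos_inj {a b c a' b' c' : ℤ} : pos D a b c = pos D a' b' c' ↔ a = a' ∧ b = b' ∧ c = c' := by
  constructor
  · intro h
    have h0 := congrFun h (D 0)
    have h1 := congrFun h (D 1)
    have h2 := congrFun h (D 2)
    rw [pos_apply_zero, pos_apply_zero] at h0
    rw [pos_apply_one, pos_apply_one] at h1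
    rw [pos_apply_two, pos_apply_two] at h2
    exact ⟨h0, h1, h2⟩
  · rintro ⟨rfl, rfl, rfl⟩; rfl

theorem pos_add_zero (a b c : ℤ) : pos D a b c + Pi.single (D 0) 1 = pos D (a + 1) b c := by
  simp only [pos, Pi.single_add]; abel

theorem pos_add_one (a b c : ℤ) : pos D a b c + Pi.single (D 1) 1 = pos D a (b + 1) c := by
  simp only [pos, Pi.single_add]; abel

theorem pos_add_two (a b c : ℤ) : pos D a b c + Pi.single (D 2) 1 = pos D a b (c + 1) := by
  simp only [pos, Pi.single_add]; abel

theorem abs_pos_le {a b c N : ℤ} (ha : |a| ≤ N) (hb : |b| ≤ N) (hc : |c| ≤ N) (i : Fin d) :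
    |pos D a b c i| ≤ N := by
  have hN : 0 ≤ N := (abs_nonneg a).trans ha
  by_cases h0 : i = D 0
  · subst h0; rwa [pos_apply_zero]
  by_cases h1 : i = D 1
  · subst h1; rwa [pos_apply_one]
  by_cases h2 : i = D 2
  · subst h2; rwa [pos_apply_two]
  simpa [pos, Pi.single_apply, h0, h1, h2] using hN

/-- An edge in the three directions `D`. -/
def edge3 (a b c : ℤ) (s : Fin 3) : (hypercubicLattice d).edgeSet := edgeOf (pos D a b c) (D s)

theorem edge3_inj {a b c a' b' c' : ℤ} {s s' : Fin 3} :
    edge3 D a b c s = edge3 D a' b' c' s' ↔ (a = a' ∧ b = b' ∧ c = c') ∧ s = s' := by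
  rw [edge3, edge3, edgeOf_inj, pos_inj, D.injective.eq_iff]

theorem edge3_mem_box {a b c : ℤ} {s : Fin 3} {N : ℕ} (ha : |a| + 1 ≤ N) (hb : |b| + 1 ≤ N)
    (hc : |c| + 1 ≤ N) : edge3 D a b c s ∈ (boxEdgeSet_finite d N).toFinset := by
  rw [Set.Finite.mem_toFinset]
  intro v hv i
  rw [edge3, edgeOf, Sym2.mem_iff] at hv
  have ha' : |a| ≤ N ∧ |a + 1| ≤ N := by
    rw [abs_le, abs_le]; have := abs_le.1 (by omega : |a| ≤ N - 1); omega
  have hb' : |b| ≤ N ∧ |b + 1| ≤ N := by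
    rw [abs_le, abs_le]; have := abs_le.1 (by omega : |b| ≤ N - 1); omega
  have hc' : |c| ≤ N ∧ |c + 1| ≤ N := by
    rw [abs_le, abs_le]; have := abs_le.1 (by omega : |c| ≤ N - 1); omega
  rcases hv with rfl | rfl
  · exact abs_pos_le D ha'.1 hb'.1 hc'.1 i
  · fin_cases s
    · simp only [Fin.zero_eta, pos_add_zero]; exact abs_pos_le D ha'.2 hb'.1 hc'.1 i
    · simp only [Fin.mk_one, pos_add_one]; exact abs_pos_le D ha'.1 hb'.2 hc'.1 i
    · simp only [Fin.reduceFinMk, pos_add_two]; exact abs_pos_le D ha'.1 hb'.1 hc'.2 i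

/-- Labels of the edges that matter for the detours: `(0, a, b)` and `(1, a, b)` are the edges of
the plane from `(a, b)` in the two directions, `(2, a, b)` is the vertical edge above `(a, b)`, and
`(3, a, b)` is the edge parallel to `(0, a, b)` at height one. -/
abbrev Obs : Type := Fin 4 × ℤ × ℤ

/-- The edge of the lattice that the label `o` stands for. -/
def obsEdge (o : Obs) : (hypercubicLattice d).edgeSet :=
  edge3 D o.2.1 o.2.2 (if o.1 = 3 then 1 else 0) (if o.1 = 1 then 1 else if o.1 = 2 then 2 else 0)

/-- The edge with the label `o` is open. -/
def obs (η : Finset (hypercubicLattice d).edgeSet) (o : Obs) : Prop := obsEdge D o ∈ η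

/-- The plaquette below an edge of the plane, in the direction `s`. -/
noncomputable def cycleBelow (s : Fin 3) (a b : ℤ) : Finset (hypercubicLattice d).edgeSet :=
  plaq (pos D a b (-1)) (D s) (D 2)

/-- The plaquette above an edge at height one. -/
noncomputable def cycleAbove (a b : ℤ) : Finset (hypercubicLattice d).edgeSet :=
  plaq (pos D a b 1) (D 0) (D 2)

open Classical in
/-- The cycle through the vertical edges above `(a, b)` and `(a + 1, b)` that runs at the heights
`2` and `-1` between them. -/
noncomputable def cycleAround (a b : ℤ) : Finset (hypercubicLattice d).edgeSet :=
  symmDiff (plaq (pos D a b 0) (D 0) (D 2)) (symmDiff (cycleBelow D 0 a b) (cycleAbove D a b))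

theorem mem_plaq_pos_zero {a b c : ℤ} {e : (hypercubicLattice d).edgeSet} :
    e ∈ plaq (pos D a b c) (D 0) (D 2) ↔ e = edge3 D a b c 0 ∨ e = edge3 D a b c 2 ∨
      e = edge3 D a b (c + 1) 0 ∨ e = edge3 D (a + 1) b c 2 := by
  rw [mem_plaq, pos_add_zero, pos_add_two]; rfl

theorem mem_plaq_pos_one {a b c : ℤ} {e : (hypercubicLattice d).edgeSet} :
    e ∈ plaq (pos D a b c) (D 1) (D 2) ↔ e = edge3 D a b c 1 ∨ e = edge3 D a b c 2 ∨
      e = edge3 D a b (c + 1) 1 ∨ e = edge3 D a (b + 1) c 2 := by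
  rw [mem_plaq, pos_add_one, pos_add_two]; rfl

theorem obsEdge_mem_cycleBelow_zero {a b : ℤ} {o : Obs} :
    obsEdge D o ∈ cycleBelow D 0 a b ↔ o = (0, a, b) := by
  obtain ⟨s, a', b'⟩ := o
  rw [cycleBelow, mem_plaq_pos_zero]
  fin_cases s <;> simp [obsEdge, edge3_inj]

theorem obsEdge_mem_cycleBelow_one {a b : ℤ} {o : Obs} :
    obsEdge D o ∈ cycleBelow D 1 a b ↔ o = (1, a, b) := by
  obtain ⟨s, a', b'⟩ := o
  rw [cycleBelow, mem_plaq_pos_one]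
  fin_cases s <;> simp [obsEdge, edge3_inj]

theorem obsEdge_mem_cycleAbove {a b : ℤ} {o : Obs} :
    obsEdge D o ∈ cycleAbove D a b ↔ o = (3, a, b) := by
  obtain ⟨s, a', b'⟩ := o
  rw [cycleAbove, mem_plaq_pos_zero]
  fin_cases s <;> simp [obsEdge, edge3_inj]

theorem obsEdge_mem_cycleAround {a b : ℤ} {o : Obs} :
    obsEdge D o ∈ cycleAround D a b ↔ o = (2, a, b) ∨ o = (2, a + 1, b) := by
  rw [cycleAround, Finset.mem_symmDiff, Finset.mem_symmDiff, obsEdge_mem_cycleBelow_zero,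
    obsEdge_mem_cycleAbove, mem_plaq_pos_zero]
  obtain ⟨s, a', b'⟩ := o
  fin_cases s <;> simp [obsEdge, edge3_inj]

theorem sum_cycleBelow {s : Fin 3} (hs : s ≠ 2) (a b : ℤ) :
    ∑ e ∈ cycleBelow D s a b, edgeBd _ e = 0 :=
  sum_edgeBd_plaq _ (D.injective.ne hs)

theorem sum_cycleAbove (a b : ℤ) : ∑ e ∈ cycleAbove D a b, edgeBd _ e = 0 :=
  sum_edgeBd_plaq _ (D.injective.ne (by decide))

theorem sum_cycleAround (a b : ℤ) : ∑ e ∈ cycleAround D a b, edgeBd _ e = 0 := by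
  classical
  rw [cycleAround, sum_symmDiff (edgeBd_add_self _), sum_symmDiff (edgeBd_add_self _),
    sum_cycleAbove, sum_cycleBelow D (by decide),
    sum_edgeBd_plaq _ (D.injective.ne (by decide : (0 : Fin 3) ≠ 2)), add_zero, add_zero]

theorem card_cycleAround_le (a b : ℤ) : (cycleAround D a b).card ≤ 12 := by
  classical
  have h1 : ∀ s t : Finset (hypercubicLattice d).edgeSet,
      (symmDiff s t).card ≤ s.card + t.card := fun s t =>
    (Finset.card_le_card symmDiff_le_sup).trans (Finset.card_union_le s t)
  have h2 := h1 (plaq (pos D a b 0) (D 0) (D 2)) (symmDiff (cycleBelow D 0 a b) (cycleAbove D a b))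
  have h3 := h1 (cycleBelow D 0 a b) (cycleAbove D a b)
  have h4 : (plaq (pos D a b 0) (D 0) (D 2)).card ≤ 4 := card_plaq_le _ _ _
  have h5 : (cycleBelow D 0 a b).card ≤ 4 := card_plaq_le _ _ _
  have h6 : (cycleAbove D a b).card ≤ 4 := card_plaq_le _ _ _
  rw [cycleAround]
  convert (show (symmDiff (plaq (pos D a b 0) (D 0) (D 2))
    (symmDiff (cycleBelow D 0 a b) (cycleAbove D a b))).card ≤ 12 by omega)

section Box

variable {N : ℕ} {a b : ℤ} (ha : |a| + 4 ≤ N) (hb : |b| + 4 ≤ N)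

include ha hb

theorem plaq_pos_zero_subset {c : ℤ} (hc : |c| ≤ 1) :
    plaq (pos D a b c) (D 0) (D 2) ⊆ (boxEdgeSet_finite d N).toFinset := by
  have h1 : ∀ z : ℤ, |z + 1| ≤ |z| + 1 := fun z => (abs_add_le z 1).trans (by simp)
  intro e he
  have := h1 a
  have := h1 c
  have := abs_nonneg a
  rcases (mem_plaq_pos_zero D).1 he with rfl | rfl | rfl | rfl <;>
    exact edge3_mem_box D (by omega) (by omega) (by omega)

theorem cycleBelow_zero_subset : cycleBelow D 0 a b ⊆ (boxEdgeSet_finite d N).toFinset :=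
  plaq_pos_zero_subset D ha hb (by simp)

theorem cycleBelow_one_subset : cycleBelow D 1 a b ⊆ (boxEdgeSet_finite d N).toFinset := by
  have h1 : |b + 1| ≤ |b| + 1 := (abs_add_le b 1).trans (by simp)
  intro e he
  have := abs_nonneg a
  have h2 : |(-1 : ℤ)| = 1 := rfl
  have h3 : |(-1 : ℤ) + 1| = 0 := rfl
  rcases (mem_plaq_pos_one D).1 he with rfl | rfl | rfl | rfl <;>
    exact edge3_mem_box D (by omega) (by omega) (by omega)

theorem cycleAbove_subset : cycleAbove D a b ⊆ (boxEdgeSet_finite d N).toFinset :=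
  plaq_pos_zero_subset D ha hb (by simp)

theorem cycleAround_subset : cycleAround D a b ⊆ (boxEdgeSet_finite d N).toFinset :=
  symmDiff_le_sup.trans (Finset.union_subset (plaq_pos_zero_subset D ha hb (by simp))
    (symmDiff_le_sup.trans (Finset.union_subset (cycleBelow_zero_subset D ha hb)
      (cycleAbove_subset D ha hb))))

end Box

end Space

section Detour

theorem xor_false_iff {p : Prop} : Xor p False ↔ p := by simp [Xor]

theorem xor_true_iff {p : Prop} : Xor p True ↔ ¬ p := by simp [Xor]

/-- The state of an edge of the plane: an edge in the first direction counts as open also if there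
is an open detour around it, at height one. -/
def Passable (C : Obs → Prop) (e : Z2Edge) : Prop :=
  if e.2.2 then C (0, e.1, e.2.1) ∨
    (C (2, e.1, e.2.1) ∧ C (2, e.1 + 1, e.2.1) ∧ C (3, e.1, e.2.1))
  else C (1, e.1, e.2.1)

theorem passable_true {C : Obs → Prop} {a b : ℤ} : Passable C (a, b, true) ↔
    C (0, a, b) ∨ (C (2, a, b) ∧ C (2, a + 1, b) ∧ C (3, a, b)) := by simp [Passable]

theorem passable_false {C : Obs → Prop} {a b : ℤ} : Passable C (a, b, false) ↔ C (1, a, b) := by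
  simp [Passable]

variable (E S : Finset Z2Edge) (a b : ℤ)

/-- The passable edges of `E` are those of `S`, and the state of `(a, b, true)` is left open. -/
def Agree (C : Obs → Prop) : Prop := ∀ e ∈ E, e ≠ (a, b, true) → (Passable C e ↔ e ∈ S)

variable {E S a b} {C C' : Obs → Prop}

theorem Agree.toggle_self (hC : ∀ o, C' o ↔ Xor (C o) (o = (0, a, b))) (h : Agree E S a b C) :
    Agree E S a b C' := by
  rintro ⟨a', b', l⟩ he hne
  rw [← h _ he hne]
  cases l
  · simp [passable_false, hC, xor_false_iff]
  · have : ¬ (a' = a ∧ b' = b) := by simpa using hne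
    simp [passable_true, hC, xor_false_iff, this]

/-- An edge of the plane whose state is not its passability can be toggled. -/
theorem Agree.toggle_plane {k : ℤ} (hC : ∀ o, C' o ↔ Xor (C o) (o = (0, a + k, b)))
    (h : Agree E S a b C) (hN : ¬ (C (0, a + k, b) ↔ (a + k, b, true) ∈ S)) :
    Agree E S a b C' := by
  rintro ⟨a', b', l⟩ he hne
  have h1 := h _ he hne
  cases l
  · rw [← h1]; simp [passable_false, hC, xor_false_iff]
  · by_cases h2 : a' = a + k ∧ b' = b
    · obtain ⟨rfl, rfl⟩ := h2
      rw [passable_true] at h1 ⊢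
      simp only [hC, Prod.mk.injEq] at *
      simp [xor_def] at *
      tauto
    · rw [← h1]
      simp [passable_true, hC, xor_false_iff, h2]

/-- The edge at height one is irrelevant for an edge of the plane whose state is its
passability. -/
theorem Agree.toggle_lateral {k : ℤ} (hC : ∀ o, C' o ↔ Xor (C o) (o = (3, a + k, b)))
    (h : Agree E S a b C) (hN : C (0, a + k, b) ↔ (a + k, b, true) ∈ S) (hM : C (3, a + k, b)) :
    Agree E S a b C' := by
  rintro ⟨a', b', l⟩ he hne
  have h1 := h _ he hne
  cases l
  · rw [← h1]; simp [passable_false, hC, xor_false_iff]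
  · by_cases h2 : a' = a + k ∧ b' = b
    · obtain ⟨rfl, rfl⟩ := h2
      rw [passable_true]
      simp [hC, hN, hM, xor_false_iff]
    · rw [← h1]
      simp [passable_true, hC, xor_false_iff, h2]

theorem Agree.toggle_lateral_self (hC : ∀ o, C' o ↔ Xor (C o) (o = (3, a, b)))
    (h : Agree E S a b C) : Agree E S a b C' := by
  rintro ⟨a', b', l⟩ he hne
  rw [← h _ he hne]
  cases l
  · simp [passable_false, hC, xor_false_iff]
  · have : ¬ (a' = a ∧ b' = b) := by simpa using hne
    simp [passable_true, hC, xor_false_iff, this]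

/-- The vertical edges are irrelevant where the edges at height one are closed. -/
theorem Agree.toggle_vertical {k : ℤ}
    (hC : ∀ o, C' o ↔ Xor (C o) (o = (2, a + k, b) ∨ o = (2, a + k + 1, b)))
    (h : Agree E S a b C)
    (hM : ∀ l, k - 1 ≤ l → l ≤ k + 1 → l ≠ 0 → ¬ C (3, a + l, b)) :
    Agree E S a b C' := by
  rintro ⟨a', b', l⟩ he hne
  rw [← h _ he hne]
  cases l
  · simp [passable_false, hC, xor_false_iff]
  · have hne' : ¬ (a' = a ∧ b' = b) := by simpa using hne
    rw [passable_true, passable_true]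
    by_cases h2 : b' = b ∧ a + k - 1 ≤ a' ∧ a' ≤ a + k + 1
    · have h3 := hM (a' - a) (by omega) (by omega) (by omega)
      rw [add_sub_cancel] at h3
      obtain ⟨rfl, -⟩ := h2
      simp [hC, h3, xor_false_iff]
    · have e1 : ¬ (a' = a + k ∧ b' = b) := by omega
      have e2 : ¬ (a' = a + k + 1 ∧ b' = b) := by omega
      have e3 : ¬ (a' + 1 = a + k ∧ b' = b) := by omega
      simp [hC, e1, e2, e3, xor_false_iff]

end Detour

section Weights

variable {d : ℕ} (D : Fin 3 ↪ Fin d)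

/-- The weight of an event that depends on the edges that matter. -/
noncomputable def obsW (x : ℝ) (F : Finset (hypercubicLattice d).edgeSet)
    (P : (Obs → Prop) → Prop) : ℝ :=
  evW (edgeBd _) x F fun η => ind (P (obs D η))

variable {x : ℝ} {F : Finset (hypercubicLattice d).edgeSet}

theorem obsW_nonneg (hx : 0 ≤ x) (P : (Obs → Prop) → Prop) : 0 ≤ obsW D x F P :=
  Finset.sum_nonneg fun _ _ => mul_nonneg (mul_nonneg (by positivity) (ind_nonneg _))
    (ind_nonneg _)

theorem obsW_mono (hx : 0 ≤ x) {P Q : (Obs → Prop) → Prop} (h : ∀ C, P C → Q C) :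
    obsW D x F P ≤ obsW D x F Q :=
  evW_mono _ hx fun _ _ _ => ind_mono (h _)

theorem obsW_add_le (hx : 0 ≤ x) {P Q R : (Obs → Prop) → Prop} (hPQ : ∀ C, P C → ¬ Q C)
    (hP : ∀ C, P C → R C) (hQ : ∀ C, Q C → R C) :
    obsW D x F P + obsW D x F Q ≤ obsW D x F R := by
  rw [obsW, obsW, ← evW_add]
  refine evW_mono _ hx fun η _ _ => ?_
  by_cases h : P (obs D η)
  · rw [ind_of h, ind_of_not (hPQ _ h), ind_of (hP _ h), add_zero]
  · rw [ind_of_not h, zero_add]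
    exact ind_mono (hQ _)

theorem obs_symmDiff [DecidableEq (hypercubicLattice d).edgeSet]
    {η g : Finset (hypercubicLattice d).edgeSet} {T : Obs → Prop}
    (hT : ∀ o, obsEdge D o ∈ g ↔ T o) (o : Obs) :
    obs D (symmDiff η g) o ↔ Xor (obs D η o) (T o) := by
  rw [obs, Finset.mem_symmDiff, hT]; rfl

theorem obsW_toggle (hx : 0 ≤ x) (hx1 : x ≤ 1) {g : Finset (hypercubicLattice d).edgeSet}
    (hg : ∑ e ∈ g, edgeBd _ e = 0) (hgF : g ⊆ F) {k : ℕ} (hk : g.card ≤ k) {T : Obs → Prop}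
    (hT : ∀ o, obsEdge D o ∈ g ↔ T o) {P Q : (Obs → Prop) → Prop}
    (hPQ : ∀ C C', (∀ o, C' o ↔ Xor (C o) (T o)) → P C → Q C') :
    x ^ k * obsW D x F P ≤ obsW D x F Q := by
  classical
  exact evW_toggle (edgeBd_add_self _) hx hx1 hg hgF hk fun η _ _ =>
    hPQ _ _ fun o => obs_symmDiff D hT o

theorem obsW_le_of_toggle (hx : 0 < x) (hx1 : x ≤ 1) {g : Finset (hypercubicLattice d).edgeSet}
    (hg : ∑ e ∈ g, edgeBd _ e = 0) (hgF : g ⊆ F) {k : ℕ} (hk : g.card ≤ k) {T : Obs → Prop}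
    (hT : ∀ o, obsEdge D o ∈ g ↔ T o) {P Q : (Obs → Prop) → Prop}
    (hPQ : ∀ C C', (∀ o, C' o ↔ Xor (C o) (T o)) → P C → ¬ Q C → P C' ∧ Q C') :
    x ^ k * obsW D x F P ≤ 2 * obsW D x F fun C => P C ∧ Q C := by
  classical
  exact evW_le_of_toggle (edgeBd_add_self _) hx hx1 hg hgF hk fun η _ _ =>
    hPQ _ _ fun o => obs_symmDiff D hT o

/-- The edge `(a, b, true)` is closed, and the other edges are passable as prescribed by `S`.
Moreover, at the offsets in `K` from this edge the edges themselves have the prescribed states, and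
at the offsets in `M` the edges at height one are closed, so that there are no detours. -/
def Ready (E S : Finset Z2Edge) (a b : ℤ) (K M : Finset ℤ) (C : Obs → Prop) : Prop :=
  Agree E S a b C ∧ ¬ C (0, a, b) ∧ (∀ k ∈ K, C (0, a + k, b) ↔ (a + k, b, true) ∈ S) ∧
    ∀ k ∈ M, ¬ C (3, a + k, b)

variable {E S : Finset Z2Edge} {a b : ℤ} {N : ℕ}

theorem obsW_ready_insert_plane (hx : 0 < x) (hx1 : x ≤ 1) (ha : |a| + 6 ≤ N) (hb : |b| + 6 ≤ N)
    (K M : Finset ℤ) {k : ℤ} (hk0 : k ≠ 0) (hk : |k| ≤ 2) :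
    x ^ 4 * obsW D x (boxEdgeSet_finite d N).toFinset (Ready E S a b K M) ≤
      2 * obsW D x (boxEdgeSet_finite d N).toFinset (Ready E S a b (insert k K) M) := by
  have hak := abs_add_le a k
  refine (obsW_le_of_toggle D hx hx1 (sum_cycleBelow D (by decide : (0 : Fin 3) ≠ 2) (a + k) b)
    (cycleBelow_zero_subset D (by omega) (by omega)) (card_plaq_le _ _ _)
    (fun o => obsEdge_mem_cycleBelow_zero D)
    (Q := fun C => (C (0, a + k, b) ↔ (a + k, b, true) ∈ S)) ?_).trans
    (mul_le_mul_of_nonneg_left (obsW_mono D hx.le ?_) two_pos.le)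
  · rintro C C' hC ⟨h1, h2, h3, h4⟩ hN
    refine ⟨⟨h1.toggle_plane hC hN, ?_, fun l hl => ?_, fun l hl => ?_⟩, ?_⟩
    · rw [hC]; simpa [xor_false_iff, hk0] using h2
    · have hlk : l ≠ k := fun h => hN (h ▸ h3 l hl)
      rw [hC, ← h3 l hl]; simp [xor_false_iff, hlk]
    · rw [hC]; simpa [xor_false_iff] using h4 l hl
    · rw [hC]; simp only [xor_true_iff]; tauto
  · rintro C ⟨⟨h1, h2, h3, h4⟩, h5⟩
    refine ⟨h1, h2, fun l hl => ?_, h4⟩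
    rcases Finset.mem_insert.1 hl with rfl | hl
    exacts [h5, h3 l hl]

theorem obsW_ready_insert_lateral (hx : 0 < x) (hx1 : x ≤ 1) (ha : |a| + 6 ≤ N) (hb : |b| + 6 ≤ N)
    (K M : Finset ℤ) {k : ℤ} (hkK : k ∈ K) (hk : |k| ≤ 2) :
    x ^ 4 * obsW D x (boxEdgeSet_finite d N).toFinset (Ready E S a b K M) ≤
      2 * obsW D x (boxEdgeSet_finite d N).toFinset (Ready E S a b K (insert k M)) := by
  have hak := abs_add_le a k
  refine (obsW_le_of_toggle D hx hx1 (sum_cycleAbove D (a + k) b)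
    (cycleAbove_subset D (by omega) (by omega)) (card_plaq_le _ _ _)
    (fun o => obsEdge_mem_cycleAbove D) (Q := fun C => ¬ C (3, a + k, b)) ?_).trans
    (mul_le_mul_of_nonneg_left (obsW_mono D hx.le ?_) two_pos.le)
  · rintro C C' hC ⟨h1, h2, h3, h4⟩ hM
    rw [not_not] at hM
    refine ⟨⟨h1.toggle_lateral hC (h3 k hkK) hM, ?_, fun l hl => ?_, fun l hl => ?_⟩, ?_⟩
    · rw [hC]; simpa [xor_false_iff] using h2
    · rw [hC, ← h3 l hl]; simp [xor_false_iff]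
    · have hlk : l ≠ k := fun h => h4 l hl (h ▸ hM)
      rw [hC]; simpa [xor_false_iff, hlk] using h4 l hl
    · rw [hC]; simp only [xor_true_iff]; tauto
  · rintro C ⟨⟨h1, h2, h3, h4⟩, h5⟩
    refine ⟨h1, h2, h3, fun l hl => ?_⟩
    rcases Finset.mem_insert.1 hl with rfl | hl
    exacts [h5, h4 l hl]

/-- Given the passability of all other edges, a closed edge in the first direction has an open
detour with a probability that is bounded from below: nine cycles can be toggled, one after the
other, to open the detour without changing the passability of another edge. -/
theorem obsW_detour (hx : 0 < x) (hx1 : x ≤ 1) (ha : |a| + 6 ≤ N) (hb : |b| + 6 ≤ N) :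
    x ^ 52 * obsW D x (boxEdgeSet_finite d N).toFinset
        (fun C => Agree E S a b C ∧ ¬ C (0, a, b)) ≤
      512 * obsW D x (boxEdgeSet_finite d N).toFinset
        (fun C => (Agree E S a b C ∧ ¬ C (0, a, b)) ∧
          C (2, a, b) ∧ C (2, a + 1, b) ∧ C (3, a, b)) := by
  set F := (boxEdgeSet_finite d N).toFinset
  set w := obsW D x F with hw
  set J : Finset ℤ := {-1, 1, 2} with hJ
  have n1 := obsW_ready_insert_plane (E := E) (S := S) D hx hx1 ha hb ∅ ∅ (k := 2) (by norm_num)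
    (by norm_num)
  have n2 := obsW_ready_insert_plane (E := E) (S := S) D hx hx1 ha hb {2} ∅ (k := 1) (by norm_num)
    (by norm_num)
  have n3 := obsW_ready_insert_plane (E := E) (S := S) D hx hx1 ha hb {1, 2} ∅ (k := -1)
    (by norm_num) (by norm_num)
  have m1 := obsW_ready_insert_lateral (E := E) (S := S) D hx hx1 ha hb J ∅ (k := 2)
    (by simp [hJ]) (by norm_num)
  have m2 := obsW_ready_insert_lateral (E := E) (S := S) D hx hx1 ha hb J {2} (k := 1)
    (by simp [hJ]) (by norm_num)
  have m3 := obsW_ready_insert_lateral (E := E) (S := S) D hx hx1 ha hb J {1, 2} (k := -1)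
    (by simp [hJ]) (by norm_num)
  have ha1 : |a + 1| ≤ |a| + 1 := (abs_add_le a 1).trans (by simp)
  have mem : ∀ l : ℤ, -1 ≤ l → l ≤ 2 → l ≠ 0 → l ∈ J := fun l h1 h2 h3 => by
    simp only [hJ, Finset.mem_insert, Finset.mem_singleton]; omega
  -- open the first vertical edge of the detour
  have v1 : x ^ 12 * w (Ready E S a b J J) ≤ 2 * w fun C => Ready E S a b J J C ∧ C (2, a, b) := by
    refine obsW_le_of_toggle D hx hx1 (sum_cycleAround D a b)
      (cycleAround_subset D (by omega) (by omega)) (card_cycleAround_le D a b)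
      (fun o => obsEdge_mem_cycleAround D) ?_
    rintro C C' hC ⟨h1, h2, h3, h4⟩ hQ
    refine ⟨⟨h1.toggle_vertical (k := 0) (by simpa using hC)
      (fun l _ _ h0 => h4 l (mem l (by omega) (by omega) h0)), ?_, fun l hl => ?_, fun l hl => ?_⟩,
      ?_⟩
    · rw [hC]; simpa [xor_false_iff] using h2
    · rw [hC, ← h3 l hl]; simp [xor_false_iff]
    · rw [hC]; simpa [xor_false_iff] using h4 l hl
    · rw [hC]; simpa [xor_true_iff] using hQ
  -- open the second one
  have v2 : x ^ 12 * w (fun C => Ready E S a b J J C ∧ C (2, a, b)) ≤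
      2 * w fun C => (Ready E S a b J J C ∧ C (2, a, b)) ∧ C (2, a + 1, b) := by
    refine obsW_le_of_toggle D hx hx1 (sum_cycleAround D (a + 1) b)
      (cycleAround_subset D (by omega) (by omega)) (card_cycleAround_le D (a + 1) b)
      (fun o => obsEdge_mem_cycleAround D) ?_
    rintro C C' hC ⟨⟨h1, h2, h3, h4⟩, h5⟩ hQ
    refine ⟨⟨⟨h1.toggle_vertical (k := 1) hC
      (fun l _ _ h0 => h4 l (mem l (by omega) (by omega) h0)), ?_, fun l hl => ?_, fun l hl => ?_⟩,
      ?_⟩, ?_⟩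
    · rw [hC]; simpa [xor_false_iff] using h2
    · rw [hC, ← h3 l hl]; simp [xor_false_iff]
    · rw [hC]; simpa [xor_false_iff] using h4 l hl
    · rw [hC]
      have : ¬ a = a + 1 + 1 := by omega
      simpa [xor_false_iff, this] using h5
    · rw [hC]; simpa [xor_true_iff] using hQ
  -- open the lateral edge
  have v3 : x ^ 4 * w (fun C => (Ready E S a b J J C ∧ C (2, a, b)) ∧ C (2, a + 1, b)) ≤
      2 * w fun C => ((Ready E S a b J J C ∧ C (2, a, b)) ∧ C (2, a + 1, b)) ∧ C (3, a, b) := by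
    refine obsW_le_of_toggle D hx hx1 (sum_cycleAbove D a b)
      (cycleAbove_subset D (by omega) (by omega)) (card_plaq_le _ _ _)
      (fun o => obsEdge_mem_cycleAbove D) ?_
    rintro C C' hC ⟨⟨⟨h1, h2, h3, h4⟩, h5⟩, h6⟩ hQ
    refine ⟨⟨⟨⟨h1.toggle_lateral_self hC, ?_, fun l hl => ?_, fun l hl => ?_⟩, ?_⟩, ?_⟩, ?_⟩
    · rw [hC]; simpa [xor_false_iff] using h2
    · rw [hC, ← h3 l hl]; simp [xor_false_iff]
    · have : l ≠ 0 := by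
        rintro rfl
        simp [hJ] at hl
      rw [hC]; simpa [xor_false_iff, this] using h4 l hl
    · rw [hC]; simpa [xor_false_iff] using h5
    · rw [hC]; simpa [xor_false_iff] using h6
    · rw [hC]; simpa [xor_true_iff] using hQ
  have h0 : w (fun C => Agree E S a b C ∧ ¬ C (0, a, b)) ≤ w (Ready E S a b ∅ ∅) :=
    obsW_mono D hx.le fun C h => ⟨h.1, h.2, by simp, by simp⟩
  have h9 : w (fun C => ((Ready E S a b J J C ∧ C (2, a, b)) ∧ C (2, a + 1, b)) ∧ C (3, a, b)) ≤
      w (fun C => (Agree E S a b C ∧ ¬ C (0, a, b)) ∧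
          C (2, a, b) ∧ C (2, a + 1, b) ∧ C (3, a, b)) :=
    obsW_mono D hx.le fun C ⟨⟨⟨h, h5⟩, h6⟩, h7⟩ => ⟨⟨h.1, h.2.1⟩, h5, h6, h7⟩
  have chain : ∀ {i j : ℕ} {m u v y : ℝ}, x ^ i * u ≤ m * v → x ^ j * v ≤ 2 * y → 0 ≤ m →
      x ^ (j + i) * u ≤ (2 * m) * y := fun {i j m u v y} h1 h2 hm => by
    have e1 := mul_le_mul_of_nonneg_left h1 (pow_nonneg hx.le j)
    have e2 := mul_le_mul_of_nonneg_left h2 hm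
    rw [pow_add, mul_assoc]
    linarith
  have c2 := chain n1 n2 (by norm_num)
  have c3 := chain c2 n3 (by norm_num)
  have c4 := chain c3 m1 (by norm_num)
  have c5 := chain c4 m2 (by norm_num)
  have c6 := chain c5 m3 (by norm_num)
  have c7 := chain c6 v1 (by norm_num)
  have c8 := chain c7 v2 (by norm_num)
  have c9 := chain c8 v3 (by norm_num)
  norm_num at c9
  exact (mul_le_mul_of_nonneg_left h0 (by positivity)).trans
    (c9.trans (mul_le_mul_of_nonneg_left h9 (by norm_num)))

end Weights

section Domination

variable {d : ℕ} (D : Fin 3 ↪ Fin d)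

open Classical in
/-- The passable edges of `E`. -/
noncomputable def passableSet (E : Finset Z2Edge) (C : Obs → Prop) : Finset Z2Edge :=
  E.filter (Passable C)

open Classical in
theorem mem_passableSet {E : Finset Z2Edge} {C : Obs → Prop} {e : Z2Edge} :
    e ∈ passableSet E C ↔ e ∈ E ∧ Passable C e := by
  rw [passableSet, Finset.mem_filter]

theorem passableSet_eq_iff {E S : Finset Z2Edge} (hS : S ⊆ E) {C : Obs → Prop} :
    passableSet E C = S ↔ ∀ e ∈ E, Passable C e ↔ e ∈ S := by
  constructor
  · rintro rfl e he
    simp [mem_passableSet, he]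
  · intro h
    ext e
    rw [mem_passableSet]
    exact ⟨fun he => (h e he.1).1 he.2, fun he => ⟨hS he, (h e (hS he)).2 he⟩⟩

variable {E S : Finset Z2Edge} {a b : ℤ} {C : Obs → Prop}

theorem passableSet_eq_iff_agree (hS : S ⊆ E) (he : (a, b, true) ∈ E) (heS : (a, b, true) ∉ S) :
    passableSet E C = S ↔ Agree E S a b C ∧ ¬ Passable C (a, b, true) := by
  rw [passableSet_eq_iff hS]
  refine ⟨fun h => ⟨fun e h1 _ => h e h1, fun h1 => heS ((h _ he).1 h1)⟩, fun h e h1 => ?_⟩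
  by_cases hne : e = (a, b, true)
  · subst hne; exact iff_of_false h.2 heS
  · exact h.1 e h1 hne

theorem passableSet_eq_insert_iff_agree [DecidableEq Z2Edge] (hS : S ⊆ E)
    (he : (a, b, true) ∈ E) :
    passableSet E C = insert (a, b, true) S ↔ Agree E S a b C ∧ Passable C (a, b, true) := by
  rw [passableSet_eq_iff (Finset.insert_subset he hS)]
  refine ⟨fun h => ⟨fun e h1 hne => ?_, (h _ he).2 (Finset.mem_insert_self _ _)⟩,
    fun h e h1 => ?_⟩
  · rw [h e h1, Finset.mem_insert, or_iff_right hne]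
  · by_cases hne : e = (a, b, true)
    · subst hne; exact iff_of_true h.2 (Finset.mem_insert_self _ _)
    · rw [h.1 e h1 hne, Finset.mem_insert, or_iff_right hne]

/-- A lower bound for the probability that a closed edge in the first direction has an open detour,
valid for `x ^ 52 ≥ 1 / 2`. -/
noncomputable def detourGain : ℝ := 1 / 1024

/-- The parameters of the dominated anisotropic percolation; their sum exceeds one. -/
noncomputable def detourP (l : Bool) : ℝ :=
  if l then 1 / 2 + detourGain / 4 else 1 / 2 - detourGain / 8

variable {x : ℝ} {N : ℕ}

/-- Closed edges in the first direction gain from detours: with `B` the weight of the configurations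
in which the edge is closed, at least `detourGain * B` of it makes the edge passable by a detour. -/
theorem detourP_true_mul_le (hx : x ∈ Set.Icc (1 - detourGain / 16) 1) (ha : |a| + 6 ≤ N)
    (hb : |b| + 6 ≤ N) [DecidableEq Z2Edge] (hS : S ⊆ E) (he : (a, b, true) ∈ E)
    (heS : (a, b, true) ∉ S) :
    detourP true * obsW D x (boxEdgeSet_finite d N).toFinset (fun C => passableSet E C = S) ≤
      (1 - detourP true) * obsW D x (boxEdgeSet_finite d N).toFinset
        (fun C => passableSet E C = insert (a, b, true) S) := by
  have hg : detourGain = 1 / 1024 := rfl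
  have hx0 : 0 < x := by linarith [hx.1]
  have h4 : 1 - detourGain / 4 ≤ x ^ 4 := by
    have := one_add_mul_le_pow (show (-2 : ℝ) ≤ x - 1 by linarith) 4
    push_cast at this
    rw [add_sub_cancel] at this
    linarith [hx.1]
  have h52 : 1 / 2 ≤ x ^ 52 := by
    have := one_add_mul_le_pow (show (-2 : ℝ) ≤ x - 1 by linarith) 52
    push_cast at this
    rw [add_sub_cancel] at this
    linarith [hx.1]
  have hdet := obsW_detour (E := E) (S := S) D hx0 hx.2 ha hb
  simp only [passableSet_eq_iff_agree hS he heS, passableSet_eq_insert_iff_agree hS he,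
    passable_true]
  set w := obsW D x (boxEdgeSet_finite d N).toFinset with hw
  set B := w fun C => Agree E S a b C ∧ ¬ C (0, a, b) with hB
  set R := w fun C => (Agree E S a b C ∧ ¬ C (0, a, b)) ∧
          C (2, a, b) ∧ C (2, a + 1, b) ∧ C (3, a, b) with hR
  set O := w fun C => Agree E S a b C ∧ C (0, a, b) with hO
  set s₀ := w fun C => Agree E S a b C ∧
    ¬ (C (0, a, b) ∨ (C (2, a, b) ∧ C (2, a + 1, b) ∧ C (3, a, b))) with hs₀
  set s₁ := w fun C => Agree E S a b C ∧
    (C (0, a, b) ∨ (C (2, a, b) ∧ C (2, a + 1, b) ∧ C (3, a, b))) with hs₁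
  have hB0 : 0 ≤ B := obsW_nonneg D hx0.le _
  have h1 : s₀ + R ≤ B := obsW_add_le D hx0.le (fun C => by tauto) (fun C => by tauto)
    (fun C => by tauto)
  have h2 : O + R ≤ s₁ := obsW_add_le D hx0.le (fun C => by tauto) (fun C => by tauto)
    (fun C => by tauto)
  have h3 : x ^ 4 * B ≤ O := by
    refine obsW_toggle D hx0.le hx.2 (sum_cycleBelow D (by decide : (0 : Fin 3) ≠ 2) a b)
      (cycleBelow_zero_subset D (by omega) (by omega)) (card_plaq_le _ _ _)
      (fun o => obsEdge_mem_cycleBelow_zero D) ?_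
    rintro C C' hC ⟨h1, h2⟩
    refine ⟨h1.toggle_self hC, ?_⟩
    rw [hC]; simpa [xor_true_iff] using h2
  have h5 : detourGain * B ≤ R := by
    have := mul_le_mul_of_nonneg_right h52 hB0
    rw [hg]; linarith
  have h6 : (1 - detourGain / 4) * B ≤ O := (mul_le_mul_of_nonneg_right h4 hB0).trans h3
  rw [detourP, if_pos rfl]
  rw [hg] at *
  linarith

theorem detourP_false_mul_le (hx : x ∈ Set.Icc (1 - detourGain / 16) 1) (ha : |a| + 6 ≤ N)
    (hb : |b| + 6 ≤ N) [DecidableEq Z2Edge] (hS : S ⊆ E) (he : (a, b, false) ∈ E)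
    (heS : (a, b, false) ∉ S) :
    detourP false * obsW D x (boxEdgeSet_finite d N).toFinset (fun C => passableSet E C = S) ≤
      (1 - detourP false) * obsW D x (boxEdgeSet_finite d N).toFinset
        (fun C => passableSet E C = insert (a, b, false) S) := by
  have hg : detourGain = 1 / 1024 := rfl
  have hx0 : 0 < x := by linarith [hx.1]
  have h4 : 1 - detourGain / 4 ≤ x ^ 4 := by
    have := one_add_mul_le_pow (show (-2 : ℝ) ≤ x - 1 by linarith) 4
    push_cast at this
    rw [add_sub_cancel] at this
    linarith [hx.1]
  have h3 : x ^ 4 * obsW D x (boxEdgeSet_finite d N).toFinset (fun C => passableSet E C = S) ≤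
      obsW D x (boxEdgeSet_finite d N).toFinset
        (fun C => passableSet E C = insert (a, b, false) S) := by
    refine obsW_toggle D hx0.le hx.2 (sum_cycleBelow D (by decide : (1 : Fin 3) ≠ 2) a b)
      (cycleBelow_one_subset D (by omega) (by omega)) (card_plaq_le _ _ _)
      (fun o => obsEdge_mem_cycleBelow_one D) ?_
    intro C C' hC h1
    rw [passableSet_eq_iff hS] at h1
    rw [passableSet_eq_iff (Finset.insert_subset he hS)]
    rintro ⟨a', b', l⟩ h2
    have h3 := h1 _ h2
    cases l
    · by_cases h4 : a' = a ∧ b' = b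
      · obtain ⟨rfl, rfl⟩ := h4
        rw [passable_false] at h3 ⊢
        simp [hC, h3, heS, xor_true_iff]
      · rw [passable_false] at h3 ⊢
        simp [hC, h3, h4, xor_false_iff]
    · rw [passable_true] at h3 ⊢
      simp [hC, h3, xor_false_iff]
  have h0 := obsW_nonneg D (F := (boxEdgeSet_finite d N).toFinset) hx0.le
    (fun C => passableSet E C = S)
  have h5 := (mul_le_mul_of_nonneg_right h4 h0).trans h3
  rw [detourP, if_neg (by decide)]
  rw [hg] at *
  linarith

theorem detourP_pos (l : Bool) : 0 < detourP l := by
  unfold detourP detourGain; split_ifs <;> norm_num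

theorem detourP_lt_one (l : Bool) : detourP l < 1 := by
  unfold detourP detourGain; split_ifs <;> norm_num

/-- The passable edges of the plane dominate anisotropic bond percolation above the self-dual
line. -/
theorem bernE_le_evE_passableSet (hx : x ∈ Set.Icc (1 - detourGain / 16) 1) {n : ℕ}
    (hN : n + 6 ≤ N) {f : Finset Z2Edge → ℝ} (hf : ∀ S T, S ⊆ T → f S ≤ f T) :
    bernE (dirP detourP) (boxEdges n) f ≤ evE (edgeBd _) x (boxEdgeSet_finite d N).toFinset
      (fun η => f (passableSet (boxEdges n) (obs D η))) := by
  have hg : detourGain = 1 / 1024 := rfl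
  refine bernE_le_evE (fun e => (detourP_pos _).le) (fun e => (detourP_lt_one _).le)
    (by linarith [hx.1])
    (fun η e he => (mem_passableSet.1 he).1) ?_ hf
  rintro ⟨a, b, l⟩ he S hS heS
  have hab := mem_boxEdges.1 he
  have ha : |a| + 6 ≤ N := by have : |a| ≤ n := abs_le.2 hab.1; omega
  have hb : |b| + 6 ≤ N := by have : |b| ≤ n := abs_le.2 hab.2; omega
  cases l
  · exact detourP_false_mul_le D hx ha hb hS he heS
  · exact detourP_true_mul_le D hx ha hb hS he heS

theorem adj_of_mem {η : Finset (hypercubicLattice d).edgeSet} {v : Fin d → ℤ} {i : Fin d}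
    (h : edgeOf v i ∈ η) :
    (openSubgraph _ (toConfig _ η)).Adj v (v + Pi.single i 1) :=
  ⟨adj_add_single v i, (toConfig_eq_true _).2 h⟩

theorem reachable_of_passable {η : Finset (hypercubicLattice d).edgeSet} {e : Z2Edge}
    (h : Passable (obs D η) e) :
    (openSubgraph _ (toConfig _ η)).Reachable (pos D (ends2 e).1.1 (ends2 e).1.2 0)
      (pos D (ends2 e).2.1 (ends2 e).2.2 0) := by
  obtain ⟨a, b, _ | _⟩ := e
  · rw [passable_false] at h
    have := adj_of_mem (v := pos D a b 0) (i := D 1) h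
    rw [pos_add_one] at this
    simpa using this.reachable
  · rw [passable_true] at h
    simp only [ends2_true]
    rcases h with h | ⟨h1, h2, h3⟩
    · have := adj_of_mem (v := pos D a b 0) (i := D 0) h
      rw [pos_add_zero] at this
      exact this.reachable
    · have h1 := adj_of_mem (v := pos D a b 0) (i := D 2) h1
      have h2 := adj_of_mem (v := pos D (a + 1) b 0) (i := D 2) h2
      have h3 := adj_of_mem (v := pos D a b 1) (i := D 0) h3
      rw [pos_add_two, zero_add] at h1 h2
      rw [pos_add_zero] at h3
      exact h1.reachable.trans (h3.reachable.trans h2.symm.reachable)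

theorem reachable_of_conn_passableSet {η : Finset (hypercubicLattice d).edgeSet}
    {E : Finset Z2Edge} {u v : ℤ × ℤ}
    (h : Conn ends2 (passableSet E (obs D η) : Set Z2Edge) u v) :
    (openSubgraph _ (toConfig _ η)).Reachable (pos D u.1 u.2 0) (pos D v.1 v.2 0) := by
  induction h with
  | refl => exact SimpleGraph.Reachable.refl _
  | tail h1 h2 ih =>
    rename_i v w
    refine ih.trans ?_
    obtain ⟨e, he, h⟩ := h2
    have := reachable_of_passable D (mem_passableSet.1 he).2
    rcases h with h | h <;> rw [h] at this
    · exact this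
    · exact this.symm

/-- The loop O(1) model in three or more dimensions percolates if `x` is close to one. -/
theorem percolates_of_three_le (hd : 3 ≤ d) (hx : x ∈ Set.Icc (1 - detourGain / 16) 1)
    {μ : Measure (PercConfig (hypercubicLattice d))} (hμ : IsLoopO1Lattice d x μ) :
    0 < μ (connectedToInfinity (hypercubicLattice d) 0) := by
  have hg : detourGain = 1 / 1024 := rfl
  have hx0 : 0 ≤ x := by linarith [hx.1]
  set D : Fin 3 ↪ Fin d := Fin.castLEEmb hd
  obtain ⟨c, hc, hcK⟩ := exists_pos_le_bernE_conn detourP_pos detourP_lt_one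
    (by rw [detourP, detourP, if_pos rfl, if_neg (by decide), hg]; norm_num)
  refine connectedToInfinity_pos ⟨hx0, hx.2⟩ hμ {0} hc fun n => ?_
  filter_upwards [eventually_ge_atTop (n + 6)] with N hN
  refine (hcK n _ subset_rfl).trans ((bernE_le_evE_passableSet D hx hN
    (f := fun S => ind (∃ b ∈ far 0 n, Conn ends2 (S : Set Z2Edge) 0 b)) ?_).trans ?_)
  · exact fun S T h => ind_mono fun ⟨b, hb, hS⟩ => ⟨b, hb, hS.mono (by exact_mod_cast h)⟩
  · refine evE_mono _ hx0 fun η _ _ => ?_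
    rw [Finset.sum_singleton]
    refine ind_mono fun ⟨b, hb, h⟩ => ?_
    have hr := reachable_of_conn_passableSet D h
    have h0 : pos D (0 : ℤ × ℤ).1 (0 : ℤ × ℤ).2 0 = 0 := by simp [pos]
    rw [h0] at hr
    simp only [mem_far, Prod.fst_zero, Prod.snd_zero, sub_zero] at hb
    rcases hb with hb | hb
    · exact mem_pathEvent_of_reachable (i := D 0) (by simpa [pos_apply_zero] using hb) hr
    · exact mem_pathEvent_of_reachable (i := D 1) (by simpa [pos_apply_one] using hb) hr

end Domination

theorem mainTheorem4 (d : ℕ) (hd : 2 ≤ d) :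
    (∀ x ∈ Set.Icc (0 : ℝ) 1, ∃! μ : Measure (PercConfig (hypercubicLattice d)),
      IsLoopO1Lattice d x μ) ∧
    ∃ x₁ x₀ : ℝ, 0 < x₁ ∧ x₁ ≤ x₀ ∧ x₀ < 1 ∧
      (∀ x ∈ Set.Ioc x₀ 1, ∀ μ : Measure (PercConfig (hypercubicLattice d)),
        IsLoopO1Lattice d x μ → 0 < μ (connectedToInfinity (hypercubicLattice d) 0)) ∧
      (∀ x ∈ Set.Ico 0 x₁, ∀ μ : Measure (PercConfig (hypercubicLattice d)),
        IsLoopO1Lattice d x μ → μ (connectedToInfinity (hypercubicLattice d) 0) = 0) := by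
  have hg0 := enhGain_pos
  have hg : enhGain / 2 ≤ detourGain / 16 ∧ enhGain ≤ 1 / 4 := by
    unfold enhGain detourGain; norm_num
  have hd' : (2 : ℝ) ≤ d := by exact_mod_cast hd
  refine ⟨fun x hx => existsUnique_isLoopO1Lattice hx, 1 / (2 * d), 1 - enhGain / 2, by positivity,
    ?_, by linarith, fun x hx μ hμ => ?_, fun x hx μ hμ => ?_⟩
  · have : 1 / (2 * (d : ℝ)) ≤ 1 / 4 := one_div_le_one_div_of_le (by norm_num) (by linarith)
    linarith
  · rcases hd.eq_or_lt with rfl | hd3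
    · exact percolates_two hx hμ
    · exact percolates_of_three_le hd3 ⟨by linarith [hx.1], hx.2⟩ hμ
  · have h1 : 2 * (d : ℝ) * x < 1 := by
      have := mul_lt_mul_of_pos_left hx.2 (show (0 : ℝ) < 2 * d by positivity)
      rwa [mul_one_div_cancel (by positivity)] at this
    exact connectedToInfinity_eq_zero ⟨hx.1, by nlinarith [hx.1]⟩ h1 hμ
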